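/- Let $(M,g)$ be a smooth $n$-dimensional manifold with a smooth metric of arbitrary signature, with Levi-Civita connection $\nabla$ and Weyl tensor $C$. Let $Y$ be a smooth conformal Killing-Yano (CKY) 2-form, i.e. for some 1-form $h$, $$\nabla_a Y_{bc}+\nabla_b Y_{ac}=2g_{ab}h_c-g_{ac}h_b-g_{bc}h_a .$$ (1) If $n\ge 3$, then everywhere on $M$ $$C^f{}_{acb}Y_{df}+C^f{}_{bda}Y_{cf}+C^f{}_{cad}Y_{bf}+C^f{}_{dbc}Y_{af}=0 .$$ Now let $n=4$ and choose an orientation locally. Complex bivectors split into the two three-dimensional eigenspaces $\Lambda^{\pm}$ of the Hodge star (eigenvalues $\pm1$ if $\det g>0$, $\pm i$ if $\det g<0$). Write $Y=Y^++Y^-$ accordingly. The operator $B_{ab}\mapsto\frac12 C_{ab}{}^{cd}B_{cd}$ preserves $\Lambda^\pm$; let $C^\pm$ be its (trace-free) restrictions. At a point, $C^+$ or $C^-$ is of type $O$ if it is zero; $N$ if it is non-zero with square zero; $III$ if it is nilpotent with non-zero square; $D$ if it is diagonalizable with eigenvalues $\lambda,\lambda,-2\lambda$, $\lambda\neq0$;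 $II$ if it has these eigenvalues but is not diagonalizable; $I$ if it has three distinct eigenvalues. The type of the Weyl tensor at the point is the unordered pair of the types of $C^+$ and $C^-$; if the metric is Lorentzian and both are equal to $T$, $T$ is called the Petrov type. Let $x\in M$. (2) If $Y^+$ (respectively $Y^-$) does not vanish identically on any neighbourhood of $x$, then $C^+$ (respectively $C^-$) is of type $O$, $N$ or $D$ at $x$. (3) If neither $Y^+$ nor $Y^-$ vanishes identically on any neighbourhood of $x$, then the type of the Weyl tensor at $x$ is one of $(O,O)$, $(O,N)$, $(O,D)$, $(N,N)$, $(N,D)$, $(D,D)$. (4) If $g$ is Lorentzian at $x$ and $Y$ does not vanish identically on any neighbourhood of $x$, then the Petrov type at $x$ is $O$, $N$ or $D$. (5) If $g$ is definite (Euclidean signature) at $x$ and neither $Y^+$ nor $Y^-$ vanishes identically on any neighbourhood of $x$, then the type of the Weyl tensor at $x$ is one of $(O,O)$, $(O,D)$, $(D,D)$. -/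

import Mathlib

open scoped Manifold ContDiff Topology

universe u

noncomputable section

/-! ### Tensor calculus in coordinates

`G` is a matrix-valued function on (an open subset of) `ℝⁿ`, the components `g_{ij}` of a metric. -/

namespace CKY

/-- The model space `ℝⁿ`. -/
abbrev E (n : ℕ) : Type := EuclideanSpace ℝ (Fin n)

/-- The partial derivative `∂_i f`. -/
def pd {n : ℕ} (i : Fin n) (f : E n → ℝ) (y : E n) : ℝ :=
  fderiv ℝ f y (EuclideanSpace.single i 1)

/-- The Christoffel symbols `Γ^k_{ij}` of the Levi-Civita connection. -/
def christoffel {n : ℕ} (G : E n → Matrix (Fin n) (Fin n) ℝ) (k i j : Fin n) (y : E n) : ℝ :=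
  (1 / 2) * ∑ l, (G y)⁻¹ k l *
    (pd i (fun z => G z j l) y + pd j (fun z => G z i l) y - pd l (fun z => G z i j) y)

/-- The Riemann tensor `R^r_{smk}`, with the convention
`R^r_{smk} = ∂_m Γ^r_{ks} - ∂_k Γ^r_{ms} + Γ^r_{ml} Γ^l_{ks} - Γ^r_{kl} Γ^l_{ms}`. -/
def riemannUp {n : ℕ} (G : E n → Matrix (Fin n) (Fin n) ℝ) (y : E n) (r s m k : Fin n) : ℝ :=
  pd m (christoffel G r k s) y - pd k (christoffel G r m s) y
    + ∑ l, (christoffel G r m l y * christoffel G l k s y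
        - christoffel G r k l y * christoffel G l m s y)

/-- The Riemann tensor with all indices lowered, `R_{abcd}`. -/
def riemann {n : ℕ} (G : E n → Matrix (Fin n) (Fin n) ℝ) (y : E n) (a b c d : Fin n) : ℝ :=
  ∑ r, G y a r * riemannUp G y r b c d

/-- The Ricci tensor `R_{ab} = R^r_{arb}`. -/
def ricci {n : ℕ} (G : E n → Matrix (Fin n) (Fin n) ℝ) (y : E n) (a b : Fin n) : ℝ :=
  ∑ r, riemannUp G y r a r b

/-- The scalar curvature. -/
def scalarCurv {n : ℕ} (G : E n → Matrix (Fin n) (Fin n) ℝ) (y : E n) : ℝ :=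
  ∑ a, ∑ b, (G y)⁻¹ a b * ricci G y a b

/-- The Weyl tensor `C_{abcd}` (for `n ≥ 3`). -/
def weyl {n : ℕ} (G : E n → Matrix (Fin n) (Fin n) ℝ) (y : E n) (a b c d : Fin n) : ℝ :=
  riemann G y a b c d
    - 1 / ((n : ℝ) - 2) *
      (G y a c * ricci G y b d - G y a d * ricci G y b c
        + G y b d * ricci G y a c - G y b c * ricci G y a d)
    + scalarCurv G y / (((n : ℝ) - 1) * ((n : ℝ) - 2)) *
      (G y a c * G y b d - G y a d * G y b c)

/-- The Weyl tensor with its first index raised, `C^f_{abc}`. -/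
def weylUp {n : ℕ} (G : E n → Matrix (Fin n) (Fin n) ℝ) (y : E n) (f a b c : Fin n) : ℝ :=
  ∑ r, (G y)⁻¹ f r * weyl G y r a b c

/-- The covariant derivative `∇_a Y_{bc}` of a covariant tensor field of rank two. -/
def covDeriv {n : ℕ} (G Y : E n → Matrix (Fin n) (Fin n) ℝ) (y : E n) (a b c : Fin n) : ℝ :=
  pd a (fun z => Y z b c) y
    - ∑ d, (christoffel G d a b y * Y y d c + christoffel G d a c y * Y y b d)

/-! ### Metrics and 2-forms on a manifold -/

/-- The smooth charts of a smooth manifold. -/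
abbrev charts (n : ℕ) (M : Type u) [TopologicalSpace M] [ChartedSpace (E n) M] :
    Set (OpenPartialHomeomorph M (E n)) :=
  IsManifold.maximalAtlas (𝓡 n) ∞ M

/-- The coordinate vector field `∂_i` of the chart `e`, at the point with coordinates `y`. -/
def coordVec {n : ℕ} {M : Type u} [TopologicalSpace M] [ChartedSpace (E n) M]
    (e : OpenPartialHomeomorph M (E n)) (y : E n) (i : Fin n) :
    TangentSpace (𝓡 n) (e.symm y) :=
  mfderiv (𝓡 n) (𝓡 n) e.symm y (EuclideanSpace.single i (1 : ℝ) : E n)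

/-- The components `B(∂_i, ∂_j)` in the chart `e` of a field `B` of bilinear forms. -/
def comp {n : ℕ} {M : Type u} [TopologicalSpace M] [ChartedSpace (E n) M]
    (B : ∀ x : M, LinearMap.BilinForm ℝ (TangentSpace (𝓡 n) x))
    (e : OpenPartialHomeomorph M (E n)) (y : E n) : Matrix (Fin n) (Fin n) ℝ :=
  Matrix.of fun i j => B (e.symm y) (coordVec e y i) (coordVec e y j)

/-- A field of bilinear forms is smooth if its components in every smooth chart are. -/
def SmoothField {n : ℕ} {M : Type u} [TopologicalSpace M] [ChartedSpace (E n) M]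
    (B : ∀ x : M, LinearMap.BilinForm ℝ (TangentSpace (𝓡 n) x)) : Prop :=
  ∀ e ∈ charts n M, ∀ i j, ContDiffOn ℝ ∞ (fun y => comp B e y i j) e.target

/-- A smooth metric of arbitrary signature. -/
structure Metric (n : ℕ) (M : Type u) [TopologicalSpace M] [ChartedSpace (E n) M] where
  /-- The bilinear form on each tangent space. -/
  val : ∀ x : M, LinearMap.BilinForm ℝ (TangentSpace (𝓡 n) x)
  symm : ∀ x, (val x).IsSymm
  nondegenerate : ∀ x, (val x).Nondegenerate
  smooth : SmoothField val

/-- A smooth (real) 2-form. -/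
structure TwoForm (n : ℕ) (M : Type u) [TopologicalSpace M] [ChartedSpace (E n) M] where
  /-- The alternating form on each tangent space. -/
  val : ∀ x : M, LinearMap.BilinForm ℝ (TangentSpace (𝓡 n) x)
  alt : ∀ x, (val x).IsAlt
  smooth : SmoothField val

/-- `Y` is a conformal Killing-Yano 2-form of the metric `g`: for some field `h` of covectors,
`∇_a Y_{bc} + ∇_b Y_{ac} = 2 g_{a[b} h_{c]} + 2 g_{b[a} h_{c]}`
(the right hand side is `2 g_{ab} h_c - g_{ac} h_b - g_{bc} h_a`), in every smooth chart. -/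
def IsCKY {n : ℕ} {M : Type u} [TopologicalSpace M] [ChartedSpace (E n) M]
    (g : Metric n M) (Y : TwoForm n M) : Prop :=
  ∃ h : ∀ x : M, TangentSpace (𝓡 n) x →ₗ[ℝ] ℝ,
    ∀ e ∈ charts n M, ∀ y ∈ e.target, ∀ a b c : Fin n,
      covDeriv (comp g.val e) (comp Y.val e) y a b c
          + covDeriv (comp g.val e) (comp Y.val e) y b a c =
        (comp g.val e y a b * h (e.symm y) (coordVec e y c)
            - comp g.val e y a c * h (e.symm y) (coordVec e y b))
          + (comp g.val e y b a * h (e.symm y) (coordVec e y c)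
            - comp g.val e y b c * h (e.symm y) (coordVec e y a))

/-- In some basis of the tangent space at `x` the metric is `diag η`. -/
def HasSignatureAt {n : ℕ} {M : Type u} [TopologicalSpace M] [ChartedSpace (E n) M]
    (g : Metric n M) (x : M) (η : Fin n → ℝ) : Prop :=
  ∃ b : Module.Basis (Fin n) ℝ (TangentSpace (𝓡 n) x),
    ∀ i j, g.val x (b i) (b j) = if i = j then η i else 0

/-- Lorentzian signature in dimension four (with either overall sign of the metric). -/
def IsLorentzianAt {M : Type u} [TopologicalSpace M] [ChartedSpace (E 4) M]
    (g : Metric 4 M) (x : M) : Prop :=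
  HasSignatureAt g x ![-1, 1, 1, 1] ∨ HasSignatureAt g x ![1, -1, -1, -1]

/-- Euclidean signature in dimension four (with either overall sign of the metric). -/
def IsEuclideanAt {M : Type u} [TopologicalSpace M] [ChartedSpace (E 4) M]
    (g : Metric 4 M) (x : M) : Prop :=
  HasSignatureAt g x ![1, 1, 1, 1] ∨ HasSignatureAt g x ![-1, -1, -1, -1]

/-! ### Algebraic types of the Weyl tensor in dimension four

Here `G` is the matrix of components of the metric at one point; a complex bivector is given by its
covariant components `B_{ab}`. -/

/-- The Levi-Civita symbol: the sign of `(a, b, c, d)` as a permutation of `(0, 1, 2, 3)`, and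
zero if two entries agree. -/
def leviCivita (a b c d : Fin 4) : ℝ :=
  Matrix.det (Matrix.of fun i j : Fin 4 => if ![a, b, c, d] i = j then (1 : ℝ) else 0)

/-- The volume form `ε_{abcd}` of the metric, in the orientation of the coordinates. -/
def volForm (G : Matrix (Fin 4) (Fin 4) ℝ) (a b c d : Fin 4) : ℝ :=
  Real.sqrt |G.det| * leviCivita a b c d

/-- The operator `B_{ab} ↦ (1/2) K_{ab}^{cd} B_{cd}` attached to a covariant tensor `K_{abcd}`. -/
def bivectorOp (G : Matrix (Fin 4) (Fin 4) ℝ) (K : Fin 4 → Fin 4 → Fin 4 → Fin 4 → ℝ) :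
    Module.End ℂ (Matrix (Fin 4) (Fin 4) ℂ) where
  toFun B := Matrix.of fun a b => (1 / 2 : ℂ) *
    ∑ p, ∑ q, ∑ c, ∑ d, ((K a b p q * G⁻¹ p c * G⁻¹ q d : ℝ) : ℂ) * B c d
  map_add' B B' := by
    ext a b
    simp [mul_add, Finset.sum_add_distrib]
  map_smul' r B := by
    ext a b
    simp only [Matrix.of_apply, Matrix.smul_apply, smul_eq_mul, RingHom.id_apply, Finset.mul_sum]
    refine Finset.sum_congr rfl fun p _ => Finset.sum_congr rfl fun q _ =>
      Finset.sum_congr rfl fun c _ => Finset.sum_congr rfl fun d _ => ?_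
    ring

/-- The Hodge star `(⋆B)_{ab} = (1/2) ε_{ab}^{cd} B_{cd}`. -/
def hodgeStar (G : Matrix (Fin 4) (Fin 4) ℝ) : Module.End ℂ (Matrix (Fin 4) (Fin 4) ℂ) :=
  bivectorOp G (volForm G)

/-- The eigenvalue of the Hodge star on self-dual (`σ = 1`) and anti-self-dual (`σ = -1`)
bivectors: `⋆⋆` is multiplication by the sign of `det G`, so it is `± 1` if `det G > 0`
and `± i` if `det G < 0`. -/
def dualEigenvalue (G : Matrix (Fin 4) (Fin 4) ℝ) (σ : ℤˣ) : ℂ :=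
  ((σ : ℤ) : ℂ) * (if 0 < G.det then 1 else Complex.I)

/-- The space of self-dual (`σ = 1`) or anti-self-dual (`σ = -1`) complex bivectors. (Every
matrix in the range of the Hodge star is skew, so no skewness condition is needed.) -/
def halfBivectors (G : Matrix (Fin 4) (Fin 4) ℝ) (σ : ℤˣ) :
    Submodule ℂ (Matrix (Fin 4) (Fin 4) ℂ) :=
  Module.End.eigenspace (hodgeStar G) (dualEigenvalue G σ)

/-- The self-dual (`σ = 1`) or anti-self-dual (`σ = -1`) part of a real bivector. -/
def halfPart (G : Matrix (Fin 4) (Fin 4) ℝ) (σ : ℤˣ) (B : Matrix (Fin 4) (Fin 4) ℝ) :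
    Matrix (Fin 4) (Fin 4) ℂ :=
  (1 / 2 : ℂ) • (B.map Complex.ofReal
    + (dualEigenvalue G σ)⁻¹ • hodgeStar G (B.map Complex.ofReal))

/-- The Petrov types of one half (self-dual or anti-self-dual) of the Weyl tensor. -/
inductive PetrovType
  | O | N | D | III | II | I

open PetrovType in
/-- The canonical forms of a trace-free operator on a three-dimensional complex space. -/
def PetrovType.normalForms : PetrovType → Set (Matrix (Fin 3) (Fin 3) ℂ)
  | O => {0}
  | N => {!![0, 1, 0; 0, 0, 0; 0, 0, 0]}
  | D => {J | ∃ l : ℂ, l ≠ 0 ∧ J = !![l, 0, 0; 0, l, 0; 0, 0, -2 * l]}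
  | III => {!![0, 1, 0; 0, 0, 1; 0, 0, 0]}
  | II => {J | ∃ l : ℂ, l ≠ 0 ∧ J = !![l, 1, 0; 0, l, 0; 0, 0, -2 * l]}
  | I => {J | ∃ l m k : ℂ, l ≠ m ∧ m ≠ k ∧ k ≠ l ∧ l + m + k = 0 ∧
      J = !![l, 0, 0; 0, m, 0; 0, 0, k]}

/-- The operator `T` acts on the space `S` with the canonical form `t`. -/
def ActsWithType {V : Type*} [AddCommGroup V] [Module ℂ V] (T : Module.End ℂ V)
    (S : Submodule ℂ V) (t : PetrovType) : Prop :=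
  ∃ b : Module.Basis (Fin 3) ℂ S, ∃ J ∈ t.normalForms,
    ∀ j, T (b j : V) = ∑ i, J i j • (b i : V)

/-- The half of the Weyl tensor of `g` at `x` given by `σ` (self-dual for `σ = 1`, anti-self-dual
for `σ = -1`, with respect to the orientation of the chart `e`) is of Petrov type `t`: the Weyl
operator `B_{ab} ↦ (1/2) C_{ab}^{cd} B_{cd}` acts on that half of the complex bivectors with
the canonical form `t`. -/
def HalfWeylHasType {M : Type u} [TopologicalSpace M] [ChartedSpace (E 4) M]
    (g : Metric 4 M) (e : OpenPartialHomeomorph M (E 4)) (x : M) (σ : ℤˣ) (t : PetrovType) :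
    Prop :=
  ActsWithType (bivectorOp (comp g.val e (e x)) (weyl (comp g.val e) (e x)))
    (halfBivectors (comp g.val e (e x)) σ) t

/-- The Weyl tensor of `g` at `x` is of type `(t₁, t₂)`: one of its two halves has type `t₁` and
the other has type `t₂`. As the order of the halves depends on the orientation, the pair is
unordered. -/
def WeylHasType {M : Type u} [TopologicalSpace M] [ChartedSpace (E 4) M]
    (g : Metric 4 M) (e : OpenPartialHomeomorph M (E 4)) (x : M) (w : Sym2 PetrovType) : Prop :=
  ∃ t₁ t₂ : PetrovType, HalfWeylHasType g e x 1 t₁ ∧ HalfWeylHasType g e x (-1) t₂ ∧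
    w = s(t₁, t₂)

/-- The self-dual (`σ = 1`) or anti-self-dual (`σ = -1`) part, in the orientation of the chart `e`,
of the 2-form `Y` does not vanish identically on any neighbourhood of `x`. -/
def HalfNonzeroNear {M : Type u} [TopologicalSpace M] [ChartedSpace (E 4) M]
    (g : Metric 4 M) (Y : TwoForm 4 M) (e : OpenPartialHomeomorph M (E 4)) (x : M) (σ : ℤˣ) :
    Prop :=
  ∃ᶠ z in 𝓝 x, halfPart (comp g.val e (e z)) σ (comp Y.val e (e z)) ≠ 0

end CKY

end

/-! Differentiate the conformal Killing-Yano equation once. The tensor `∇_d ∇_a Y_{bc} - g_{ab} ∇_d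
h_c + g_{ac} ∇_d h_b` is skew in its last three indices, so the Ricci identity and the first Bianchi
identity express the action of the Riemann tensor on `Y` by the metric and the symmetrized `∇h`
alone (`CKYOn.curvatureAction_riemann`). The Ricci part of the curvature contributes a term of the
same shape `kn` (`exists_curvatureAction_weyl`). So the action of the Weyl tensor on `Y` is some `kn
g Q`; its trace vanishes, and for `n ≥ 3` this forces `kn g Q = 0` (`kn_trace`).

By pair symmetry the resulting identity says that the infinitesimal rotation `Y` annihilates `C`. In
dimension four take a complex frame in which the metric is Euclidean (`exists_isFrame`). There
`so(4, ℂ) = so(3, ℂ) ⊕ so(3, ℂ)`: each half of `C` is a trace-free symmetric 3×3 matrix, the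
corresponding half of `Y` is a vector `y` acting by the cross product, and invariance means that the
matrix commutes with `y ×` (`IsWeylLike.dualMatrix_commute`). If `y ≠ 0`, null or not, such a matrix
is a scalar plus a matrix of rank at most one, hence satisfies a quadratic equation
(`exists_quadratic_of_commute`), and a trace-free operator on a three-dimensional space with this
property is of type `O`, `N` or `D` (`exists_hasNormalForm`).

At a zero of the half of `Y` that is a limit of non-zeros, the conclusion is obtained by closure:
the trace-free part of the square of the half Weyl operator is proportional to the operator itself.
This is the vanishing of 2×2 minors which are continuous and need no frame
(`proportional_of_frequently`), and it implies the quadratic equation again.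

In Lorentzian signature complex conjugation exchanges the two halves, so they have the same type. In
definite signature the 3×3 matrix is real and symmetric, hence cannot be a non-zero nilpotent. -/

noncomputable section

namespace CKY

/-! ### Partial derivatives -/

section PartialDerivatives

variable {n : ℕ} {U : Set (E n)} {f f' : E n → ℝ} {y : E n}

theorem pd_add (i : Fin n) (hf : DifferentiableAt ℝ f y) (hf' : DifferentiableAt ℝ f' y) :
    pd i (fun z => f z + f' z) y = pd i f y + pd i f' y := by
  simp [pd, fderiv_fun_add hf hf']

theorem pd_sub (i : Fin n) (hf : DifferentiableAt ℝ f y) (hf' : DifferentiableAt ℝ f' y) :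
    pd i (fun z => f z - f' z) y = pd i f y - pd i f' y := by
  simp [pd, fderiv_fun_sub hf hf']

theorem pd_mul (i : Fin n) (hf : DifferentiableAt ℝ f y) (hf' : DifferentiableAt ℝ f' y) :
    pd i (fun z => f z * f' z) y = pd i f y * f' y + f y * pd i f' y := by
  simp [pd, fderiv_fun_mul hf hf']
  ring

theorem pd_sum {ι : Type*} (s : Finset ι) (F : ι → E n → ℝ) (i : Fin n)
    (hF : ∀ k ∈ s, DifferentiableAt ℝ (F k) y) :
    pd i (fun z => ∑ k ∈ s, F k z) y = ∑ k ∈ s, pd i (F k) y := by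
  simp [pd, fderiv_fun_sum hF]

theorem pd_congr (i : Fin n) (h : f =ᶠ[𝓝 y] f') : pd i f y = pd i f' y := by
  simp [pd, h.fderiv_eq]

theorem pd_congr_on (hU : IsOpen U) (hy : y ∈ U) (i : Fin n) (h : ∀ z ∈ U, f z = f' z) :
    pd i f y = pd i f' y :=
  pd_congr i (Filter.eventually_of_mem (hU.mem_nhds hy) h)

theorem contDiffOn_pd (hU : IsOpen U) (hf : ContDiffOn ℝ ∞ f U) (i : Fin n) :
    ContDiffOn ℝ ∞ (pd i f) U :=
  (hf.fderiv_of_isOpen hU (m := ∞) (by simp)).clm_apply contDiffOn_const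

theorem differentiableAt_of_contDiffOn (hU : IsOpen U) (hf : ContDiffOn ℝ ∞ f U) (hy : y ∈ U) :
    DifferentiableAt ℝ f y :=
  (hf.contDiffAt (hU.mem_nhds hy)).differentiableAt (by simp)

theorem pd_comm (hU : IsOpen U) (hf : ContDiffOn ℝ ∞ f U) (hy : y ∈ U) (i j : Fin n) :
    pd i (pd j f) y = pd j (pd i f) y := by
  have hc : ContDiffAt ℝ ∞ f y := hf.contDiffAt (hU.mem_nhds hy)
  have hs : IsSymmSndFDerivAt ℝ f y := hc.isSymmSndFDerivAt (by
    have h : ((2 : ℕ∞) : WithTop ℕ∞) ≤ ((⊤ : ℕ∞) : WithTop ℕ∞) := WithTop.coe_le_coe.2 le_top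
    simpa using h)
  have hd : DifferentiableAt ℝ (fderiv ℝ f) y :=
    (hc.fderiv_right (m := ∞) (by simp)).differentiableAt (by simp)
  have key : ∀ k l : Fin n, pd k (pd l f) y =
      fderiv ℝ (fderiv ℝ f) y (EuclideanSpace.single k 1) (EuclideanSpace.single l 1) := by
    intro k l
    have : pd l f = fun z => (fderiv ℝ f z) (EuclideanSpace.single l 1) := rfl
    rw [this, pd, fderiv_clm_apply hd (differentiableAt_const _)]
    simp
  rw [key, key]
  exact hs _ _

end PartialDerivatives

/-! ### Matrix-valued functions -/

section MatrixFunctions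

variable {n : ℕ} {U : Set (E n)} {y : E n}

/-- All entries of a matrix-valued function are smooth on `U`. -/
def SmoothMat (U : Set (E n)) (X : E n → Matrix (Fin n) (Fin n) ℝ) : Prop :=
  ∀ i j, ContDiffOn ℝ ∞ (fun z => X z i j) U

/-- The entrywise partial derivative of a matrix-valued function. -/
def pdMat (i : Fin n) (X : E n → Matrix (Fin n) (Fin n) ℝ) (y : E n) : Matrix (Fin n) (Fin n) ℝ :=
  Matrix.of fun a b => pd i (fun z => X z a b) y

variable {X X' : E n → Matrix (Fin n) (Fin n) ℝ}

theorem SmoothMat.diff (hX : SmoothMat U X) (hU : IsOpen U) (hy : y ∈ U) (a b : Fin n) :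
    DifferentiableAt ℝ (fun z => X z a b) y :=
  differentiableAt_of_contDiffOn hU (hX a b) hy

theorem SmoothMat.mul (hX : SmoothMat U X) (hX' : SmoothMat U X') :
    SmoothMat U fun z => X z * X' z := by
  intro i j
  simp only [Matrix.mul_apply]
  exact ContDiffOn.sum fun k _ => (hX i k).mul (hX' k j)

theorem SmoothMat.sub (hX : SmoothMat U X) (hX' : SmoothMat U X') :
    SmoothMat U fun z => X z - X' z :=
  fun i j => (hX i j).sub (hX' i j)

theorem SmoothMat.transpose (hX : SmoothMat U X) : SmoothMat U fun z => (X z).transpose :=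
  fun i j => hX j i

theorem SmoothMat.pdMat (hU : IsOpen U) (hX : SmoothMat U X) (i : Fin n) :
    SmoothMat U (pdMat i X) :=
  fun a b => contDiffOn_pd hU (hX a b) i

theorem contDiffOn_det {k : ℕ} {X : E n → Matrix (Fin k) (Fin k) ℝ}
    (hX : ∀ i j, ContDiffOn ℝ ∞ (fun z => X z i j) U) :
    ContDiffOn ℝ ∞ (fun z => (X z).det) U := by
  simp only [Matrix.det_apply']
  exact ContDiffOn.sum fun s _ => contDiffOn_const.mul (contDiffOn_prod fun i _ => hX _ _)

/-- Cramer's rule: each entry of the inverse is a quotient of two determinants. -/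
theorem SmoothMat.inv (hX : SmoothMat U X) (hdet : ∀ z ∈ U, (X z).det ≠ 0) :
    SmoothMat U fun z => (X z)⁻¹ := by
  intro i j
  simp only [Matrix.inv_def, Ring.inverse_eq_inv', Matrix.smul_apply, smul_eq_mul,
    Matrix.adjugate_apply]
  refine ((contDiffOn_det hX).inv hdet).mul (contDiffOn_det fun a b => ?_)
  simp only [Matrix.updateRow_apply]
  split_ifs
  · exact contDiffOn_const
  · exact hX a b

theorem pdMat_mul (hU : IsOpen U) (hX : SmoothMat U X) (hX' : SmoothMat U X') (hy : y ∈ U)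
    (i : Fin n) :
    pdMat i (fun z => X z * X' z) y = pdMat i X y * X' y + X y * pdMat i X' y := by
  ext a b
  simp only [pdMat, Matrix.of_apply, Matrix.mul_apply, Matrix.add_apply]
  rw [pd_sum _ _ _ fun k _ => (hX.diff hU hy a k).fun_mul (hX'.diff hU hy k b),
    ← Finset.sum_add_distrib]
  exact Finset.sum_congr rfl fun k _ => pd_mul _ (hX.diff hU hy a k) (hX'.diff hU hy k b)

theorem pdMat_sub (hU : IsOpen U) (hX : SmoothMat U X) (hX' : SmoothMat U X') (hy : y ∈ U)
    (i : Fin n) : pdMat i (fun z => X z - X' z) y = pdMat i X y - pdMat i X' y := by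
  ext a b
  exact pd_sub _ (hX.diff hU hy a b) (hX'.diff hU hy a b)

theorem pdMat_transpose (i : Fin n) :
    pdMat i (fun z => (X z).transpose) y = (pdMat i X y).transpose := rfl

theorem pdMat_congr_on (hU : IsOpen U) (hy : y ∈ U) (i : Fin n) (h : ∀ z ∈ U, X z = X' z) :
    pdMat i X y = pdMat i X' y := by
  ext a b
  exact pd_congr_on hU hy i fun z hz => by rw [h z hz]

theorem pdMat_comm (hU : IsOpen U) (hX : SmoothMat U X) (hy : y ∈ U) (i j : Fin n) :
    pdMat i (pdMat j X) y = pdMat j (pdMat i X) y := by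
  ext a b
  exact pd_comm hU (hX a b) hy i j

end MatrixFunctions

/-! ### The Levi-Civita connection and its curvature -/

section Connection

variable {n : ℕ} {U : Set (E n)} {y : E n} {G X : E n → Matrix (Fin n) (Fin n) ℝ}

/-- The connection matrix `(Γ_i)^k_j`. -/
def connMat (G : E n → Matrix (Fin n) (Fin n) ℝ) (i : Fin n) (y : E n) :
    Matrix (Fin n) (Fin n) ℝ :=
  Matrix.of fun k j => christoffel G k i j y

/-- The curvature matrix `R^r_{s m k}` as a matrix in `r`, `s`. -/
def curvMat (G : E n → Matrix (Fin n) (Fin n) ℝ) (m k : Fin n) (y : E n) :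
    Matrix (Fin n) (Fin n) ℝ :=
  Matrix.of fun r s => riemannUp G y r s m k

/-- The covariant derivative `∇_i X` of a tensor of rank two as a matrix. -/
def covMat (G X : E n → Matrix (Fin n) (Fin n) ℝ) (i : Fin n) (y : E n) :
    Matrix (Fin n) (Fin n) ℝ :=
  Matrix.of fun a b => covDeriv G X y i a b

/-- With the derivative index kept as a label, the covariant derivative is written in the matrix
ring, where the Ricci identity becomes a noncommutative ring computation. -/
theorem covMat_eq (G X : E n → Matrix (Fin n) (Fin n) ℝ) (i : Fin n) (y : E n) :
    covMat G X i y = pdMat i X y - (connMat G i y).transpose * X y - X y * connMat G i y := by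
  ext a b
  simp only [covMat, covDeriv, pdMat, connMat, Matrix.of_apply, Matrix.sub_apply, Matrix.mul_apply,
    Matrix.transpose_apply, Finset.sum_add_distrib]
  simp only [mul_comm (X y a _)]
  ring

theorem connMat_smooth (hU : IsOpen U) (hG : SmoothMat U G) (hdet : ∀ z ∈ U, (G z).det ≠ 0)
    (i : Fin n) : SmoothMat U (connMat G i) := by
  intro k j
  simp only [connMat, Matrix.of_apply, christoffel]
  refine contDiffOn_const.mul (ContDiffOn.sum fun l _ => ((hG.inv hdet) k l).mul ?_)
  exact ((contDiffOn_pd hU (hG j l) i).add (contDiffOn_pd hU (hG i l) j)).sub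
    (contDiffOn_pd hU (hG i j) l)

theorem covMat_smooth (hU : IsOpen U) (hG : SmoothMat U G) (hdet : ∀ z ∈ U, (G z).det ≠ 0)
    (hX : SmoothMat U X) (i : Fin n) : SmoothMat U (covMat G X i) := by
  have h : covMat G X i = fun y =>
      pdMat i X y - (connMat G i y).transpose * X y - X y * connMat G i y :=
    funext fun z => covMat_eq G X i z
  have hc := connMat_smooth hU hG hdet i
  rw [h]
  exact ((hX.pdMat hU i).sub (hc.transpose.mul hX)).sub (hX.mul hc)

theorem curvMat_eq (G : E n → Matrix (Fin n) (Fin n) ℝ) (m k : Fin n) (y : E n) :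
    curvMat G m k y = pdMat m (connMat G k) y - pdMat k (connMat G m) y
      + connMat G m y * connMat G k y - connMat G k y * connMat G m y := by
  ext r s
  simp [curvMat, riemannUp, pdMat, connMat, Matrix.mul_apply, Finset.sum_sub_distrib]
  ring

theorem curvMat_smooth (hU : IsOpen U) (hG : SmoothMat U G) (hdet : ∀ z ∈ U, (G z).det ≠ 0)
    (m k : Fin n) : SmoothMat U (curvMat G m k) := by
  have h : curvMat G m k = fun y => pdMat m (connMat G k) y - pdMat k (connMat G m) y
      - (connMat G k y * connMat G m y - connMat G m y * connMat G k y) :=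
    funext fun z => by rw [curvMat_eq]; abel
  have hc := connMat_smooth hU hG hdet
  rw [h]
  exact (((hc k).pdMat hU m).sub ((hc m).pdMat hU k)).sub
    (((hc k).mul (hc m)).sub ((hc m).mul (hc k)))

/-- The Ricci identity for covariant tensors of rank two (before the derivative index is
corrected by the connection). -/
theorem ricci_identity (hU : IsOpen U) (hG : SmoothMat U G) (hdet : ∀ z ∈ U, (G z).det ≠ 0)
    (hX : SmoothMat U X) (hy : y ∈ U) (i j : Fin n) :
    covMat G (covMat G X j) i y - covMat G (covMat G X i) j y =
      -((curvMat G i j y).transpose * X y + X y * curvMat G i j y) := by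
  have hc := connMat_smooth hU hG hdet
  have key : ∀ i j, covMat G (covMat G X j) i y = pdMat i (pdMat j X) y
      - ((pdMat i (connMat G j) y).transpose * X y + (connMat G j y).transpose * pdMat i X y)
      - (pdMat i X y * connMat G j y + X y * pdMat i (connMat G j) y)
      - (connMat G i y).transpose *
        (pdMat j X y - (connMat G j y).transpose * X y - X y * connMat G j y)
      - (pdMat j X y - (connMat G j y).transpose * X y - X y * connMat G j y) *
        connMat G i y := by
    intro i j
    have h : covMat G X j = fun y =>
        pdMat j X y - (connMat G j y).transpose * X y - X y * connMat G j y :=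
      funext fun z => covMat_eq G X j z
    rw [covMat_eq, h, pdMat_sub hU ((hX.pdMat hU j).sub ((hc j).transpose.mul hX))
      (hX.mul (hc j)) hy, pdMat_sub hU (hX.pdMat hU j) ((hc j).transpose.mul hX) hy,
      pdMat_mul hU (hc j).transpose hX hy, pdMat_mul hU hX (hc j) hy, pdMat_transpose]
  rw [key, key, pdMat_comm hU hX hy i j, curvMat_eq]
  simp only [Matrix.transpose_add, Matrix.transpose_sub, Matrix.transpose_mul]
  noncomm_ring

theorem christoffel_symm (hs : ∀ z, (G z).transpose = G z) (k i j : Fin n) (y : E n) :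
    christoffel G k i j y = christoffel G k j i y := by
  have h : ∀ z a b, G z a b = G z b a := fun z a b => by
    conv_lhs => rw [← hs z]
    rfl
  simp only [christoffel]
  congr 1
  refine Finset.sum_congr rfl fun l _ => ?_
  rw [show (fun z => G z i j) = fun z => G z j i from funext fun z => h z i j]
  ring

/-- The first Bianchi identity. -/
theorem riemannUp_bianchi (hs : ∀ z, (G z).transpose = G z) (y : E n) (r a b c : Fin n) :
    riemannUp G y r a b c + riemannUp G y r b c a + riemannUp G y r c a b = 0 := by
  have h : ∀ i j, christoffel G r i j = christoffel G r j i :=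
    fun i j => funext fun z => christoffel_symm hs r i j z
  have h' : ∀ k i j, christoffel G k i j y = christoffel G k j i y :=
    fun k i j => christoffel_symm hs k i j y
  simp only [riemannUp, Finset.sum_sub_distrib]
  rw [h c a, h b a, h c b]
  simp only [h' _ c a, h' _ b a, h' _ c b]
  ring

theorem riemannUp_skew (G : E n → Matrix (Fin n) (Fin n) ℝ) (y : E n) (r a b c : Fin n) :
    riemannUp G y r a b c = -riemannUp G y r a c b := by
  simp only [riemannUp, Finset.sum_sub_distrib]
  ring

/-- The Levi-Civita connection is metric. -/
theorem covDeriv_metric (hs : ∀ z, (G z).transpose = G z) (hdet : (G y).det ≠ 0)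
    (i a b : Fin n) : covDeriv G G y i a b = 0 := by
  have h : ∀ z a b, G z a b = G z b a := fun z a b => by
    conv_lhs => rw [← hs z]
    rfl
  have hf : ∀ a b, (fun z => G z a b) = fun z => G z b a := fun a b => funext fun z => h z a b
  have hinv : G y * (G y)⁻¹ = 1 := Matrix.mul_nonsing_inv _ (isUnit_iff_ne_zero.mpr hdet)
  -- Lowering the upper index of `Γ` gives the Christoffel symbols of the first kind; two of them
  -- add up to `∂_i g_{ab}`.
  have key : ∀ i a b, ∑ d, christoffel G d i a y * G y d b = (1 / 2) *
      (pd i (fun z => G z a b) y + pd a (fun z => G z i b) y - pd b (fun z => G z i a) y) := by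
    intro i a b
    calc ∑ d, christoffel G d i a y * G y d b
        = ∑ l, (G y * (G y)⁻¹) b l * ((1 / 2) * (pd i (fun z => G z a l) y +
            pd a (fun z => G z i l) y - pd l (fun z => G z i a) y)) := by
          simp only [christoffel, Matrix.mul_apply, Finset.sum_mul, Finset.mul_sum]
          rw [Finset.sum_comm]
          refine Finset.sum_congr rfl fun l _ => Finset.sum_congr rfl fun d _ => ?_
          rw [h y d b]
          ring
      _ = _ := by simp [hinv, Matrix.one_apply]
  simp only [covDeriv, Finset.sum_add_distrib]
  simp only [h y a _]
  rw [key, key, hf i b, hf i a, hf b a]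
  ring

/-- The Ricci identity applied to the metric itself: since `∇g = 0`, its right-hand side, the
symmetrization of the Riemann tensor in its first pair, vanishes. -/
theorem riemann_skew_left (hU : IsOpen U) (hG : SmoothMat U G) (hdet : ∀ z ∈ U, (G z).det ≠ 0)
    (hs : ∀ z, (G z).transpose = G z) (hy : y ∈ U) (a b c d : Fin n) :
    riemann G y a b c d = -riemann G y b a c d := by
  have hz : ∀ i, ∀ z ∈ U, covMat G G i z = 0 := fun i z hz => by
    ext a b
    exact covDeriv_metric hs (hdet z hz) i a b
  have hzz : ∀ i j, covMat G (covMat G G j) i y = 0 := by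
    intro i j
    rw [covMat_eq, pdMat_congr_on hU hy i (hz j), hz j y hy]
    ext a b
    simp [pdMat, pd]
  have hr := ricci_identity hU hG hdet hG hy c d
  rw [hzz, hzz] at hr
  have h := congrFun (congrFun hr a) b
  have hg : ∀ a b, G y a b = G y b a := fun a b => by
    conv_lhs => rw [← hs y]
    rfl
  simp only [sub_zero, Matrix.zero_apply, Matrix.neg_apply, Matrix.add_apply, Matrix.mul_apply,
    Matrix.transpose_apply, curvMat, Matrix.of_apply] at h
  simp only [riemann]
  simp only [mul_comm (riemannUp G y _ _ _ _), hg _ b] at h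
  linarith

end Connection


/-! ### Symmetries of the Riemann, Ricci and Weyl tensors -/

section CurvatureSymmetries

/-- The algebraic symmetries of a curvature tensor. -/
structure IsCurvatureLike {ι R : Type*} [AddCommGroup R] (K : ι → ι → ι → ι → R) : Prop where
  skew_left : ∀ a b c d, K a b c d = -K b a c d
  skew_right : ∀ a b c d, K a b c d = -K a b d c
  bianchi : ∀ a b c d, K a b c d + K a c d b + K a d b c = 0

/-- The octahedron argument: in a combination of the four Bianchi identities that start at `a`, `b`,
`c`, `d`, the other terms cancel by skewness. -/
theorem IsCurvatureLike.pair {ι R : Type*} [Field R] [CharZero R]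
    {K : ι → ι → ι → ι → R} (h : IsCurvatureLike K) (a b c d : ι) : K a b c d = K c d a b := by
  have l := h.skew_left
  have r := h.skew_right
  have e : 2 * K a b c d = 2 * K c d a b := by
    have b1 := h.bianchi a b c d
    have b2 := h.bianchi b c d a
    have b3 := h.bianchi c d a b
    have b4 := h.bianchi d a b c
    grind
  exact mul_left_cancel₀ two_ne_zero e

variable {n : ℕ} {U : Set (E n)} {y : E n} {G : E n → Matrix (Fin n) (Fin n) ℝ}

theorem apply_comm_of_transpose_eq {n : ℕ} {g : Matrix (Fin n) (Fin n) ℝ} (hs : g.transpose = g)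
    (a b : Fin n) : g a b = g b a := by
  conv_lhs => rw [← hs]
  rfl

theorem inv_apply_comm {n : ℕ} {g : Matrix (Fin n) (Fin n) ℝ} (hs : g.transpose = g)
    (a b : Fin n) : g⁻¹ a b = g⁻¹ b a :=
  apply_comm_of_transpose_eq (by rw [Matrix.transpose_nonsing_inv, hs]) a b

theorem sum_inv_mul {n : ℕ} {g : Matrix (Fin n) (Fin n) ℝ} (hdet : g.det ≠ 0) (a b : Fin n) :
    ∑ k, g⁻¹ a k * g k b = if a = b then 1 else 0 := by
  rw [← Matrix.mul_apply, Matrix.nonsing_inv_mul _ (isUnit_iff_ne_zero.mpr hdet), Matrix.one_apply]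

theorem sum_mul_inv {n : ℕ} {g : Matrix (Fin n) (Fin n) ℝ} (hdet : g.det ≠ 0) (a b : Fin n) :
    ∑ k, g a k * g⁻¹ k b = if a = b then 1 else 0 := by
  rw [← Matrix.mul_apply, Matrix.mul_nonsing_inv _ (isUnit_iff_ne_zero.mpr hdet), Matrix.one_apply]

theorem riemann_curvatureLike (hU : IsOpen U) (hG : SmoothMat U G)
    (hdet : ∀ z ∈ U, (G z).det ≠ 0) (hs : ∀ z, (G z).transpose = G z) (hy : y ∈ U) :
    IsCurvatureLike (riemann G y) where
  skew_left := riemann_skew_left hU hG hdet hs hy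
  skew_right a b c d := by
    simp only [riemann, ← Finset.sum_neg_distrib]
    exact Finset.sum_congr rfl fun r _ => by rw [riemannUp_skew G y r b c d, mul_neg]
  bianchi a b c d := by
    simp only [riemann, ← Finset.sum_add_distrib, ← mul_add]
    exact Finset.sum_eq_zero fun r _ => by rw [riemannUp_bianchi hs, mul_zero]

theorem sum_inv_riemann (hdet : (G y).det ≠ 0) (f a b c : Fin n) :
    ∑ r, (G y)⁻¹ f r * riemann G y r a b c = riemannUp G y f a b c := by
  simp only [riemann, Finset.mul_sum, ← mul_assoc]
  rw [Finset.sum_comm]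
  simp [← Finset.sum_mul, sum_inv_mul hdet]

theorem ricci_symm (hdet : (G y).det ≠ 0) (hs : (G y).transpose = G y)
    (hR : IsCurvatureLike (riemann G y)) (a b : Fin n) : ricci G y a b = ricci G y b a := by
  simp only [ricci, ← sum_inv_riemann hdet]
  rw [Finset.sum_comm]
  refine Finset.sum_congr rfl fun r _ => Finset.sum_congr rfl fun f _ => ?_
  rw [inv_apply_comm hs, hR.pair]

/-- The Ricci tensor with its first index raised. -/
def ricciUp (G : E n → Matrix (Fin n) (Fin n) ℝ) (y : E n) (f b : Fin n) : ℝ :=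
  ∑ r, (G y)⁻¹ f r * ricci G y r b

/-- Raising the first index turns the metric into Kronecker deltas, so later contractions with `Y`
or with another index collapse. -/
theorem weylUp_eq (hdet : (G y).det ≠ 0) (f a b c : Fin n) :
    weylUp G y f a b c = riemannUp G y f a b c
      - 1 / ((n : ℝ) - 2) * ((if f = b then 1 else 0) * ricci G y a c
        - (if f = c then 1 else 0) * ricci G y a b
        + G y a c * ricciUp G y f b - G y a b * ricciUp G y f c)
      + scalarCurv G y / (((n : ℝ) - 1) * ((n : ℝ) - 2)) *
        ((if f = b then 1 else 0) * G y a c - (if f = c then 1 else 0) * G y a b) := by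
  rw [← sum_inv_mul hdet f b, ← sum_inv_mul hdet f c, ← sum_inv_riemann hdet]
  simp only [weylUp, weyl, ricciUp, Finset.sum_mul, Finset.mul_sum, ← Finset.sum_add_distrib,
    ← Finset.sum_sub_distrib]
  exact Finset.sum_congr rfl fun r _ => by ring

theorem weyl_curvatureLike (hdet : (G y).det ≠ 0) (hs : (G y).transpose = G y)
    (hR : IsCurvatureLike (riemann G y)) : IsCurvatureLike (weyl G y) := by
  have hg := apply_comm_of_transpose_eq hs
  have hric := ricci_symm hdet hs hR
  refine ⟨fun a b c d => ?_, fun a b c d => ?_, fun a b c d => ?_⟩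
  · simp only [weyl]
    rw [hR.skew_left a b c d]
    ring
  · simp only [weyl]
    rw [hR.skew_right a b c d]
    ring
  · simp only [weyl]
    rw [hg c b, hg d b, hg d c, hric c b, hric d b, hric d c]
    linear_combination hR.bianchi a b c d

theorem weylUp_trace (hn : 3 ≤ n) (hdet : (G y).det ≠ 0) (hs : (G y).transpose = G y)
    (hR : IsCurvatureLike (riemann G y)) (a b : Fin n) : ∑ f, weylUp G y f a f b = 0 := by
  have hn' : (3 : ℝ) ≤ n := by exact_mod_cast hn
  have h1 : (n : ℝ) - 1 ≠ 0 := by linarith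
  have h2 : (n : ℝ) - 2 ≠ 0 := by linarith
  have e1 : ∑ f, ricciUp G y f f = scalarCurv G y := by
    simp only [ricciUp, scalarCurv]
    refine Finset.sum_congr rfl fun f _ => Finset.sum_congr rfl fun r _ => ?_
    rw [ricci_symm hdet hs hR]
  have e2 : ∑ f, G y a f * ricciUp G y f b = ricci G y a b := by
    simp only [ricciUp, Finset.mul_sum, ← mul_assoc]
    rw [Finset.sum_comm]
    simp [← Finset.sum_mul, sum_mul_inv hdet]
  simp only [weylUp_eq hdet, Finset.sum_add_distrib, Finset.sum_sub_distrib, ← Finset.mul_sum]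
  rw [e1, e2]
  simp only [if_true, one_mul, Finset.sum_const, Finset.card_univ, Fintype.card_fin,
    nsmul_eq_mul, ite_mul, zero_mul, Finset.sum_ite_eq', Finset.mem_univ]
  rw [← ricci]
  field_simp
  ring

end CurvatureSymmetries

/-! ### Integrability conditions of the conformal Killing-Yano equation -/

section Integrability

variable {n : ℕ} {U : Set (E n)} {y : E n} {G Y : E n → Matrix (Fin n) (Fin n) ℝ}

/-- The connection term in the covariant derivative of a tensor of rank three. -/
def connTerm (G : E n → Matrix (Fin n) (Fin n) ℝ) (X : Fin n → Fin n → Fin n → ℝ) (y : E n)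
    (d a b c : Fin n) : ℝ :=
  ∑ e, (christoffel G e d a y * X e b c + christoffel G e d b y * X a e c
    + christoffel G e d c y * X a b e)

/-- The second covariant derivative `∇_d ∇_a Y_{bc}`. -/
def covDeriv₂ (G Y : E n → Matrix (Fin n) (Fin n) ℝ) (y : E n) (d a b c : Fin n) : ℝ :=
  pd d (fun z => covDeriv G Y z a b c) y - connTerm G (covDeriv G Y y) y d a b c

/-- The covariant derivative `∇_d h_c`. -/
def covDerivForm (G : E n → Matrix (Fin n) (Fin n) ℝ) (h : E n → Fin n → ℝ) (y : E n)
    (d c : Fin n) : ℝ :=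
  pd d (fun z => h z c) y - ∑ e, christoffel G e d c y * h y e

/-- `ricci_identity` treats the derivative index as a label; the genuine second derivative differs
by a term `Γ^e_{da} ∇_e Y_{bc}`, which drops out of the commutator because the connection is
torsion-free. Skewness of `Y` brings the result to the arrangement of indices used in
`curvatureAction`. -/
theorem covDeriv₂_comm (hU : IsOpen U) (hG : SmoothMat U G) (hdet : ∀ z ∈ U, (G z).det ≠ 0)
    (hs : ∀ z, (G z).transpose = G z) (hY : SmoothMat U Y) (hYs : ∀ z, (Y z).transpose = -Y z)
    (hy : y ∈ U) (d a b c : Fin n) :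
    covDeriv₂ G Y y d a b c - covDeriv₂ G Y y a d b c =
      ∑ f, (riemannUp G y f b d a * Y y c f + riemannUp G y f c a d * Y y b f) := by
  have key : ∀ d a, covDeriv₂ G Y y d a b c = covMat G (covMat G Y a) d y b c
      - ∑ e, christoffel G e d a y * covDeriv G Y y e b c := by
    intro d a
    have h : covMat G (covMat G Y a) d y b c = pd d (fun z => covDeriv G Y z a b c) y
        - ∑ e, (christoffel G e d b y * covDeriv G Y y a e c
          + christoffel G e d c y * covDeriv G Y y a b e) := rfl
    rw [h]
    simp only [covDeriv₂, connTerm, Finset.sum_add_distrib]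
    ring
  have hr := congrFun (congrFun (ricci_identity hU hG hdet hY hy d a) b) c
  simp only [Matrix.sub_apply, Matrix.neg_apply, Matrix.add_apply, Matrix.mul_apply,
    Matrix.transpose_apply, curvMat, Matrix.of_apply] at hr
  rw [key, key]
  simp only [christoffel_symm hs _ a d]
  have hYs' : ∀ f, Y y f c = -Y y c f := fun f => congrFun (congrFun (hYs y) c) f
  simp only [hYs'] at hr
  rw [Finset.sum_add_distrib]
  have e2 : ∑ f, riemannUp G y f c a d * Y y b f = -∑ f, Y y b f * riemannUp G y f c d a := by
    rw [← Finset.sum_neg_distrib]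
    exact Finset.sum_congr rfl fun f _ => by rw [riemannUp_skew G y f c a d]; ring
  simp only [mul_neg, Finset.sum_neg_distrib] at hr
  rw [e2]
  linarith

theorem covDeriv_skew (hYs : ∀ z, (Y z).transpose = -Y z) (z : E n) (a b c : Fin n) :
    covDeriv G Y z a b c = -covDeriv G Y z a c b := by
  have h : ∀ z b c, Y z b c = -Y z c b := fun z b c => congrFun (congrFun (hYs z) c) b
  simp only [covDeriv]
  rw [show (fun z => Y z b c) = fun z => -Y z c b from funext fun z => h z b c]
  have : pd a (fun z => -Y z c b) z = -pd a (fun z => Y z c b) z := by simp [pd]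
  have e : ∑ d, (christoffel G d a b z * Y z d c + christoffel G d a c z * Y z b d) =
      -∑ d, (christoffel G d a c z * Y z d b + christoffel G d a b z * Y z c d) := by
    rw [← Finset.sum_neg_distrib]
    refine Finset.sum_congr rfl fun d _ => ?_
    rw [h z d c, h z b d]
    ring
  rw [this, e]
  ring

theorem covDeriv₂_skew (hYs : ∀ z, (Y z).transpose = -Y z) (d a b c : Fin n) :
    covDeriv₂ G Y y d a b c = -covDeriv₂ G Y y d a c b := by
  have h := covDeriv_skew (G := G) hYs
  simp only [covDeriv₂, connTerm]
  rw [show (fun z => covDeriv G Y z a b c) = fun z => -covDeriv G Y z a c b from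
    funext fun z => h z a b c]
  have : pd d (fun z => -covDeriv G Y z a c b) y = -pd d (fun z => covDeriv G Y z a c b) y := by
    simp [pd]
  have e : ∑ e, (christoffel G e d a y * covDeriv G Y y e b c
        + christoffel G e d b y * covDeriv G Y y a e c
        + christoffel G e d c y * covDeriv G Y y a b e) =
      -∑ e, (christoffel G e d a y * covDeriv G Y y e c b
        + christoffel G e d c y * covDeriv G Y y a e b
        + christoffel G e d b y * covDeriv G Y y a c e) := by
    rw [← Finset.sum_neg_distrib]
    refine Finset.sum_congr rfl fun e _ => ?_
    rw [h y e b c, h y a e c, h y a b e]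
    ring
  rw [this, e]
  ring

/-- `∇_d` of the product of the metric and a covector. -/
theorem metric_mul_covDeriv (hU : IsOpen U) (hG : SmoothMat U G)
    (hdet : ∀ z ∈ U, (G z).det ≠ 0) (hs : ∀ z, (G z).transpose = G z) {h : E n → Fin n → ℝ}
    (hh : ∀ c, ContDiffOn ℝ ∞ (fun z => h z c) U) (hy : y ∈ U) (d a b c : Fin n) :
    pd d (fun z => G z a b * h z c) y - connTerm G (fun a b c => G y a b * h y c) y d a b c =
      G y a b * covDerivForm G h y d c := by
  rw [pd_mul d (hG.diff hU hy a b) (differentiableAt_of_contDiffOn hU (hh c) hy)]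
  have hm := covDeriv_metric hs (hdet y hy) d a b
  have e : connTerm G (fun a b c => G y a b * h y c) y d a b c =
      (∑ e, (christoffel G e d a y * G y e b + christoffel G e d b y * G y a e)) * h y c
        + G y a b * ∑ e, christoffel G e d c y * h y e := by
    simp only [connTerm, Finset.sum_mul, Finset.mul_sum, ← Finset.sum_add_distrib]
    exact Finset.sum_congr rfl fun e _ => by ring
  rw [covDeriv] at hm
  rw [e, covDerivForm]
  linear_combination h y c * hm

/-- The conformal Killing-Yano equation in coordinates. -/
def CKYOn (U : Set (E n)) (G Y : E n → Matrix (Fin n) (Fin n) ℝ) (h : E n → Fin n → ℝ) : Prop :=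
  ∀ y ∈ U, ∀ a b c, covDeriv G Y y a b c + covDeriv G Y y b a c =
    2 * (G y a b * h y c) - G y a c * h y b - G y b c * h y a

theorem covDeriv_smooth (hU : IsOpen U) (hG : SmoothMat U G) (hdet : ∀ z ∈ U, (G z).det ≠ 0)
    (hY : SmoothMat U Y) (a b c : Fin n) :
    ContDiffOn ℝ ∞ (fun z => covDeriv G Y z a b c) U :=
  covMat_smooth hU hG hdet hY a b c

/-- `h` is only assumed to exist pointwise. Contracting the equation with `g^{ab}` gives `2(n - 1)
h_c` in terms of `∇Y`, so `h` is smooth and the equation may be differentiated. -/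
theorem CKYOn.smooth (hn : 3 ≤ n) (hU : IsOpen U) (hG : SmoothMat U G)
    (hdet : ∀ z ∈ U, (G z).det ≠ 0) (hs : ∀ z, (G z).transpose = G z) (hY : SmoothMat U Y)
    {h : E n → Fin n → ℝ} (H : CKYOn U G Y h) (c : Fin n) :
    ContDiffOn ℝ ∞ (fun z => h z c) U := by
  have hn' : (3 : ℝ) ≤ n := by exact_mod_cast hn
  have h1 : (n : ℝ) - 1 ≠ 0 := by linarith
  have hform : ∀ z ∈ U, h z c =
      (2 * ((n : ℝ) - 1))⁻¹ * ∑ a, ∑ b, (G z)⁻¹ a b *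
        (covDeriv G Y z a b c + covDeriv G Y z b a c) := by
    intro z hz
    have hg := apply_comm_of_transpose_eq (hs z)
    have e1 : ∑ a, ∑ b, (G z)⁻¹ a b * (G z a b * h z c) = n * h z c := by
      simp only [← mul_assoc, ← Finset.sum_mul]
      congr 1
      calc ∑ a, ∑ b, (G z)⁻¹ a b * G z a b = ∑ a, ∑ b, (G z)⁻¹ a b * G z b a :=
            Finset.sum_congr rfl fun a _ => Finset.sum_congr rfl fun b _ => by rw [hg]
        _ = n := by simp [sum_inv_mul (hdet z hz)]
    have e2 : ∑ a, ∑ b, (G z)⁻¹ a b * (G z b c * h z a) = h z c := by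
      simp only [← mul_assoc, ← Finset.sum_mul, sum_inv_mul (hdet z hz)]
      simp
    have e3 : ∑ a, ∑ b, (G z)⁻¹ a b * (G z a c * h z b) = h z c := by
      rw [Finset.sum_comm, ← e2]
      exact Finset.sum_congr rfl fun a _ => Finset.sum_congr rfl fun b _ => by
        rw [inv_apply_comm (hs z)]
    have e : ∑ a, ∑ b, (G z)⁻¹ a b * (covDeriv G Y z a b c + covDeriv G Y z b a c) =
        2 * ∑ a, ∑ b, (G z)⁻¹ a b * (G z a b * h z c)
          - ∑ a, ∑ b, (G z)⁻¹ a b * (G z a c * h z b)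
          - ∑ a, ∑ b, (G z)⁻¹ a b * (G z b c * h z a) := by
      simp only [Finset.mul_sum, ← Finset.sum_sub_distrib]
      exact Finset.sum_congr rfl fun a _ => Finset.sum_congr rfl fun b _ => by
        rw [H z hz]
        ring
    rw [e, e1, e2, e3]
    field_simp
    ring
  refine ContDiffOn.congr ?_ hform
  refine contDiffOn_const.mul (ContDiffOn.sum fun a _ => ContDiffOn.sum fun b _ => ?_)
  exact ((hG.inv hdet) a b).mul ((covDeriv_smooth hU hG hdet hY a b c).add
    (covDeriv_smooth hU hG hdet hY b a c))

/-- The covariant derivative of the conformal Killing-Yano equation. -/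
theorem CKYOn.covDeriv₂_add (hU : IsOpen U) (hG : SmoothMat U G)
    (hdet : ∀ z ∈ U, (G z).det ≠ 0) (hs : ∀ z, (G z).transpose = G z) (hY : SmoothMat U Y)
    {h : E n → Fin n → ℝ} (hh : ∀ c, ContDiffOn ℝ ∞ (fun z => h z c) U)
    (H : CKYOn U G Y h) (hy : y ∈ U) (d a b c : Fin n) :
    covDeriv₂ G Y y d a b c + covDeriv₂ G Y y d b a c =
      2 * (G y a b * covDerivForm G h y d c) - G y a c * covDerivForm G h y d b
        - G y b c * covDerivForm G h y d a := by
  have hq := metric_mul_covDeriv hU hG hdet hs hh hy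
  have dq : ∀ a b c, DifferentiableAt ℝ (fun z => G z a b * h z c) y := fun a b c =>
    (hG.diff hU hy a b).fun_mul (differentiableAt_of_contDiffOn hU (hh c) hy)
  have dT : ∀ a b c, DifferentiableAt ℝ (fun z => covDeriv G Y z a b c) y := fun a b c =>
    differentiableAt_of_contDiffOn hU (covDeriv_smooth hU hG hdet hY a b c) hy
  have hg := apply_comm_of_transpose_eq (hs y)
  have ep : pd d (fun z => covDeriv G Y z a b c) y + pd d (fun z => covDeriv G Y z b a c) y =
      pd d (fun z => G z a b * h z c) y + pd d (fun z => G z a b * h z c) y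
        - pd d (fun z => G z a c * h z b) y - pd d (fun z => G z b c * h z a) y := by
    rw [← pd_add d (dT a b c) (dT b a c), ← pd_add d (dq a b c) (dq a b c),
      ← pd_sub d ((dq a b c).fun_add (dq a b c)) (dq a c b),
      ← pd_sub d (((dq a b c).fun_add (dq a b c)).fun_sub (dq a c b)) (dq b c a)]
    exact pd_congr_on hU hy d fun z hz => by rw [H z hz]; ring
  have ec : connTerm G (covDeriv G Y y) y d a b c + connTerm G (covDeriv G Y y) y d b a c =
      2 * connTerm G (fun a b c => G y a b * h y c) y d a b c
        - connTerm G (fun a b c => G y a b * h y c) y d a c b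
        - connTerm G (fun a b c => G y a b * h y c) y d b c a := by
    simp only [connTerm, Finset.mul_sum, ← Finset.sum_add_distrib, ← Finset.sum_sub_distrib]
    refine Finset.sum_congr rfl fun e _ => ?_
    linear_combination christoffel G e d a y * H y hy e b c
      + christoffel G e d b y * H y hy a e c + christoffel G e d c y * H y hy a b e
  simp only [covDeriv₂]
  linear_combination ep - ec + 2 * hq d a b c - hq d a c b - hq d b c a

/-- The left hand side of the integrability condition. -/
def curvatureAction (K : Fin n → Fin n → Fin n → Fin n → ℝ) (Z : Matrix (Fin n) (Fin n) ℝ)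
    (a b c d : Fin n) : ℝ :=
  ∑ f, (K f a c b * Z d f + K f b d a * Z c f + K f c a d * Z b f + K f d b c * Z a f)

/-- The Kulkarni-Nomizu type tensor built from the metric and a symmetric tensor. -/
def kn (g P : Matrix (Fin n) (Fin n) ℝ) (a b c d : Fin n) : ℝ :=
  g a b * (P c d + P d c) + g c d * (P a b + P b a) - g a c * (P b d + P d b)
    - g b d * (P a c + P c a)

/-- The unknown second derivatives of `Y` are eliminated by total skewness: they enter the action
through a combination invariant under cyclic permutation of `a`, `b`, `c`, whereas the cyclic sum of
the action vanishes by the Bianchi identity. -/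
theorem CKYOn.curvatureAction_riemann (hU : IsOpen U) (hG : SmoothMat U G)
    (hdet : ∀ z ∈ U, (G z).det ≠ 0) (hs : ∀ z, (G z).transpose = G z) (hY : SmoothMat U Y)
    (hYs : ∀ z, (Y z).transpose = -Y z)
    {h : E n → Fin n → ℝ} (hh : ∀ c, ContDiffOn ℝ ∞ (fun z => h z c) U)
    (H : CKYOn U G Y h) (hy : y ∈ U) (a b c d : Fin n) :
    curvatureAction (riemannUp G y) (Y y) a b c d =
      kn (G y) (Matrix.of (covDerivForm G h y)) a b c d := by
  have hg := apply_comm_of_transpose_eq (hs y)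
  set P := covDerivForm G h y with hP
  -- `∇∇Y` with its metric part removed. `A1` is the differentiated equation and `A2` the skewness
  -- of `Y`, so `Φ` is skew in its last three indices.
  set Φ : Fin n → Fin n → Fin n → Fin n → ℝ := fun d a b c =>
    covDeriv₂ G Y y d a b c - G y a b * P d c + G y a c * P d b with hΦ
  have A1 : ∀ d a b c, Φ d a b c = -Φ d b a c := fun d a b c => by
    simp only [hΦ]
    rw [hg b a]
    linear_combination H.covDeriv₂_add hU hG hdet hs hY hh hy d a b c
  have A2 : ∀ d a b c, Φ d a b c = -Φ d a c b := fun d a b c => by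
    simp only [hΦ]
    linear_combination covDeriv₂_skew (G := G) (y := y) hYs d a b c
  have A3 : ∀ d a b c, Φ d b c a = Φ d a b c := fun d a b c => by
    rw [A2 d b c a, A1 d b a c, neg_neg]
  -- The four curvature terms are two Ricci identities, for `[∇_d, ∇_a] Y_{bc}` and `[∇_b, ∇_c]
  -- Y_{da}`.
  have hW : ∀ a b c d, curvatureAction (riemannUp G y) (Y y) a b c d =
      (Φ d a b c - Φ a d b c + Φ b c d a - Φ c b d a) + kn (G y) (Matrix.of P) a b c d := by
    intro a b c d
    have h1 := covDeriv₂_comm hU hG hdet hs hY hYs hy d a b c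
    have h2 := covDeriv₂_comm hU hG hdet hs hY hYs hy b c d a
    have e : curvatureAction (riemannUp G y) (Y y) a b c d =
        ∑ f, (riemannUp G y f b d a * Y y c f + riemannUp G y f c a d * Y y b f)
        + ∑ f, (riemannUp G y f d b c * Y y a f + riemannUp G y f a c b * Y y d f) := by
      simp only [curvatureAction, ← Finset.sum_add_distrib]
      exact Finset.sum_congr rfl fun f _ => by ring
    rw [e, ← h1, ← h2]
    simp only [hΦ, kn, Matrix.of_apply]
    rw [hg d b, hg d c, hg b a, hg c a]
    ring
  have hcyc : curvatureAction (riemannUp G y) (Y y) a b c d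
      + curvatureAction (riemannUp G y) (Y y) b c a d
      + curvatureAction (riemannUp G y) (Y y) c a b d = 0 := by
    simp only [curvatureAction, ← Finset.sum_add_distrib]
    refine Finset.sum_eq_zero fun f _ => ?_
    linear_combination Y y d f * riemannUp_bianchi hs y f a c b
      + Y y c f * riemannUp_bianchi hs y f b d a + Y y b f * riemannUp_bianchi hs y f c a d
      + Y y a f * riemannUp_bianchi hs y f d b c
  have w1 := hW a b c d
  have w2 := hW b c a d
  have w3 := hW c a b d
  have k : kn (G y) (Matrix.of P) a b c d + kn (G y) (Matrix.of P) b c a d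
      + kn (G y) (Matrix.of P) c a b d = 0 := by
    simp only [kn]
    rw [hg b a, hg c a, hg c b]
    ring
  -- These relations identify the `Φ` parts of `w1`, `w2` and `w3`. The cyclic sums of the action
  -- and of `kn` vanish, so three times the common `Φ` part is zero.
  have c1 : Φ b c d a = -Φ b d c a := A1 _ _ _ _
  have c2 : Φ c b d a = Φ c a b d := A3 _ _ _ _
  have c3 : Φ d b c a = Φ d a b c := A3 _ _ _ _
  have c4 : Φ d c a b = Φ d a b c := (A3 _ _ _ _).symm
  have c5 : Φ c a d b = -Φ c d a b := A1 _ _ _ _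
  have c6 : Φ a c d b = -Φ a d c b := A1 _ _ _ _
  have c7 : Φ a d c b = -Φ a d b c := A2 _ _ _ _
  have c8 : Φ c a b d = Φ c d a b := A3 _ _ _ _
  have c9 : Φ a b d c = Φ a c b d := A3 _ _ _ _
  have c10 : Φ a b d c = -Φ a d b c := A1 _ _ _ _
  have c11 : Φ b a d c = -Φ b d a c := A1 _ _ _ _
  have c12 : Φ b d a c = -Φ b d c a := A2 _ _ _ _
  linarith

/-- The Weyl part of the curvature acts as the Riemann tensor up to a Kulkarni-Nomizu term. -/
theorem exists_curvatureAction_weyl (hdet : (G y).det ≠ 0) (hs : (G y).transpose = G y)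
    (hYs : (Y y).transpose = -Y y) (hR : IsCurvatureLike (riemann G y)) :
    ∃ Q : Matrix (Fin n) (Fin n) ℝ, ∀ a b c d,
      curvatureAction (weylUp G y) (Y y) a b c d =
        curvatureAction (riemannUp G y) (Y y) a b c d - kn (G y) Q a b c d := by
  have hg := apply_comm_of_transpose_eq hs
  have hYs' : ∀ b c, Y y b c = -Y y c b := fun b c => congrFun (congrFun hYs c) b
  have hric := ricci_symm hdet hs hR
  set k := 1 / ((n : ℝ) - 2) with hk
  set s := scalarCurv G y / (((n : ℝ) - 1) * ((n : ℝ) - 2)) with hs'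
  set q : Fin n → Fin n → ℝ := fun d c => ∑ f, Y y d f * ricciUp G y f c with hq
  have term : ∀ a b c d, ∑ f, weylUp G y f a c b * Y y d f =
      ∑ f, riemannUp G y f a c b * Y y d f - k * (Y y d c * ricci G y a b - Y y d b * ricci G y a c
        + G y a b * q d c - G y a c * q d b) + s * (Y y d c * G y a b - Y y d b * G y a c) := by
    intro a b c d
    have e1 : ∀ c, Y y d c = ∑ f, (if f = c then 1 else 0) * Y y d f := fun c => by simp
    rw [e1 c, e1 b]
    simp only [hq, Finset.mul_sum, Finset.sum_mul, ← Finset.sum_add_distrib,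
      ← Finset.sum_sub_distrib]
    refine Finset.sum_congr rfl fun f _ => ?_
    rw [weylUp_eq hdet]
    ring
  -- `Q` is `Y · Ric / (n - 2)`. The terms `Y ⊗ Ric` and the scalar curvature terms cancel among the
  -- four summands because `Y` is skew.
  refine ⟨Matrix.of fun c d => k * q c d, fun a b c d => ?_⟩
  simp only [curvatureAction, Finset.sum_add_distrib, term, kn, Matrix.of_apply]
  rw [hYs' d c, hYs' d b, hYs' c a, hYs' b a, hric c a, hric d b, hric d c, hric b a, hg b a,
    hg d b, hg d c, hg c a]
  ring

/-! ### Traces of the integrability condition -/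

theorem sum_comm_four {ι R : Type*} [Fintype ι] [AddCommMonoid R] (F : ι → ι → ι → ι → R) :
    ∑ c, ∑ d, ∑ f, ∑ r, F c d f r = ∑ f, ∑ r, ∑ d, ∑ c, F c d f r := by
  have cyc : ∀ H : ι → ι → ι → R, ∑ a, ∑ b, ∑ c, H a b c = ∑ b, ∑ c, ∑ a, H a b c :=
    fun H => by rw [Finset.sum_comm_cycle, Finset.sum_comm_cycle]
  rw [Finset.sum_comm]
  simp only [cyc (fun c f r => F c _ f r)]
  rw [cyc]

/-- Two of the four terms are traces of the Weyl tensor. The other two cancel each other by pair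
symmetry and the skewness of `Y`. -/
theorem curvatureAction_weyl_trace (hn : 3 ≤ n) (hdet : (G y).det ≠ 0)
    (hs : (G y).transpose = G y) (hYs : (Y y).transpose = -Y y)
    (hR : IsCurvatureLike (riemann G y)) (a b : Fin n) :
    ∑ c, ∑ d, (G y)⁻¹ c d * curvatureAction (weylUp G y) (Y y) a b c d = 0 := by
  have hC := weyl_curvatureLike hdet hs hR
  have hYs' : ∀ b c, Y y b c = -Y y c b := fun b c => congrFun (congrFun hYs c) b
  have hi := inv_apply_comm hs
  have htr : ∀ a f, ∑ c, ∑ d, (G y)⁻¹ c d * weylUp G y f c a d = 0 := by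
    intro a f
    simp only [weylUp, Finset.mul_sum]
    have h : ∀ r, ∑ c, ∑ d, (G y)⁻¹ c d * weyl G y r c a d = 0 := by
      intro r
      rw [← weylUp_trace hn hdet hs hR r a, Finset.sum_comm]
      simp only [weylUp]
      refine Finset.sum_congr rfl fun c _ => Finset.sum_congr rfl fun d _ => ?_
      rw [hC.skew_left r d a c, hC.skew_right d r a c, neg_neg, hi]
    calc ∑ c, ∑ d, ∑ r, (G y)⁻¹ c d * ((G y)⁻¹ f r * weyl G y r c a d)
        = ∑ r, (G y)⁻¹ f r * ∑ c, ∑ d, (G y)⁻¹ c d * weyl G y r c a d := by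
          simp only [Finset.mul_sum]
          rw [Finset.sum_comm_cycle]
          exact Finset.sum_congr rfl fun r _ => Finset.sum_congr rfl fun c _ =>
            Finset.sum_congr rfl fun d _ => by ring
      _ = 0 := by simp [h]
  have e34 : ∀ a b, ∑ c, ∑ d, (G y)⁻¹ c d * ∑ f, weylUp G y f c a d * Y y b f = 0 := by
    intro a b
    calc ∑ c, ∑ d, (G y)⁻¹ c d * ∑ f, weylUp G y f c a d * Y y b f
        = ∑ f, Y y b f * ∑ c, ∑ d, (G y)⁻¹ c d * weylUp G y f c a d := by
          simp only [Finset.mul_sum]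
          rw [Finset.sum_comm_cycle]
          exact Finset.sum_congr rfl fun r _ => Finset.sum_congr rfl fun c _ =>
            Finset.sum_congr rfl fun d _ => by ring
      _ = 0 := by simp [htr]
  have e34' : ∀ a b, ∑ c, ∑ d, (G y)⁻¹ c d * ∑ f, weylUp G y f d b c * Y y a f = 0 := by
    intro a b
    rw [← e34 b a, Finset.sum_comm]
    exact Finset.sum_congr rfl fun d _ => Finset.sum_congr rfl fun c _ => by rw [hi]
  have e12 : ∑ c, ∑ d, (G y)⁻¹ c d * ∑ f, weylUp G y f a c b * Y y d f =
      -∑ c, ∑ d, (G y)⁻¹ c d * ∑ f, weylUp G y f b d a * Y y c f := by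
    simp only [weylUp, Finset.mul_sum, Finset.sum_mul, ← Finset.sum_neg_distrib]
    rw [sum_comm_four]
    refine Finset.sum_congr rfl fun f _ => Finset.sum_congr rfl fun r _ =>
      Finset.sum_congr rfl fun d _ => Finset.sum_congr rfl fun c _ => ?_
    rw [hYs' d f, hC.pair r a c b, hi f r, hi c d]
    ring
  simp only [curvatureAction, Finset.sum_add_distrib, mul_add]
  rw [e12, e34, e34']
  ring

/-- Write `P` for twice the symmetric part of `Q` and `p` for its trace. Contraction gives `(n - 2)
P + p g = 0`; contracting again gives `(2n - 2) p = 0`. So `p = 0`, and then `P = 0` because `n ≠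
2`. -/
theorem kn_trace (hn : 3 ≤ n) {g Q : Matrix (Fin n) (Fin n) ℝ} (hdet : g.det ≠ 0)
    (hs : g.transpose = g) (h : ∀ a b, ∑ c, ∑ d, g⁻¹ c d * kn g Q a b c d = 0) (a b : Fin n) :
    Q a b + Q b a = 0 := by
  have hn' : (3 : ℝ) ≤ n := by exact_mod_cast hn
  have h2 : (n : ℝ) - 2 ≠ 0 := by linarith
  have h22 : 2 * (n : ℝ) - 2 ≠ 0 := by linarith
  set P : Fin n → Fin n → ℝ := fun a b => Q a b + Q b a with hP
  set p := ∑ c, ∑ d, g⁻¹ c d * P c d with hp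
  have hg := apply_comm_of_transpose_eq hs
  have hPs : ∀ a b, P a b = P b a := fun a b => add_comm _ _
  have tr : ∑ c, ∑ d, g⁻¹ c d * g c d = n := by
    calc ∑ c, ∑ d, g⁻¹ c d * g c d = ∑ c, ∑ d, g⁻¹ c d * g d c :=
          Finset.sum_congr rfl fun c _ => Finset.sum_congr rfl fun d _ => by rw [hg]
      _ = n := by simp [sum_inv_mul hdet]
  have e1 : ∀ a b, ∑ c, ∑ d, g⁻¹ c d * (g b d * P a c) = P a b := by
    intro a b
    calc ∑ c, ∑ d, g⁻¹ c d * (g b d * P a c) = ∑ c, (∑ d, g⁻¹ c d * g d b) * P a c := by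
          simp only [Finset.sum_mul]
          exact Finset.sum_congr rfl fun c _ => Finset.sum_congr rfl fun d _ => by
            rw [hg b d]; ring
      _ = P a b := by simp [sum_inv_mul hdet]
  have e2 : ∀ a b, ∑ c, ∑ d, g⁻¹ c d * (g a c * P b d) = P a b := by
    intro a b
    rw [hPs, ← e1 b a, Finset.sum_comm]
    exact Finset.sum_congr rfl fun d _ => Finset.sum_congr rfl fun c _ => by
      rw [inv_apply_comm hs]
  have main : ∀ a b, ((n : ℝ) - 2) * P a b = -(p * g a b) := by
    intro a b
    have h0 : ∑ c, ∑ d, g⁻¹ c d * kn g Q a b c d = g a b * p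
        + (∑ c, ∑ d, g⁻¹ c d * g c d) * P a b - ∑ c, ∑ d, g⁻¹ c d * (g a c * P b d)
        - ∑ c, ∑ d, g⁻¹ c d * (g b d * P a c) := by
      simp only [hp, Finset.mul_sum, Finset.sum_mul, ← Finset.sum_add_distrib,
        ← Finset.sum_sub_distrib]
      refine Finset.sum_congr rfl fun c _ => Finset.sum_congr rfl fun d _ => ?_
      simp only [kn, hP]
      ring
    rw [h, tr, e1, e2] at h0
    linarith
  have hp0 : p = 0 := by
    have h0 : ∑ c, ∑ d, g⁻¹ c d * (((n : ℝ) - 2) * P c d) = ∑ c, ∑ d, g⁻¹ c d * -(p * g c d) := by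
      simp only [main]
    have l : ∑ c, ∑ d, g⁻¹ c d * (((n : ℝ) - 2) * P c d) = ((n : ℝ) - 2) * p := by
      simp only [hp, Finset.mul_sum]
      exact Finset.sum_congr rfl fun c _ => Finset.sum_congr rfl fun d _ => by ring
    have r : ∑ c, ∑ d, g⁻¹ c d * -(p * g c d) = -p * ∑ c, ∑ d, g⁻¹ c d * g c d := by
      simp only [Finset.mul_sum]
      exact Finset.sum_congr rfl fun c _ => Finset.sum_congr rfl fun d _ => by ring
    rw [l, r, tr] at h0
    have : (2 * (n : ℝ) - 2) * p = 0 := by linarith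
    exact (mul_eq_zero.mp this).resolve_left h22
  have := main a b
  rw [hp0, zero_mul, neg_zero] at this
  exact (mul_eq_zero.mp this).resolve_left h2

/-- The integrability condition of the conformal Killing-Yano equation. -/
theorem CKYOn.curvatureAction_weyl (hn : 3 ≤ n) (hU : IsOpen U) (hG : SmoothMat U G)
    (hdet : ∀ z ∈ U, (G z).det ≠ 0) (hs : ∀ z, (G z).transpose = G z) (hY : SmoothMat U Y)
    (hYs : ∀ z, (Y z).transpose = -Y z) {h : E n → Fin n → ℝ}
    (H : CKYOn U G Y h) (hy : y ∈ U) (a b c d : Fin n) :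
    curvatureAction (weylUp G y) (Y y) a b c d = 0 := by
  have hR := riemann_curvatureLike hU hG hdet hs hy
  have hh := H.smooth hn hU hG hdet hs hY
  obtain ⟨Q, hQ⟩ := exists_curvatureAction_weyl (hdet y hy) (hs y) (hYs y) hR
  have hW : ∀ a b c d, curvatureAction (weylUp G y) (Y y) a b c d =
      kn (G y) (Matrix.of (covDerivForm G h y) - Q) a b c d := by
    intro a b c d
    rw [hQ, H.curvatureAction_riemann hU hG hdet hs hY hYs hh hy]
    simp only [kn, Matrix.sub_apply]
    ring
  have ht := curvatureAction_weyl_trace hn (hdet y hy) (hs y) (hYs y) hR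
  simp only [hW] at ht
  have h0 := kn_trace hn (hdet y hy) (hs y) ht
  rw [hW, kn, h0, h0, h0, h0]
  ring

end Integrability


/-! ### Components of fields on a manifold -/

section Components

variable {n : ℕ} {M : Type u} [TopologicalSpace M] [ChartedSpace (E n) M]

theorem comp_transpose_of_isSymm {B : ∀ x : M, LinearMap.BilinForm ℝ (TangentSpace (𝓡 n) x)}
    (hB : ∀ x, (B x).IsSymm) (e : OpenPartialHomeomorph M (E n)) (y : E n) :
    (comp B e y).transpose = comp B e y := by
  ext i j
  exact (hB _).eq _ _

theorem comp_transpose_of_isAlt {B : ∀ x : M, LinearMap.BilinForm ℝ (TangentSpace (𝓡 n) x)}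
    (hB : ∀ x, (B x).IsAlt) (e : OpenPartialHomeomorph M (E n)) (y : E n) :
    (comp B e y).transpose = -comp B e y := by
  ext i j
  exact (LinearMap.BilinForm.IsAlt.neg_eq (hB _) _ _).symm

variable {e : OpenPartialHomeomorph M (E n)} {y : E n}

theorem charts_mdifferentiable (he : e ∈ charts n M) : e.MDifferentiable (𝓡 n) (𝓡 n) :=
  ⟨(contMDiffOn_of_mem_maximalAtlas he).mdifferentiableOn (by simp),
    (contMDiffOn_symm_of_mem_maximalAtlas he).mdifferentiableOn (by simp)⟩

/-- The coordinate vectors as a basis of the tangent space. -/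
def coordBasis (he : e ∈ charts n M) (hy : y ∈ e.target) :
    Module.Basis (Fin n) ℝ (TangentSpace (𝓡 n) (e.symm y)) :=
  Module.Basis.map (M' := TangentSpace (𝓡 n) (e.symm y))
    (EuclideanSpace.basisFun (Fin n) ℝ).toBasis
    (show E n ≃ₗ[ℝ] TangentSpace (𝓡 n) (e.symm y) from
      ((charts_mdifferentiable he).symm.mfderiv (x := y) hy).toLinearEquiv)

theorem coordBasis_apply (he : e ∈ charts n M) (hy : y ∈ e.target) (i : Fin n) :
    coordBasis he hy i = coordVec e y i := by
  rw [coordBasis, Module.Basis.map_apply, OrthonormalBasis.coe_toBasis,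
    EuclideanSpace.basisFun_apply]
  rfl

theorem comp_eq_toMatrix (B : ∀ x : M, LinearMap.BilinForm ℝ (TangentSpace (𝓡 n) x))
    (he : e ∈ charts n M) (hy : y ∈ e.target) :
    comp B e y = LinearMap.BilinForm.toMatrix (coordBasis he hy) (B (e.symm y)) := by
  ext i j
  simp [comp, LinearMap.BilinForm.toMatrix_apply, coordBasis_apply]

theorem comp_det_ne_zero (g : Metric n M) (he : e ∈ charts n M) (hy : y ∈ e.target) :
    (comp g.val e y).det ≠ 0 := by
  rw [comp_eq_toMatrix _ he hy]
  exact (LinearMap.BilinForm.nondegenerate_iff_det_ne_zero _).mp (g.nondegenerate _)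

theorem comp_ne_zero {B : ∀ x : M, LinearMap.BilinForm ℝ (TangentSpace (𝓡 n) x)}
    (he : e ∈ charts n M) (hy : y ∈ e.target) (hB : B (e.symm y) ≠ 0) : comp B e y ≠ 0 := by
  rw [comp_eq_toMatrix _ he hy]
  simpa using hB

theorem comp_of_hasSignatureAt (g : Metric n M) (he : e ∈ charts n M) {x : M} (hx : x ∈ e.source)
    {η : Fin n → ℝ} (h : HasSignatureAt g x η) :
    ∃ Q : Matrix (Fin n) (Fin n) ℝ, IsUnit Q.det ∧
      comp g.val e (e x) = Q.transpose * Matrix.diagonal η * Q := by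
  have hy := e.map_source hx
  rw [← e.left_inv hx] at h
  obtain ⟨b, hb⟩ := h
  have hbm : LinearMap.BilinForm.toMatrix b (g.val (e.symm (e x))) = Matrix.diagonal η := by
    ext i j
    rw [LinearMap.BilinForm.toMatrix_apply, hb, Matrix.diagonal_apply]
  refine ⟨b.toMatrix (coordBasis he hy), ?_, ?_⟩
  · exact (Matrix.isUnit_iff_isUnit_det _).mp
      (IsUnit.of_mul_eq_one _ (b.toMatrix_mul_toMatrix_flip (coordBasis he hy)))
  · rw [comp_eq_toMatrix _ he hy, ← hbm, LinearMap.BilinForm.toMatrix_mul_basis_toMatrix]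

theorem IsCKY.ckyOn {g : Metric n M} {Y : TwoForm n M} (h : IsCKY g Y) (he : e ∈ charts n M) :
    ∃ k : E n → Fin n → ℝ, CKYOn e.target (comp g.val e) (comp Y.val e) k := by
  obtain ⟨k, hk⟩ := h
  refine ⟨fun y c => k (e.symm y) (coordVec e y c), fun y hy a b c => ?_⟩
  have hg := apply_comm_of_transpose_eq (comp_transpose_of_isSymm g.symm e y)
  rw [hk e he y hy a b c, hg b a]
  ring

theorem IsCKY.curvatureAction_weyl (hn : 3 ≤ n) {g : Metric n M} {Y : TwoForm n M}
    (h : IsCKY g Y) (he : e ∈ charts n M) (hy : y ∈ e.target) (a b c d : Fin n) :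
    curvatureAction (weylUp (comp g.val e) y) (comp Y.val e y) a b c d = 0 := by
  obtain ⟨k, hk⟩ := h.ckyOn he
  exact hk.curvatureAction_weyl hn e.open_target (g.smooth e he)
    (fun z hz => comp_det_ne_zero g he hz) (comp_transpose_of_isSymm g.symm e) (Y.smooth e he)
    (comp_transpose_of_isAlt Y.alt e) hy a b c d

end Components

/-! ### Normal forms of trace-free operators with a quadratic minimal polynomial -/

section NormalForms

variable {W : Type*} [AddCommGroup W] [Module ℂ W]

/-- The operator `f` has the canonical form `t` in some basis. -/
def HasNormalForm (f : Module.End ℂ W) (t : PetrovType) : Prop :=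
  ∃ b : Module.Basis (Fin 3) ℂ W, ∃ J ∈ t.normalForms, ∀ j, f (b j) = ∑ i, J i j • b i

theorem hasNormalForm_zero (h3 : Module.finrank ℂ W = 3) :
    HasNormalForm (0 : Module.End ℂ W) .O := by
  have : FiniteDimensional ℂ W := Module.finite_of_finrank_pos (by omega)
  exact ⟨Module.finBasisOfFinrankEq ℂ W h3, 0, rfl, fun j => by simp⟩

theorem hasNormalForm_of_isCompl {f : Module.End ℂ W} {A B : Submodule ℂ W} (hAB : IsCompl A B)
    (hA : Module.finrank ℂ A = 2) (hB : Module.finrank ℂ B = 1) {l : ℂ} (hl : l ≠ 0)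
    (hfA : ∀ v ∈ A, f v = l • v) (hfB : ∀ v ∈ B, f v = (-2 * l) • v) : HasNormalForm f .D := by
  have : FiniteDimensional ℂ A := Module.finite_of_finrank_pos (by omega)
  have : FiniteDimensional ℂ B := Module.finite_of_finrank_pos (by omega)
  let bA := Module.finBasisOfFinrankEq ℂ A hA
  let bB := Module.finBasisOfFinrankEq ℂ B hB
  let b := ((bA.prod bB).map (Submodule.prodEquivOfIsCompl A B hAB)).reindex finSumFinEquiv
  have b0 : b 0 = bA 0 := by
    rw [show (0 : Fin 3) = finSumFinEquiv (Sum.inl (0 : Fin 2) : Fin 2 ⊕ Fin 1) from rfl]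
    simp [b]
  have b1 : b 1 = bA 1 := by
    rw [show (1 : Fin 3) = finSumFinEquiv (Sum.inl (1 : Fin 2) : Fin 2 ⊕ Fin 1) from rfl]
    simp [b]
  have b2 : b 2 = bB 0 := by
    rw [show (2 : Fin 3) = finSumFinEquiv (Sum.inr (0 : Fin 1) : Fin 2 ⊕ Fin 1) from rfl]
    simp [b]
  refine ⟨b, _, ⟨l, hl, rfl⟩, fun j => ?_⟩
  fin_cases j
  · simp [Fin.sum_univ_three, b0, hfA _ (bA 0).2]
  · simp [Fin.sum_univ_three, b1, hfA _ (bA 1).2]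
  · simp [Fin.sum_univ_three, b2, hfB _ (bB 0).2]

/-- The range lies in the kernel, so the kernel has dimension at least two and contains some `w`
outside the line of `f v`. The basis is `f v, v, w`. -/
theorem hasNormalForm_of_sq_eq_zero (h3 : Module.finrank ℂ W = 3) {f : Module.End ℂ W}
    (hf : f ≠ 0) (hff : f * f = 0) : HasNormalForm f .N := by
  have : FiniteDimensional ℂ W := Module.finite_of_finrank_pos (by omega)
  obtain ⟨v, hv⟩ : ∃ v, f v ≠ 0 := by
    by_contra! h
    exact hf (LinearMap.ext h)
  have hff' : ∀ w, f (f w) = 0 := fun w => LinearMap.congr_fun hff w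
  have hle : LinearMap.range f ≤ LinearMap.ker f := by
    rintro _ ⟨w, rfl⟩
    exact hff' w
  have h1 := Submodule.finrank_mono hle
  have h2 := f.finrank_range_add_finrank_ker
  obtain ⟨w, hw, hwn⟩ : ∃ w ∈ LinearMap.ker f, w ∉ Submodule.span ℂ {f v} := by
    by_contra! h
    have := (Submodule.finrank_mono (show LinearMap.ker f ≤ Submodule.span ℂ {f v} from h)).trans
      (finrank_span_le_card {f v})
    simp at this
    omega
  have hw0 : f w = 0 := hw
  have hli : LinearIndependent ℂ ![f v, v, w] := by
    rw [Fintype.linearIndependent_iff]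
    intro c hc
    simp only [Fin.sum_univ_three, Matrix.cons_val_zero, Matrix.cons_val_one,
      Matrix.cons_val] at hc
    have c1 : c 1 = 0 := by
      have := congrArg f hc
      simp only [map_add, map_smul, hff', hw0, smul_zero, zero_add, add_zero, map_zero] at this
      exact (smul_eq_zero.mp this).resolve_right hv
    rw [c1, zero_smul, add_zero] at hc
    have c2 : c 2 = 0 := by
      by_contra hne
      refine hwn (Submodule.mem_span_singleton.mpr ⟨-(c 2)⁻¹ * c 0, ?_⟩)
      have : w = (c 2)⁻¹ • (c 2 • w) := by rw [smul_smul, inv_mul_cancel₀ hne, one_smul]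
      rw [this, ← sub_eq_zero, eq_neg_of_add_eq_zero_right hc]
      module
    rw [c2, zero_smul, add_zero] at hc
    have c0 : c 0 = 0 := (smul_eq_zero.mp hc).resolve_right hv
    intro i
    fin_cases i <;> assumption
  refine ⟨basisOfLinearIndependentOfCardEqFinrank hli (by simp [h3]), _, rfl, fun j => ?_⟩
  fin_cases j <;> simp [Fin.sum_univ_three, hff', hw0]

/-- Factor the quadratic as `(f - p)(f - q) = 0`. For `p = q` the operator `f - p` is nilpotent, so
the trace forces `p = 0`. For `p ≠ q` the operator is `p + (q - p) e` with `e` idempotent, and the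
trace condition determines `p : q` from the rank of `e`. -/
theorem exists_hasNormalForm (h3 : Module.finrank ℂ W = 3) {f : Module.End ℂ W}
    (htr : LinearMap.trace ℂ W f = 0) {μ κ : ℂ} (hf : f * f = μ • f + κ • 1) :
    ∃ t ∈ ({.O, .N, .D} : Set PetrovType), HasNormalForm f t := by
  have : FiniteDimensional ℂ W := Module.finite_of_finrank_pos (by omega)
  have h1 : LinearMap.trace ℂ W 1 = 3 := by simp [LinearMap.trace_one, h3]
  obtain ⟨s, hs⟩ := IsAlgClosed.exists_pow_nat_eq (μ ^ 2 + 4 * κ) (n := 2) (by norm_num)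
  obtain ⟨p, hp⟩ : ∃ p, p = (μ + s) / 2 := ⟨_, rfl⟩
  obtain ⟨q, hq⟩ : ∃ q, q = (μ - s) / 2 := ⟨_, rfl⟩
  have hμ : μ = p + q := by rw [hp, hq]; ring
  have hκ : κ = -(p * q) := by rw [hp, hq]; linear_combination (-1 / 4) * hs
  rw [hμ, hκ] at hf
  by_cases hpq : p = q
  · subst hpq
    have hnil : (f - p • 1) * (f - p • 1) = 0 := by
      simp only [sub_mul, mul_sub, hf, smul_mul_assoc, mul_smul_comm, one_mul, mul_one]
      module
    have ht : LinearMap.trace ℂ W (f - p • 1) = 0 :=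
      (LinearMap.isNilpotent_trace_of_isNilpotent ⟨2, by rw [pow_two, hnil]⟩).eq_zero
    rw [map_sub, map_smul, h1, htr] at ht
    have hp0 : p = 0 := by simpa using ht
    subst hp0
    by_cases h0 : f = 0
    · exact ⟨.O, by simp, h0 ▸ hasNormalForm_zero h3⟩
    · exact ⟨.N, by simp, hasNormalForm_of_sq_eq_zero h3 h0 (by simpa using hf)⟩
  · have hqp : q - p ≠ 0 := sub_ne_zero.mpr (Ne.symm hpq)
    set e : Module.End ℂ W := (q - p)⁻¹ • (f - p • 1) with he
    have hfe : f = p • 1 + (q - p) • e := by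
      rw [he, smul_smul, mul_inv_cancel₀ hqp]
      module
    have hee : e * e = e := by
      have : (f - p • 1) * (f - p • 1) = (q - p) • (f - p • 1) := by
        simp only [sub_mul, mul_sub, hf, smul_mul_assoc, mul_smul_comm, one_mul, mul_one]
        module
      rw [he, smul_mul_smul_comm, this, smul_smul, mul_assoc, inv_mul_cancel₀ hqp, mul_one]
    have hproj : LinearMap.IsProj (LinearMap.range e) e :=
      ⟨fun x => ⟨x, rfl⟩, by rintro _ ⟨x, rfl⟩; exact LinearMap.congr_fun hee x⟩
    have hcompl : IsCompl (LinearMap.range e) (LinearMap.ker e) := hproj.isCompl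
    have hte : LinearMap.trace ℂ W e = Module.finrank ℂ (LinearMap.range e) := hproj.trace
    have hsum := e.finrank_range_add_finrank_ker
    -- The trace of a projection is its rank. Rank 0 or 3 gives `f = 0`; rank 1 or 2 gives the
    -- eigenvalues `l, l, -2l`.
    have htr' : 3 * p + (q - p) * Module.finrank ℂ (LinearMap.range e) = 0 := by
      have h := congrArg (LinearMap.trace ℂ W) hfe
      rw [htr, map_add, map_smul, map_smul, h1, hte, smul_eq_mul, smul_eq_mul] at h
      linear_combination -h
    have hr : ∀ v ∈ LinearMap.range e, f v = q • v := by
      rintro _ ⟨x, rfl⟩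
      have : e (e x) = e x := LinearMap.congr_fun hee x
      rw [hfe]
      simp only [LinearMap.add_apply, LinearMap.smul_apply, Module.End.one_apply, this]
      module
    have hk : ∀ v ∈ LinearMap.ker e, f v = p • v := by
      intro v hv
      rw [hfe]
      simp only [LinearMap.add_apply, LinearMap.smul_apply, Module.End.one_apply,
        LinearMap.mem_ker.mp hv]
      module
    have hle : Module.finrank ℂ (LinearMap.range e) ≤ 3 := by omega
    obtain hd | hd | hd | hd : Module.finrank ℂ (LinearMap.range e) = 0 ∨
      Module.finrank ℂ (LinearMap.range e) = 1 ∨ Module.finrank ℂ (LinearMap.range e) = 2 ∨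
      Module.finrank ℂ (LinearMap.range e) = 3 := by omega
    · have hp0 : p = 0 := by rw [hd] at htr'; simpa using htr'
      have he0 : e = 0 := LinearMap.range_eq_bot.mp (Submodule.finrank_eq_zero.mp hd)
      refine ⟨.O, by simp, ?_⟩
      rw [hfe, hp0, he0]
      simpa using hasNormalForm_zero h3
    · have hq2 : q = -2 * p := by rw [hd] at htr'; push_cast at htr'; linear_combination htr'
      refine ⟨.D, by simp, hasNormalForm_of_isCompl hcompl.symm (by omega) hd (l := p) ?_ hk
        (by rw [← hq2]; exact hr)⟩
      rintro rfl
      exact hpq (by rw [hq2]; ring)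
    · have hp2 : p = -2 * q := by rw [hd] at htr'; push_cast at htr'; linear_combination htr'
      refine ⟨.D, by simp, hasNormalForm_of_isCompl hcompl hd (by omega) (l := q) ?_ hr
        (by rw [← hp2]; exact hk)⟩
      rintro rfl
      exact hpq (by rw [hp2]; ring)
    · have hq0 : q = 0 := by
        rw [hd] at htr'
        push_cast at htr'
        linear_combination htr' / 3
      have htop : LinearMap.range e = ⊤ := Submodule.eq_top_of_finrank_eq (by rw [hd, h3])
      have hf0 : f = 0 := by
        ext v
        rw [hr v (by rw [htop]; trivial), hq0]
        simp
      exact ⟨.O, by simp, hf0 ▸ hasNormalForm_zero h3⟩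

end NormalForms

/-! ### Self-duality in complex Euclidean four-space -/

section SelfDual

/-- The standard basis of the (anti-)self-dual bivectors of complex Euclidean four-space. -/
def dualBasis (s : ℂ) : Fin 3 → Matrix (Fin 4) (Fin 4) ℂ :=
  ![!![0, 1, 0, 0; -1, 0, 0, 0; 0, 0, 0, s; 0, 0, -s, 0],
    !![0, 0, 1, 0; 0, 0, 0, -s; -1, 0, 0, 0; 0, s, 0, 0],
    !![0, 0, 0, 1; 0, 0, s, 0; 0, -s, 0, 0; -1, 0, 0, 0]]

/-- The coordinates, with respect to `dualBasis`, of twice the (anti-)self-dual part of a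
bivector. -/
def dualCoord (s : ℂ) (B : Matrix (Fin 4) (Fin 4) ℂ) : Fin 3 → ℂ :=
  ![B 0 1 + s * B 2 3, B 0 2 + s * B 3 1, B 0 3 + s * B 1 2]

/-- The action of a tensor of rank four on bivectors of complex Euclidean space. -/
def euclidOp (K : Fin 4 → Fin 4 → Fin 4 → Fin 4 → ℂ) (B : Matrix (Fin 4) (Fin 4) ℂ) :
    Matrix (Fin 4) (Fin 4) ℂ :=
  Matrix.of fun a b => (1 / 2 : ℂ) * ∑ c, ∑ d, K a b c d * B c d

/-- The matrix of the action of a Weyl-like tensor on `dualBasis`. -/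
def dualMatrix (K : Fin 4 → Fin 4 → Fin 4 → Fin 4 → ℂ) (s : ℂ) : Matrix (Fin 3) (Fin 3) ℂ :=
  -- The coordinates of a combination of `dualBasis` are its entries `0 i.succ`: row zero of
  -- `dualBasis s i` has a single 1, in that place.
  Matrix.of fun i j => euclidOp K (dualBasis s j) 0 i.succ

/-- The cross product with `y`, as a matrix. -/
def crossMatrix (y : Fin 3 → ℂ) : Matrix (Fin 3) (Fin 3) ℂ :=
  !![0, -y 2, y 1; y 2, 0, -y 0; -y 1, y 0, 0]

/-- The algebraic symmetries of a Weyl tensor of complex Euclidean four-space. -/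
structure IsWeylLike (K : Fin 4 → Fin 4 → Fin 4 → Fin 4 → ℂ) : Prop extends
    IsCurvatureLike K where
  trace : ∀ b d, ∑ a, K a b a d = 0

theorem dualBasis_transpose (s : ℂ) (i : Fin 3) :
    (dualBasis s i).transpose = -dualBasis s i := by
  ext a b
  fin_cases i <;> fin_cases a <;> fin_cases b <;> simp [dualBasis]

theorem skew_ext {A B : Matrix (Fin 4) (Fin 4) ℂ} (hA : A.transpose = -A) (hB : B.transpose = -B)
    (h1 : A 0 1 = B 0 1) (h2 : A 0 2 = B 0 2) (h3 : A 0 3 = B 0 3) (h4 : A 2 3 = B 2 3)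
    (h5 : A 3 1 = B 3 1) (h6 : A 1 2 = B 1 2) : A = B := by
  have hA' : ∀ a b, A a b = -A b a := fun a b => congrFun (congrFun hA b) a
  have hB' : ∀ a b, B a b = -B b a := fun a b => congrFun (congrFun hB b) a
  ext a b
  fin_cases a <;> fin_cases b <;> grind

theorem euclidOp_transpose {K : Fin 4 → Fin 4 → Fin 4 → Fin 4 → ℂ} (hK : IsCurvatureLike K)
    (B : Matrix (Fin 4) (Fin 4) ℂ) : (euclidOp K B).transpose = -euclidOp K B := by
  ext a b
  simp only [euclidOp, Matrix.transpose_apply, Matrix.neg_apply, Matrix.of_apply,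
    hK.skew_left b a, neg_mul, Finset.sum_neg_distrib, mul_neg]

theorem euclidOp_apply {K : Fin 4 → Fin 4 → Fin 4 → Fin 4 → ℂ} (hK : IsCurvatureLike K)
    {B : Matrix (Fin 4) (Fin 4) ℂ} (hB : B.transpose = -B) (a b : Fin 4) :
    euclidOp K B a b = K a b 0 1 * B 0 1 + K a b 0 2 * B 0 2 + K a b 0 3 * B 0 3
      + K a b 2 3 * B 2 3 + K a b 3 1 * B 3 1 + K a b 1 2 * B 1 2 := by
  have hB' : ∀ a b, B a b = -B b a := fun a b => congrFun (congrFun hB b) a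
  have r := hK.skew_right a b
  have hd : ∀ i, B i i = 0 := fun i => by linear_combination (hB' i i) / 2
  simp only [euclidOp, Matrix.of_apply, Fin.sum_univ_four, hd]
  rw [r 1 0, r 2 0, r 3 0, r 3 2, r 1 3, r 2 1, hB' 1 0, hB' 2 0, hB' 3 0, hB' 3 2, hB' 1 3,
    hB' 2 1]
  ring

namespace IsWeylLike

variable {K : Fin 4 → Fin 4 → Fin 4 → Fin 4 → ℂ}

/-- All components of a Weyl-like tensor in terms of ten of them. -/
theorem components (hK : IsWeylLike K) :
    (K 2 3 2 3 = K 0 1 0 1 ∧ K 3 1 3 1 = K 0 2 0 2 ∧ K 1 2 1 2 = K 0 3 0 3 ∧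
      K 0 3 0 3 = -K 0 1 0 1 - K 0 2 0 2) ∧
    (K 2 3 3 1 = K 0 1 0 2 ∧ K 2 3 1 2 = K 0 1 0 3 ∧ K 3 1 1 2 = K 0 2 0 3) ∧
    (K 3 1 2 3 = K 0 1 0 2 ∧ K 1 2 2 3 = K 0 1 0 3 ∧ K 1 2 3 1 = K 0 2 0 3) ∧
    (K 0 2 0 1 = K 0 1 0 2 ∧ K 0 3 0 1 = K 0 1 0 3 ∧ K 0 3 0 2 = K 0 2 0 3) ∧
    (K 0 2 2 3 = K 0 1 3 1 ∧ K 0 3 2 3 = K 0 1 1 2 ∧ K 0 3 3 1 = K 0 2 1 2 ∧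
      K 0 3 1 2 = -K 0 1 2 3 - K 0 2 3 1) ∧
    (K 2 3 0 1 = K 0 1 2 3 ∧ K 2 3 0 2 = K 0 1 3 1 ∧ K 2 3 0 3 = K 0 1 1 2) ∧
    (K 3 1 0 1 = K 0 1 3 1 ∧ K 3 1 0 2 = K 0 2 3 1 ∧ K 3 1 0 3 = K 0 2 1 2) ∧
    (K 1 2 0 1 = K 0 1 1 2 ∧ K 1 2 0 2 = K 0 2 1 2 ∧
      K 1 2 0 3 = -K 0 1 2 3 - K 0 2 3 1) := by
  have l := hK.skew_left
  have r := hK.skew_right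
  have p := hK.pair
  have b := hK.bianchi
  have t := hK.trace
  have l0 : ∀ a c d, K a a c d = 0 := fun a c d => by
    have := l a a c d
    linear_combination this / 2
  simp only [Fin.sum_univ_four] at t
  -- On the pairs `01, 02, 03 | 23, 31, 12` the tensor has the block form `A, B | B, A` with `A` and
  -- `B` symmetric and trace-free. The equality of blocks and the symmetry of `B` come from the
  -- vanishing trace; `B` is trace-free by the Bianchi identity.
  have a1 : K 2 3 2 3 = K 0 1 0 1 := by grind
  have a2 : K 3 1 3 1 = K 0 2 0 2 := by grind
  have a3 : K 1 2 1 2 = K 0 3 0 3 := by grind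
  have a4 : K 0 3 0 3 = -K 0 1 0 1 - K 0 2 0 2 := by grind
  have a5 : K 2 3 3 1 = K 0 1 0 2 := by grind
  have a6 : K 2 3 1 2 = K 0 1 0 3 := by grind
  have a7 : K 3 1 1 2 = K 0 2 0 3 := by grind
  have h1 : K 0 2 2 3 = K 0 1 3 1 := by grind
  have h2 : K 0 3 2 3 = K 0 1 1 2 := by grind
  have h3 : K 0 3 3 1 = K 0 2 1 2 := by grind
  have h4 : K 0 3 1 2 = -K 0 1 2 3 - K 0 2 3 1 := by grind
  refine ⟨⟨a1, a2, a3, a4⟩, ⟨a5, a6, a7⟩, ⟨?_, ?_, ?_⟩, ⟨p _ _ _ _, p _ _ _ _, p _ _ _ _⟩,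
    ⟨h1, h2, h3, h4⟩, ⟨p _ _ _ _, ?_, ?_⟩, ⟨p _ _ _ _, p _ _ _ _, ?_⟩,
    ⟨p _ _ _ _, p _ _ _ _, ?_⟩⟩
  · rw [p, a5]
  · rw [p, a6]
  · rw [p, a7]
  · rw [p, h1]
  · rw [p, h2]
  · rw [p, h3]
  · rw [p, h4]

/-- In terms of the blocks of `components` this is `A + s B`, so its symmetry and trace-freeness are
visible. -/
theorem dualMatrix_eq (hK : IsWeylLike K) (s : ℂ) :
    dualMatrix K s =
      !![K 0 1 0 1 + s * K 0 1 2 3, K 0 1 0 2 + s * K 0 1 3 1, K 0 1 0 3 + s * K 0 1 1 2;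
        K 0 1 0 2 + s * K 0 1 3 1, K 0 2 0 2 + s * K 0 2 3 1, K 0 2 0 3 + s * K 0 2 1 2;
        K 0 1 0 3 + s * K 0 1 1 2, K 0 2 0 3 + s * K 0 2 1 2,
          -K 0 1 0 1 - K 0 2 0 2 - s * (K 0 1 2 3 + K 0 2 3 1)] := by
  obtain ⟨⟨-, -, -, a4⟩, -, -, ⟨c1, c2, c3⟩, ⟨h1, h2, h3, h4⟩, -⟩ := hK.components
  ext i j
  rw [dualMatrix, Matrix.of_apply,
    euclidOp_apply hK.toIsCurvatureLike (dualBasis_transpose s _)]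
  fin_cases i <;> fin_cases j <;>
    simp [dualBasis, a4, c1, c2, c3, h1, h2, h3, h4] <;> ring

theorem dualMatrix_transpose (hK : IsWeylLike K) (s : ℂ) :
    (dualMatrix K s).transpose = dualMatrix K s := by
  rw [hK.dualMatrix_eq]
  ext i j
  fin_cases i <;> fin_cases j <;> rfl

theorem dualMatrix_trace (hK : IsWeylLike K) (s : ℂ) : (dualMatrix K s).trace = 0 := by
  rw [hK.dualMatrix_eq]
  simp [Matrix.trace, Fin.sum_univ_three]
  ring

/-- A Weyl-like operator commutes with the Hodge star, hence preserves each eigenspace; this is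
where trace-freeness enters. -/
theorem euclidOp_dualBasis (hK : IsWeylLike K) {s : ℂ} (hs : s * s = 1) (j : Fin 3) :
    euclidOp K (dualBasis s j) = ∑ i, dualMatrix K s i j • dualBasis s i := by
  obtain ⟨⟨a1, a2, a3, a4⟩, ⟨a5, a6, a7⟩, ⟨b5, b6, b7⟩, ⟨c1, c2, c3⟩, ⟨h1, h2, h3, h4⟩,
    ⟨d1, d2, d3⟩, ⟨d4, d5, d6⟩, ⟨d7, d8, d9⟩⟩ := hK.components
  rw [hK.dualMatrix_eq]
  refine skew_ext (euclidOp_transpose hK.toIsCurvatureLike _) ?_ ?_ ?_ ?_ ?_ ?_ ?_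
  · simp [Matrix.transpose_sum, dualBasis_transpose]
  all_goals
    rw [euclidOp_apply hK.toIsCurvatureLike (dualBasis_transpose s _)]
    fin_cases j <;>
      simp [dualBasis, Fin.sum_univ_three, a1, a2, a3, a4, a5, a6, a7, b5, b6, b7, c1, c2, c3,
        h1, h2, h3, h4, d1, d2, d3, d4, d5, d6, d7, d8, d9] <;> grind

set_option maxHeartbeats 2000000 in
-- By pair symmetry `hW` says that the derivation of tensors induced by `Z` annihilates `K`. On a
-- half of the bivectors this derivation is the commutator with the cross product by the half of
-- `Z`, the other half of `Z` acting trivially.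
theorem dualMatrix_commute (hK : IsWeylLike K) {s : ℂ} (hs : s * s = 1)
    {Z : Matrix (Fin 4) (Fin 4) ℂ} (hZ : Z.transpose = -Z)
    (hW : ∀ a b c d, ∑ f, (K f a c b * Z d f + K f b d a * Z c f + K f c a d * Z b f
      + K f d b c * Z a f) = 0) :
    dualMatrix K s * crossMatrix (dualCoord s Z) =
      crossMatrix (dualCoord s Z) * dualMatrix K s := by
  have hZ' : ∀ a b, Z a b = -Z b a := fun a b => congrFun (congrFun hZ b) a
  have hd : ∀ i, Z i i = 0 := fun i => by linear_combination (hZ' i i) / 2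
  have l := hK.skew_left
  have r := hK.skew_right
  have l0 : ∀ a c d, K a a c d = 0 := fun a c d => by
    have := l a a c d
    linear_combination this / 2
  obtain ⟨⟨a1, a2, a3, a4⟩, ⟨a5, a6, a7⟩, ⟨b5, b6, b7⟩, ⟨c1, c2, c3⟩, ⟨h1, h2, h3, h4⟩,
    ⟨d1, d2, d3⟩, ⟨d4, d5, d6⟩, ⟨d7, d8, d9⟩⟩ := hK.components
  have e1 := l 1 0
  have e2 := l 2 0
  have e3 := l 3 0
  have e4 := l 3 2
  have e5 := l 1 3
  have e6 := l 2 1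
  have f1 := fun a b => r a b 1 0
  have f2 := fun a b => r a b 2 0
  have f3 := fun a b => r a b 3 0
  have f4 := fun a b => r a b 3 2
  have f5 := fun a b => r a b 1 3
  have f6 := fun a b => r a b 2 1
  have w : ∀ a b c, K 0 a c b * Z 0 0 + K 1 a c b * Z 0 1 + K 2 a c b * Z 0 2 + K 3 a c b * Z 0 3
      + (K 0 b 0 a * Z c 0 + K 1 b 0 a * Z c 1 + K 2 b 0 a * Z c 2 + K 3 b 0 a * Z c 3)
      + (K 0 c a 0 * Z b 0 + K 1 c a 0 * Z b 1 + K 2 c a 0 * Z b 2 + K 3 c a 0 * Z b 3)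
      + (K 0 0 b c * Z a 0 + K 1 0 b c * Z a 1 + K 2 0 b c * Z a 2 + K 3 0 b c * Z a 3) = 0 := by
    intro a b c
    rw [← hW a b c 0]
    simp only [Fin.sum_univ_four]
    ring
  -- Up to sign, `x` collects the components `0a0i` of the derivative of `K`, and `z` its components
  -- `0a23`, `0a31`, `0a12`. The entries of the commutator are, up to sign, the combinations of `x`
  -- and `z` in the pattern `A + s B`.
  have x11 := w 1 0 1
  have x12 := w 1 0 2
  have x13 := w 1 0 3
  have x21 := w 2 0 1
  have x22 := w 2 0 2
  have x23 := w 2 0 3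
  have x31 := w 3 0 1
  have x32 := w 3 0 2
  have x33 := w 3 0 3
  have z11 := w 1 2 3
  have z12 := w 1 3 1
  have z13 := w 1 1 2
  have z21 := w 2 2 3
  have z22 := w 2 3 1
  have z23 := w 2 1 2
  have z31 := w 3 2 3
  have z32 := w 3 3 1
  have z33 := w 3 1 2
  simp only [e1, e2, e3, e4, e5, e6, f1, f2, f3, f4, f5, f6, l0, hd, a1, a2, a3, a4, a5, a6, a7,
    b5, b6, b7, c1, c2, c3, h1, h2, h3, h4, d1, d2, d3, d4, d5, d6, d7, d8, d9,
    hZ' 1 0, hZ' 2 0, hZ' 3 0, hZ' 3 2, hZ' 1 3, hZ' 2 1]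
    at x11 x12 x13 x21 x22 x23 x31 x32 x33 z11 z12 z13 z21 z22 z23 z31 z32 z33
  clear hW w
  rw [hK.dualMatrix_eq]
  ext i j
  rcases mul_self_eq_one_iff.mp hs with rfl | rfl
  · fin_cases i <;> fin_cases j <;>
      simp [crossMatrix, dualCoord, Matrix.mul_apply, Fin.sum_univ_three]
    · linear_combination -x11 - z11
    · linear_combination -x12 - z12
    · linear_combination -x13 - z13
    · linear_combination -x21 - z21
    · linear_combination -x22 - z22
    · linear_combination -x23 - z23
    · linear_combination -x31 - z31
    · linear_combination -x32 - z32
    · linear_combination -x33 - z33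
  · fin_cases i <;> fin_cases j <;>
      simp [crossMatrix, dualCoord, Matrix.mul_apply, Fin.sum_univ_three]
    · linear_combination x11 - z11
    · linear_combination x12 - z12
    · linear_combination x13 - z13
    · linear_combination x21 - z21
    · linear_combination x22 - z22
    · linear_combination x23 - z23
    · linear_combination x31 - z31
    · linear_combination x32 - z32
    · linear_combination x33 - z33

end IsWeylLike

end SelfDual

/-! ### Trace-free symmetric matrices commuting with a rotation generator -/

section RotationInvariant

/-- Vectors with zero cross product are parallel. Over `ℂ` the vector `y` may be null, so the factor
is read off at a non-zero coordinate rather than from `y · y`. -/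
theorem exists_eq_smul_of_crossMatrix_mulVec {y u : Fin 3 → ℂ} (hy : y ≠ 0)
    (h : (crossMatrix y).mulVec u = 0) : ∃ c : ℂ, u = c • y := by
  have h0 := congrFun h 0
  have h1 := congrFun h 1
  have h2 := congrFun h 2
  simp [crossMatrix, Matrix.mulVec, dotProduct, Fin.sum_univ_three] at h0 h1 h2
  obtain ⟨k, hk⟩ : ∃ k, y k ≠ 0 := by
    by_contra! hc
    exact hy (funext hc)
  refine ⟨u k / y k, funext fun i => ?_⟩
  rw [Pi.smul_apply, smul_eq_mul, div_mul_eq_mul_div, eq_div_iff hk]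
  fin_cases k <;> fin_cases i <;> simp <;> grind

/-- `M` preserves the kernel of `y ×`, which is the line of `y`, so `M y = ν y`. For trace-free
symmetric `M` one has `M [y] + [y] M = -[M y]`; with commutation this gives `(M + ν/2) [y] = 0`. The
rows of `X = M + ν/2` are then multiples of `y`, so `X = c yᵀ` and `X² = (tr X) X`. -/
theorem exists_quadratic_of_commute {M : Matrix (Fin 3) (Fin 3) ℂ} (hs : M.transpose = M)
    (ht : M.trace = 0) {y : Fin 3 → ℂ} (hy : y ≠ 0)
    (hc : M * crossMatrix y = crossMatrix y * M) :
    ∃ ν : ℂ, M * M = ν • M + (2 * ν ^ 2) • (1 : Matrix (Fin 3) (Fin 3) ℂ) := by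
  have hM : ∀ i j, M i j = M j i := fun i j => congrFun (congrFun hs j) i
  have hcy : (crossMatrix y).mulVec y = 0 := by
    ext i
    fin_cases i <;> simp [crossMatrix, Matrix.mulVec, dotProduct, Fin.sum_univ_three] <;> ring
  obtain ⟨ν, hν⟩ := exists_eq_smul_of_crossMatrix_mulVec (u := M.mulVec y) hy (by
    rw [Matrix.mulVec_mulVec, ← hc, ← Matrix.mulVec_mulVec, hcy, Matrix.mulVec_zero])
  have hanti : M * crossMatrix y + crossMatrix y * M = -crossMatrix (M.mulVec y) := by
    have h0 := hM 0 1
    have h1 := hM 0 2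
    have h2 := hM 1 2
    rw [Matrix.trace, Fin.sum_univ_three] at ht
    simp only [Matrix.diag_apply] at ht
    ext i j
    fin_cases i <;> fin_cases j <;>
      simp [crossMatrix, Matrix.mul_apply, Matrix.mulVec, Matrix.vecMul, dotProduct,
        Fin.sum_univ_three] <;> grind
  set X := M + (ν / 2) • (1 : Matrix (Fin 3) (Fin 3) ℂ) with hX
  have hXJ : X * crossMatrix y = 0 := by
    have hν' : crossMatrix (ν • y) = ν • crossMatrix y := by
      ext i j
      fin_cases i <;> fin_cases j <;> simp [crossMatrix]
    rw [hν, hν', ← hc] at hanti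
    ext i j
    have := congrFun (congrFun hanti i) j
    simp only [Matrix.add_apply, Matrix.neg_apply, Matrix.smul_apply, smul_eq_mul] at this
    simp only [hX, add_mul, smul_mul_assoc, one_mul, Matrix.add_apply, Matrix.smul_apply,
      smul_eq_mul, Matrix.zero_apply]
    linear_combination this / 2
  have hrow : ∀ i, ∃ c : ℂ, X i = c • y := by
    intro i
    refine exists_eq_smul_of_crossMatrix_mulVec hy (funext fun j => ?_)
    have := congrFun (congrFun hXJ i) j
    fin_cases j <;>
    simp [crossMatrix, Matrix.mul_apply, Matrix.mulVec, dotProduct,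
        Fin.sum_univ_three]
      at this ⊢ <;> linear_combination -this
  choose c hcX using hrow
  have hXe : ∀ i j, X i j = c i * y j := fun i j => by rw [hcX i]; rfl
  have htr : ∑ k, y k * c k = 3 * ν / 2 := by
    have h1 : X.trace = 3 * ν / 2 := by
      rw [hX, Matrix.trace_add, ht, Matrix.trace_smul, Matrix.trace_one]
      simp
      ring
    rw [← h1, Matrix.trace]
    exact Finset.sum_congr rfl fun k _ => by rw [Matrix.diag_apply, hXe, mul_comm]
  have hXX : X * X = (3 * ν / 2) • X := by
    ext i j
    rw [Matrix.mul_apply, Matrix.smul_apply, smul_eq_mul, ← htr, Finset.sum_mul]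
    exact Finset.sum_congr rfl fun k _ => by rw [hXe, hXe, hXe]; ring
  -- From `X² = (3ν/2) X` and `M = X - ν/2` follows `M² = (ν/2) M + ν²/2`; the constant term is `2
  -- (ν/2)²`.
  refine ⟨ν / 2, ?_⟩
  have e : M = X - (ν / 2) • (1 : Matrix (Fin 3) (Fin 3) ℂ) := by rw [hX]; module
  rw [e]
  simp only [sub_mul, mul_sub, hXX, smul_mul_assoc, mul_smul_comm, one_mul, mul_one]
  module

end RotationInvariant

/-! ### Change of frame -/

section Frames

/-- Contraction of one index. -/
def ctr (r X : Fin 4 → ℂ) : ℂ := ∑ a, r a * X a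

theorem ctr_comm (r r' : Fin 4 → ℂ) (X : Fin 4 → Fin 4 → ℂ) :
    ctr r (fun a => ctr r' fun b => X a b) = ctr r' fun b => ctr r fun a => X a b := by
  simp only [ctr, Finset.mul_sum]
  rw [Finset.sum_comm]
  exact Finset.sum_congr rfl fun _ _ => Finset.sum_congr rfl fun _ _ => by ring

theorem ctr_add (r X X' : Fin 4 → ℂ) : ctr r (fun a => X a + X' a) = ctr r X + ctr r X' := by
  simp only [ctr, mul_add, Finset.sum_add_distrib]

theorem ctr_neg (r X : Fin 4 → ℂ) : ctr r (fun a => -X a) = -ctr r X := by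
  simp only [ctr, mul_neg, Finset.sum_neg_distrib]

theorem ctr_zero (r : Fin 4 → ℂ) : ctr r (fun _ => 0) = 0 := by
  simp [ctr]

theorem ctr_mul_left (c : ℂ) (r X : Fin 4 → ℂ) : ctr r (fun a => c * X a) = c * ctr r X := by
  simp only [ctr, Finset.mul_sum]
  exact Finset.sum_congr rfl fun _ _ => by ring

theorem ctr_mul_right (c : ℂ) (r X : Fin 4 → ℂ) : ctr r (fun a => X a * c) = ctr r X * c := by
  simp only [ctr, Finset.sum_mul]
  exact Finset.sum_congr rfl fun _ _ => by ring

theorem ctr_sum {ι : Type*} (s : Finset ι) (r : Fin 4 → ℂ) (X : ι → Fin 4 → ℂ) :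
    ctr r (fun a => ∑ g ∈ s, X g a) = ∑ g ∈ s, ctr r (X g) := by
  simp only [ctr, Finset.mul_sum]
  rw [Finset.sum_comm]

theorem sum_ctr_mul (r₁ r₂ r₃ r₄ : Fin 4 → ℂ) (κ : Fin 4 → Fin 4 → Fin 4 → Fin 4 → ℂ)
    (y : Fin 4 → Fin 4 → ℂ) :
    ∑ f, (ctr r₁ fun n => ctr r₂ fun p => ctr r₃ fun q => κ f n p q) * (ctr r₄ fun k => y k f) =
      ctr r₁ fun n => ctr r₂ fun p => ctr r₃ fun q => ctr r₄ fun k => ∑ f, κ f n p q * y k f := by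
  simp only [ctr_sum, ctr_mul_left, ctr_mul_right]

/-- The components of a tensor of rank four in the frame of columns of `R`. -/
def frameTensor (R : Matrix (Fin 4) (Fin 4) ℂ) (K : Fin 4 → Fin 4 → Fin 4 → Fin 4 → ℂ)
    (a b c d : Fin 4) : ℂ :=
  ctr (fun m => R m a) fun m => ctr (fun n => R n b) fun n => ctr (fun p => R p c) fun p =>
    ctr (fun q => R q d) fun q => K m n p q

theorem frameTensor_curvatureLike (R : Matrix (Fin 4) (Fin 4) ℂ)
    {K : Fin 4 → Fin 4 → Fin 4 → Fin 4 → ℂ} (hK : IsCurvatureLike K) :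
    IsCurvatureLike (frameTensor R K) where
  skew_left a b c d := by
    simp only [frameTensor]
    rw [ctr_comm]
    simp only [← ctr_neg]
    simp only [← hK.skew_left]
  skew_right a b c d := by
    simp only [frameTensor]
    simp only [ctr_comm (fun p => R p c)]
    simp only [← ctr_neg]
    simp only [← hK.skew_right]
  bianchi a b c d := by
    simp only [frameTensor]
    have e1 : ∀ m, (ctr (fun n => R n c) fun n => ctr (fun p => R p d) fun p =>
        ctr (fun q => R q b) fun q => K m n p q) =
        ctr (fun n => R n b) fun n => ctr (fun p => R p c) fun p =>
          ctr (fun q => R q d) fun q => K m p q n := by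
      intro m
      simp only [ctr_comm (fun p => R p d) (fun q => R q b)]
      rw [ctr_comm]
    have e2 : ∀ m, (ctr (fun n => R n d) fun n => ctr (fun p => R p b) fun p =>
        ctr (fun q => R q c) fun q => K m n p q) =
        ctr (fun n => R n b) fun n => ctr (fun p => R p c) fun p =>
          ctr (fun q => R q d) fun q => K m q n p := by
      intro m
      rw [ctr_comm]
      simp only [ctr_comm (fun p => R p d) (fun q => R q c)]
    simp only [e1, e2, ← ctr_add, hK.bianchi, ctr_zero]

/-- A complex frame in which the metric `g` becomes Euclidean: `g = Pᵀ P`, `R = P⁻¹`. -/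
structure IsFrame (g : Matrix (Fin 4) (Fin 4) ℝ) (P R : Matrix (Fin 4) (Fin 4) ℂ) : Prop where
  metric : P.transpose * P = g.map Complex.ofReal
  right_inv : P * R = 1
  left_inv : R * P = 1
  -- The squares of both sides agree because `(det P)² = det g`. The sign is an orientation
  -- condition: it ensures that `s = 1` corresponds to `σ = 1`.
  det : dualEigenvalue g 1 * P.det = (Real.sqrt |g.det| : ℝ)

namespace IsFrame

variable {g : Matrix (Fin 4) (Fin 4) ℝ} {P R : Matrix (Fin 4) (Fin 4) ℂ}

theorem inv_eq (h : IsFrame g P R) : g⁻¹.map Complex.ofReal = R * R.transpose := by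
  have h1 : (g.map Complex.ofReal) * (R * R.transpose) = 1 := by
    rw [← h.metric, Matrix.mul_assoc, ← Matrix.mul_assoc P, h.right_inv, Matrix.one_mul,
      ← Matrix.transpose_mul, h.left_inv, Matrix.transpose_one]
  have h2 : (g.map Complex.ofReal)⁻¹ = R * R.transpose := Matrix.inv_eq_right_inv h1
  rw [← h2]
  have hu : IsUnit g.det := by
    have : IsUnit (g.map Complex.ofReal).det :=
      IsUnit.of_mul_eq_one _ (by rw [← Matrix.det_mul, h1, Matrix.det_one])
    rw [show g.map Complex.ofReal = Complex.ofRealHom.mapMatrix g from rfl, ← RingHom.map_det]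
      at this
    rw [isUnit_iff_ne_zero] at this ⊢
    intro h0
    exact this (by rw [h0, map_zero])
  symm
  apply Matrix.inv_eq_right_inv
  have : (g * g⁻¹).map Complex.ofRealHom = 1 := by
    rw [Matrix.mul_nonsing_inv _ hu]
    simp
  rw [Matrix.map_mul] at this
  exact this

theorem inv_apply (h : IsFrame g P R) (a b : Fin 4) :
    ((g⁻¹ a b : ℝ) : ℂ) = ∑ k, R a k * R b k := by
  have := congrFun (congrFun h.inv_eq a) b
  simpa [Matrix.mul_apply] using this

/-- The components of a bivector in the frame. -/
theorem bivectorOp_frame (h : IsFrame g P R) (K : Fin 4 → Fin 4 → Fin 4 → Fin 4 → ℝ)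
    (X : Matrix (Fin 4) (Fin 4) ℂ) :
    R.transpose * bivectorOp g K (P.transpose * X * P) * R =
      euclidOp (frameTensor R fun a b c d => (K a b c d : ℂ)) X := by
  have hX : (g⁻¹.map Complex.ofReal) * (P.transpose * X * P) * (g⁻¹.map Complex.ofReal).transpose =
      R * X * R.transpose := by
    rw [h.inv_eq, Matrix.transpose_mul, Matrix.transpose_transpose]
    calc R * R.transpose * (P.transpose * X * P) * (R * R.transpose)
        = R * (R.transpose * P.transpose) * X * (P * R) * R.transpose := by noncomm_ring
      _ = _ := by
        rw [← Matrix.transpose_mul, h.right_inv, Matrix.transpose_one, Matrix.mul_one,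
          Matrix.mul_one]
  have hop : ∀ m n, bivectorOp g K (P.transpose * X * P) m n =
      (1 / 2 : ℂ) * ∑ p, ∑ q, (K m n p q : ℂ) * (R * X * R.transpose) p q := by
    intro m n
    rw [← hX]
    simp only [bivectorOp, LinearMap.coe_mk, AddHom.coe_mk, Matrix.of_apply]
    congr 1
    refine Finset.sum_congr rfl fun p _ => Finset.sum_congr rfl fun q _ => ?_
    simp only [Matrix.mul_apply (M := _ * _) (N := (g⁻¹.map Complex.ofReal).transpose),
      Matrix.mul_apply (M := g⁻¹.map Complex.ofReal), Finset.sum_mul, Finset.mul_sum]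
    rw [Finset.sum_comm]
    refine Finset.sum_congr rfl fun d _ => Finset.sum_congr rfl fun c _ => ?_
    simp only [Matrix.transpose_apply, Matrix.map_apply]
    push_cast
    ring
  have inner : ∀ (k : Fin 4 → Fin 4 → ℂ),
      ∑ p, ∑ q, k p q * (R * X * R.transpose) p q =
        ∑ c, ∑ d, (ctr (fun p => R p c) fun p => ctr (fun q => R q d) fun q => k p q) * X c d := by
    intro k
    simp only [ctr, Matrix.mul_apply, Finset.mul_sum, Finset.sum_mul]
    rw [sum_comm_four, Finset.sum_comm]
    refine Finset.sum_congr rfl fun c _ => Finset.sum_congr rfl fun d _ => ?_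
    rw [Finset.sum_comm]
    refine Finset.sum_congr rfl fun p _ => Finset.sum_congr rfl fun q _ => ?_
    rw [Matrix.transpose_apply]
    ring
  ext a b
  have hl : (R.transpose * bivectorOp g K (P.transpose * X * P) * R) a b =
      ctr (fun m => R m a) fun m => ctr (fun n => R n b) fun n =>
        bivectorOp g K (P.transpose * X * P) m n := by
    refine Eq.trans ?_ (ctr_comm (fun n => R n b) (fun m => R m a)
      fun n m => bivectorOp g K (P.transpose * X * P) m n)
    simp only [ctr, Matrix.mul_apply (M := R.transpose * _), Matrix.mul_apply (M := R.transpose),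
      Matrix.transpose_apply]
    exact Finset.sum_congr rfl fun _ _ => mul_comm _ _
  rw [hl]
  simp only [hop, inner, ctr_mul_left, ctr_sum, ctr_mul_right, euclidOp, Matrix.of_apply,
    frameTensor]

/-- Since `g⁻¹ = R Rᵀ`, raising indices is invisible in the frame, and congruence by `P` intertwines
the operator with its Euclidean model. -/
theorem bivectorOp_eq (h : IsFrame g P R) (K : Fin 4 → Fin 4 → Fin 4 → Fin 4 → ℝ)
    (X : Matrix (Fin 4) (Fin 4) ℂ) :
    bivectorOp g K (P.transpose * X * P) =
      P.transpose * euclidOp (frameTensor R fun a b c d => (K a b c d : ℂ)) X * P := by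
  rw [← h.bivectorOp_frame]
  calc bivectorOp g K (P.transpose * X * P)
      = (R * P).transpose * bivectorOp g K (P.transpose * X * P) * (R * P) := by
        rw [h.left_inv, Matrix.transpose_one, Matrix.one_mul, Matrix.mul_one]
    _ = _ := by
        rw [Matrix.transpose_mul]
        noncomm_ring

theorem frameTensor_trace (h : IsFrame g P R) {K : Fin 4 → Fin 4 → Fin 4 → Fin 4 → ℝ}
    (hK : ∀ b d, ∑ f, ∑ r, g⁻¹ f r * K r b f d = 0) (b d : Fin 4) :
    ∑ a, frameTensor R (fun a b c d => (K a b c d : ℂ)) a b a d = 0 := by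
  have hK' : ∀ b d, ∑ a, (ctr (fun m => R m a) fun m => ctr (fun p => R p a) fun p =>
      (K m b p d : ℂ)) = 0 := by
    intro b d
    have e : ((∑ f, ∑ r, g⁻¹ f r * K r b f d : ℝ) : ℂ) = 0 := by rw [hK]; simp
    rw [← e]
    push_cast
    simp only [h.inv_apply, ctr, Finset.mul_sum, Finset.sum_mul]
    rw [Finset.sum_comm_cycle, Finset.sum_comm_cycle, Finset.sum_comm]
    refine Finset.sum_congr rfl fun p _ => Finset.sum_congr rfl fun m _ =>
      Finset.sum_congr rfl fun a _ => ?_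
    ring
  have e : ∀ a, frameTensor R (fun a b c d => (K a b c d : ℂ)) a b a d =
      ctr (fun n => R n b) fun n => ctr (fun q => R q d) fun q =>
        ctr (fun m => R m a) fun m => ctr (fun p => R p a) fun p => (K m n p q : ℂ) := by
    intro a
    simp only [frameTensor]
    rw [ctr_comm]
    simp only [ctr_comm (fun p => R p a) (fun q => R q d)]
  simp only [e, ← ctr_sum, hK', ctr_zero]

/-- The integrability condition in the frame. -/
theorem curvatureAction_frame (h : IsFrame g P R) {K : Fin 4 → Fin 4 → Fin 4 → Fin 4 → ℝ}
    {Y : Matrix (Fin 4) (Fin 4) ℝ}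
    (hW : ∀ a b c d, curvatureAction (fun f a b c => ∑ r, g⁻¹ f r * K r a b c) Y a b c d = 0)
    (a b c d : Fin 4) :
    ∑ f, (frameTensor R (fun a b c d => (K a b c d : ℂ)) f a c b *
          (R.transpose * Y.map Complex.ofReal * R) d f
        + frameTensor R (fun a b c d => (K a b c d : ℂ)) f b d a *
          (R.transpose * Y.map Complex.ofReal * R) c f
        + frameTensor R (fun a b c d => (K a b c d : ℂ)) f c a d *
          (R.transpose * Y.map Complex.ofReal * R) b f
        + frameTensor R (fun a b c d => (K a b c d : ℂ)) f d b c *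
          (R.transpose * Y.map Complex.ofReal * R) a f) = 0 := by
  set W : Fin 4 → Fin 4 → Fin 4 → Fin 4 → ℂ := fun a c b d =>
    ∑ f, ((∑ r, g⁻¹ f r * K r a c b : ℝ) : ℂ) * (Y d f : ℂ) with hWdef
  have term : ∀ a c b d, ∑ f, frameTensor R (fun a b c d => (K a b c d : ℂ)) f a c b *
      (R.transpose * Y.map Complex.ofReal * R) d f = frameTensor R W a c b d := by
    intro a c b d
    have hZ : ∀ f, (R.transpose * Y.map Complex.ofReal * R) d f =
        ctr (fun k => R k d) fun k => ∑ j, (Y k j : ℂ) * R j f := by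
      intro f
      rw [Matrix.mul_assoc, Matrix.mul_apply]
      simp only [ctr, Matrix.transpose_apply, Matrix.mul_apply, Matrix.map_apply]
    have hK : ∀ f, frameTensor R (fun a b c d => (K a b c d : ℂ)) f a c b =
        ctr (fun n => R n a) fun n => ctr (fun p => R p c) fun p => ctr (fun q => R q b) fun q =>
          ctr (fun m => R m f) fun m => (K m n p q : ℂ) := by
      intro f
      simp only [frameTensor]
      rw [ctr_comm]
      refine congrArg _ (funext fun n => ?_)
      rw [ctr_comm]
      refine congrArg _ (funext fun p => ?_)
      rw [ctr_comm]
    have hin : ∀ n p q k, ∑ f, (ctr (fun m => R m f) fun m => (K m n p q : ℂ)) *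
        (∑ j, (Y k j : ℂ) * R j f) = W n p q k := by
      intro n p q k
      simp only [hWdef, ctr]
      push_cast
      simp only [h.inv_apply, Finset.sum_mul, Finset.mul_sum]
      rw [Finset.sum_comm_cycle, Finset.sum_comm_cycle]
      refine Finset.sum_congr rfl fun j _ => Finset.sum_congr rfl fun m _ =>
        Finset.sum_congr rfl fun f _ => ?_
      ring
    simp only [hZ, hK]
    simp only [sum_ctr_mul, hin]
    simp only [frameTensor]
  have e2 : frameTensor R W b d a c = ctr (fun n => R n a) fun n => ctr (fun p => R p c) fun p =>
      ctr (fun q => R q b) fun q => ctr (fun k => R k d) fun k => W q k n p := by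
    simp only [frameTensor]
    simp only [ctr_comm (fun n => R n d) (fun n => R n a)]
    rw [ctr_comm]
    simp only [ctr_comm (fun n => R n d) (fun n => R n c)]
    simp only [ctr_comm (fun n => R n b) (fun n => R n c)]
  have e3 : frameTensor R W c a d b = ctr (fun n => R n a) fun n => ctr (fun p => R p c) fun p =>
      ctr (fun q => R q b) fun q => ctr (fun k => R k d) fun k => W p n k q := by
    simp only [frameTensor]
    rw [ctr_comm]
    simp only [ctr_comm (fun p => R p d) (fun q => R q b)]
  have e4 : frameTensor R W d b c a = ctr (fun n => R n a) fun n => ctr (fun p => R p c) fun p =>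
      ctr (fun q => R q b) fun q => ctr (fun k => R k d) fun k => W k q p n := by
    simp only [frameTensor]
    simp only [ctr_comm (fun n => R n c) (fun n => R n a)]
    simp only [ctr_comm (fun n => R n b) (fun n => R n a)]
    rw [ctr_comm]
    simp only [ctr_comm (fun n => R n b) (fun n => R n c)]
    simp only [ctr_comm (fun n => R n d) (fun n => R n c)]
    simp only [ctr_comm (fun n => R n d) (fun n => R n b)]
  simp only [Finset.sum_add_distrib, term, e2, e3, e4]
  simp only [frameTensor, ← ctr_add]
  have hz : ∀ m n p q, W m n p q + W p q m n + W n m q p + W q p n m = 0 := by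
    intro m n p q
    have := hW m p n q
    simp only [curvatureAction, Finset.sum_add_distrib] at this
    simp only [hWdef]
    exact_mod_cast this
  simp only [hz, ctr_zero]

end IsFrame
end Frames

/-! ### The Hodge star in a frame -/

section Hodge

/-- The standard basis vectors of `ℂ⁴`. -/
def stdVec (a j : Fin 4) : ℂ := if a = j then 1 else 0

theorem det_four (u v w x : Fin 4 → ℂ) :
    (Matrix.of ![u, v, w, x]).det =
      u 0 * v 1 * w 2 * x 3 - u 0 * v 1 * w 3 * x 2 - u 0 * v 2 * w 1 * x 3
      + u 0 * v 2 * w 3 * x 1 + u 0 * v 3 * w 1 * x 2 - u 0 * v 3 * w 2 * x 1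
      - u 1 * v 0 * w 2 * x 3 + u 1 * v 0 * w 3 * x 2 + u 1 * v 2 * w 0 * x 3
      - u 1 * v 2 * w 3 * x 0 - u 1 * v 3 * w 0 * x 2 + u 1 * v 3 * w 2 * x 0
      + u 2 * v 0 * w 1 * x 3 - u 2 * v 0 * w 3 * x 1 - u 2 * v 1 * w 0 * x 3
      + u 2 * v 1 * w 3 * x 0 + u 2 * v 3 * w 0 * x 1 - u 2 * v 3 * w 1 * x 0
      - u 3 * v 0 * w 1 * x 2 + u 3 * v 0 * w 2 * x 1 + u 3 * v 1 * w 0 * x 2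
      - u 3 * v 1 * w 2 * x 0 - u 3 * v 2 * w 0 * x 1 + u 3 * v 2 * w 1 * x 0 := by
  simp [Matrix.det_succ_row_zero, Fin.sum_univ_succ, Fin.succAbove]
  ring

theorem leviCivita_eq_det (a b c d : Fin 4) :
    (leviCivita a b c d : ℂ) = (Matrix.of ![stdVec a, stdVec b, stdVec c, stdVec d]).det := by
  have h : (Matrix.of ![stdVec a, stdVec b, stdVec c, stdVec d]) =
      Complex.ofRealHom.mapMatrix
        (Matrix.of fun i j : Fin 4 => if ![a, b, c, d] i = j then (1 : ℝ) else 0) := by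
    have hst : ∀ a j : Fin 4, stdVec a j = ((if a = j then 1 else 0 : ℝ) : ℂ) := fun a j => by
      unfold stdVec
      split_ifs <;> simp
    ext i j
    fin_cases i
    exacts [hst a j, hst b j, hst c j, hst d j]
  rw [h, ← RingHom.map_det]
  rfl

theorem ctr_stdVec_apply (r : Fin 4 → ℂ) (j : Fin 4) : ctr r (fun a => stdVec a j) = r j := by
  simp [ctr, stdVec]

/-- The symbol is the determinant of four standard vectors; by multilinearity each contraction
replaces one of them by the contracting vector. -/
theorem ctr_leviCivita (u v w x : Fin 4 → ℂ) :
    (ctr u fun a => ctr v fun b => ctr w fun c => ctr x fun d => (leviCivita a b c d : ℂ)) =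
      (Matrix.of ![u, v, w, x]).det := by
  have ctr_sub : ∀ r X X' : Fin 4 → ℂ, ctr r (fun a => X a - X' a) = ctr r X - ctr r X' :=
    fun r X X' => by simp only [ctr, mul_sub, Finset.sum_sub_distrib]
  simp only [leviCivita_eq_det, det_four, ctr_add, ctr_sub, ctr_mul_left, ctr_mul_right,
    ctr_stdVec_apply]

/-- The factor is `√|det g| · det R`, which the orientation condition in `IsFrame` makes equal to
the eigenvalue `1` or `i`. -/
theorem frameTensor_volForm {g : Matrix (Fin 4) (Fin 4) ℝ} {P R : Matrix (Fin 4) (Fin 4) ℂ}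
    (h : IsFrame g P R) (a b c d : Fin 4) :
    frameTensor R (fun a b c d => (volForm g a b c d : ℂ)) a b c d =
      dualEigenvalue g 1 * leviCivita a b c d := by
  have h1 : (Matrix.of ![fun m => R m a, fun m => R m b, fun m => R m c, fun m => R m d]) =
      Matrix.of ![stdVec a, stdVec b, stdVec c, stdVec d] * R.transpose := by
    ext i j
    fin_cases i <;> simp [Matrix.mul_apply, stdVec]
  have h2 : P.det * R.det = 1 := by rw [← Matrix.det_mul, h.right_inv, Matrix.det_one]
  simp only [frameTensor, volForm]
  push_cast
  simp only [ctr_mul_left, ctr_leviCivita]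
  rw [h1, Matrix.det_mul, Matrix.det_transpose, ← leviCivita_eq_det, ← h.det]
  linear_combination (dualEigenvalue g 1 * leviCivita a b c d) * h2

/-- The Hodge star of complex Euclidean four-space, on the skew part of a matrix. -/
def euclidStar (X : Matrix (Fin 4) (Fin 4) ℂ) : Matrix (Fin 4) (Fin 4) ℂ :=
  Matrix.of fun a b => (1 / 2 : ℂ) *
    !![0, X 2 3 - X 3 2, X 3 1 - X 1 3, X 1 2 - X 2 1;
      X 3 2 - X 2 3, 0, X 0 3 - X 3 0, X 2 0 - X 0 2;
      X 1 3 - X 3 1, X 3 0 - X 0 3, 0, X 0 1 - X 1 0;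
      X 2 1 - X 1 2, X 0 2 - X 2 0, X 1 0 - X 0 1, 0] a b

theorem euclidOp_leviCivita (X : Matrix (Fin 4) (Fin 4) ℂ) :
    euclidOp (fun a b c d => (leviCivita a b c d : ℂ)) X = euclidStar X := by
  ext a b
  simp only [euclidOp, leviCivita_eq_det, det_four, Fin.sum_univ_four, Matrix.of_apply]
  fin_cases a <;> fin_cases b <;> simp [stdVec, euclidStar] <;> ring

theorem hodgeStar_eq {g : Matrix (Fin 4) (Fin 4) ℝ} {P R : Matrix (Fin 4) (Fin 4) ℂ}
    (h : IsFrame g P R) (X : Matrix (Fin 4) (Fin 4) ℂ) :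
    hodgeStar g (P.transpose * X * P) =
      dualEigenvalue g 1 • (P.transpose * euclidStar X * P) := by
  have e : euclidOp (frameTensor R fun a b c d => (volForm g a b c d : ℂ)) X =
      dualEigenvalue g 1 • euclidStar X := by
    rw [← euclidOp_leviCivita]
    ext a b
    simp only [euclidOp, frameTensor_volForm h, Matrix.of_apply, Matrix.smul_apply, smul_eq_mul,
      Finset.mul_sum]
    exact Finset.sum_congr rfl fun _ _ => Finset.sum_congr rfl fun _ _ => by ring
  rw [hodgeStar, h.bivectorOp_eq, e, Matrix.mul_smul, Matrix.smul_mul]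

/-! ### Eigenvalues of the star and existence of frames -/

theorem dualEigenvalue_sq {g : Matrix (Fin 4) (Fin 4) ℝ} (hg : g.det ≠ 0) (σ : ℤˣ) :
    dualEigenvalue g σ ^ 2 = ((g.det / |g.det| : ℝ) : ℂ) := by
  have hσ : ((σ : ℤ) : ℂ) ^ 2 = 1 := by
    rcases Int.units_eq_one_or σ with rfl | rfl <;> simp
  rw [dualEigenvalue, mul_pow, hσ, one_mul]
  split_ifs with h
  · rw [abs_of_pos h, div_self hg]
    simp
  · rw [abs_of_neg (lt_of_le_of_ne (not_lt.mp h) hg), div_neg, div_self hg]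
    simp

theorem dualEigenvalue_ne_zero (g : Matrix (Fin 4) (Fin 4) ℝ) (σ : ℤˣ) :
    dualEigenvalue g σ ≠ 0 := by
  have hσ : ((σ : ℤ) : ℂ) ≠ 0 := by exact_mod_cast σ.ne_zero
  rw [dualEigenvalue]
  split_ifs
  · simp
  · exact mul_ne_zero hσ Complex.I_ne_zero

theorem dualEigenvalue_eq (g : Matrix (Fin 4) (Fin 4) ℝ) (σ : ℤˣ) :
    dualEigenvalue g σ = ((σ : ℤ) : ℂ) * dualEigenvalue g 1 := by
  simp [dualEigenvalue]

/-- A diagonalization of the metric yields a frame, up to signs. -/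
theorem exists_isFrame_of_diagonal {g Q : Matrix (Fin 4) (Fin 4) ℝ} {η : Fin 4 → ℝ}
    (hg : g.det ≠ 0) (h : g = Q.transpose * Matrix.diagonal η * Q) {c : Fin 4 → ℂ}
    (hc : ∀ i, c i ^ 2 = η i) :
    ∃ t : Fin 4 → ℝ, ∃ R : Matrix (Fin 4) (Fin 4) ℂ,
      IsFrame g (Matrix.diagonal (fun i => (t i : ℂ) * c i) * Q.map Complex.ofReal) R := by
  have hgC : g.map Complex.ofReal = (Q.map Complex.ofReal).transpose *
      Matrix.diagonal (fun i => (η i : ℂ)) * Q.map Complex.ofReal := by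
    have : Matrix.diagonal (fun i => (η i : ℂ)) = (Matrix.diagonal η).map Complex.ofRealHom := by
      ext i j
      by_cases hij : i = j <;> simp [hij]
    rw [this, h]
    change (Q.transpose * Matrix.diagonal η * Q).map Complex.ofRealHom = _
    rw [Matrix.map_mul, Matrix.map_mul]
    rfl
  have metric : ∀ t : Fin 4 → ℝ, (∀ i, t i ^ 2 = 1) →
      (Matrix.diagonal (fun i => (t i : ℂ) * c i) * Q.map Complex.ofReal).transpose *
        (Matrix.diagonal (fun i => (t i : ℂ) * c i) * Q.map Complex.ofReal) =
          g.map Complex.ofReal := by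
    intro t ht
    have hd : Matrix.diagonal (fun i => (t i : ℂ) * c i) *
        Matrix.diagonal (fun i => (t i : ℂ) * c i) = Matrix.diagonal fun i => (η i : ℂ) := by
      rw [Matrix.diagonal_mul_diagonal]
      congr 1
      funext i
      have hti : ((t i : ℂ)) ^ 2 = 1 := by exact_mod_cast ht i
      rw [← hc]
      linear_combination c i ^ 2 * hti
    rw [hgC, Matrix.transpose_mul, Matrix.diagonal_transpose, ← hd]
    noncomm_ring
  have hgdet : (g.map Complex.ofReal).det = (g.det : ℂ) := by
    rw [show g.map Complex.ofReal = Complex.ofRealHom.mapMatrix g from rfl, ← RingHom.map_det]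
    rfl
  have key : ∀ t : Fin 4 → ℝ, (∀ i, t i ^ 2 = 1) →
      dualEigenvalue g 1 * (Matrix.diagonal (fun i => (t i : ℂ) * c i) * Q.map Complex.ofReal).det
        = (Real.sqrt |g.det| : ℝ) → ∃ R : Matrix (Fin 4) (Fin 4) ℂ,
      IsFrame g (Matrix.diagonal (fun i => (t i : ℂ) * c i) * Q.map Complex.ofReal) R := by
    intro t ht hdet
    set P := Matrix.diagonal (fun i => (t i : ℂ) * c i) * Q.map Complex.ofReal
    have hu : IsUnit P.det := by
      rw [isUnit_iff_ne_zero]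
      intro h0
      have := congrArg Matrix.det (metric t ht)
      rw [Matrix.det_mul, h0, mul_zero, hgdet] at this
      exact hg (by exact_mod_cast this.symm)
    exact ⟨P⁻¹, metric t ht, Matrix.mul_nonsing_inv _ hu, Matrix.nonsing_inv_mul _ hu, hdet⟩
  have hsq : (dualEigenvalue g 1 *
      (Matrix.diagonal (fun i => ((1 : ℝ) : ℂ) * c i) * Q.map Complex.ofReal).det) ^ 2 =
        ((Real.sqrt |g.det| : ℝ) : ℂ) ^ 2 := by
    have hdet := congrArg Matrix.det (metric (fun _ => 1) (by simp))
    rw [Matrix.det_mul, Matrix.det_transpose, hgdet] at hdet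
    have hs : ((Real.sqrt |g.det| : ℝ) : ℂ) ^ 2 = (|g.det| : ℝ) := by
      rw [← Complex.ofReal_pow, Real.sq_sqrt (abs_nonneg _)]
    have habs : (|g.det| : ℝ) = g.det / |g.det| * g.det := by
      have : |g.det| ≠ 0 := abs_ne_zero.mpr hg
      field_simp
      rw [sq_abs]
    rw [mul_pow, dualEigenvalue_sq hg, hs, pow_two, hdet]
    exact_mod_cast habs.symm
  rcases sq_eq_sq_iff_eq_or_eq_neg.mp hsq with h1 | h1
  · exact ⟨_, key (fun _ => 1) (by simp) h1⟩
  · refine ⟨fun i => if i = 0 then -1 else 1, key _ (fun i => by split_ifs <;> norm_num) ?_⟩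
    rw [← neg_eq_iff_eq_neg] at h1
    rw [← h1, Matrix.det_mul, Matrix.det_mul, Matrix.det_diagonal, Matrix.det_diagonal]
    simp [Fin.prod_univ_four]

/-- Diagonalize `g` by the real spectral theorem and take complex square roots of the eigenvalues,
whatever their signs. -/
theorem exists_isFrame {g : Matrix (Fin 4) (Fin 4) ℝ} (hs : g.transpose = g) (hg : g.det ≠ 0) :
    ∃ P R, IsFrame g P R := by
  have hH : g.IsHermitian := by
    rw [Matrix.IsHermitian, Matrix.conjTranspose_eq_transpose_of_trivial, hs]
  have hsp := hH.spectral_theorem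
  rw [Unitary.conjStarAlgAut_apply] at hsp
  obtain ⟨c, hc⟩ : ∃ c : Fin 4 → ℂ, ∀ i, c i ^ 2 = (hH.eigenvalues i : ℂ) := by
    choose c hc using fun i => IsAlgClosed.exists_pow_nat_eq (hH.eigenvalues i : ℂ)
      (n := 2) (by norm_num)
    exact ⟨c, hc⟩
  obtain ⟨t, R, h⟩ := exists_isFrame_of_diagonal
    (Q := (hH.eigenvectorUnitary : Matrix (Fin 4) (Fin 4) ℝ).transpose) hg (by
      rw [Matrix.transpose_transpose]
      exact hsp) hc
  exact ⟨_, R, h⟩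

end Hodge

/-! ### The halves of the Weyl operator in a frame -/

section Halves

/-- The projection onto the (anti-)self-dual bivectors. -/
def halfProj (g : Matrix (Fin 4) (Fin 4) ℝ) (ε : ℂ) : Module.End ℂ (Matrix (Fin 4) (Fin 4) ℂ) :=
  -- For `ε` a star eigenvalue of `g`, `ε⁻² ⋆⋆` is the projection onto skew matrices. Used in place
  -- of the identity, it yields a projection defined on all matrices, whose formula involves no
  -- frame and is continuous in `g`.
  (1 / 2 : ℂ) • (ε⁻¹ • hodgeStar g + ε⁻¹ ^ 2 • (hodgeStar g * hodgeStar g))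

/-- The parametrization of the (anti-)self-dual bivectors by a frame. -/
def halfEmbed (P : Matrix (Fin 4) (Fin 4) ℂ) (s : ℂ) :
    (Fin 3 → ℂ) →ₗ[ℂ] Matrix (Fin 4) (Fin 4) ℂ where
  toFun c := P.transpose * (∑ i, c i • dualBasis s i) * P
  map_add' c c' := by
    simp only [Pi.add_apply, add_smul, Finset.sum_add_distrib, mul_add, add_mul]
  map_smul' r c := by
    simp only [Pi.smul_apply, smul_eq_mul, mul_smul, ← Finset.smul_sum, Matrix.mul_smul,
      Matrix.smul_mul, RingHom.id_apply]

/-- The components of the (anti-)self-dual part of a matrix. -/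
def euclidCoord (s : ℂ) (X : Matrix (Fin 4) (Fin 4) ℂ) : Fin 3 → ℂ :=
  ![(X 0 1 - X 1 0 + s * (X 2 3 - X 3 2)) / 4, (X 0 2 - X 2 0 + s * (X 3 1 - X 1 3)) / 4,
    (X 0 3 - X 3 0 + s * (X 1 2 - X 2 1)) / 4]

/-- The coordinates of the (anti-)self-dual part of a bivector in a frame. -/
def halfCoord (R : Matrix (Fin 4) (Fin 4) ℂ) (s : ℂ) :
    Matrix (Fin 4) (Fin 4) ℂ →ₗ[ℂ] (Fin 3 → ℂ) where
  toFun X := euclidCoord s (R.transpose * X * R)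
  map_add' X X' := by
    rw [mul_add, add_mul]
    ext i
    fin_cases i <;> simp [euclidCoord] <;> ring
  map_smul' r X := by
    rw [Matrix.mul_smul, Matrix.smul_mul]
    ext i
    fin_cases i <;> simp [euclidCoord] <;> ring

theorem euclidCoord_sum {s : ℂ} (hs : s * s = 1) (c : Fin 3 → ℂ) :
    euclidCoord s (∑ i, c i • dualBasis s i) = c := by
  ext i
  fin_cases i <;> simp [euclidCoord, dualBasis, Fin.sum_univ_three] <;> grind

theorem euclidStar_sum {s : ℂ} (hs : s * s = 1) (c : Fin 3 → ℂ) :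
    euclidStar (∑ i, c i • dualBasis s i) = s • ∑ i, c i • dualBasis s i := by
  ext a b
  fin_cases a <;> fin_cases b <;>
    simp [euclidStar, dualBasis, Fin.sum_univ_three] <;> grind

theorem euclidStar_projection {s : ℂ} (hs : s * s = 1) (X : Matrix (Fin 4) (Fin 4) ℂ) :
    (1 / 2 : ℂ) • (s • euclidStar X + euclidStar (euclidStar X)) =
      ∑ i, euclidCoord s X i • dualBasis s i := by
  ext a b
  fin_cases a <;> fin_cases b <;>
    simp [euclidStar, euclidCoord, dualBasis, Fin.sum_univ_three] <;> grind

variable {g : Matrix (Fin 4) (Fin 4) ℝ} {P R : Matrix (Fin 4) (Fin 4) ℂ}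

namespace IsFrame

theorem conj_left (h : IsFrame g P R) (X : Matrix (Fin 4) (Fin 4) ℂ) :
    R.transpose * (P.transpose * X * P) * R = X := by
  calc R.transpose * (P.transpose * X * P) * R
      = (R.transpose * P.transpose) * X * (P * R) := by noncomm_ring
    _ = X := by
      rw [← Matrix.transpose_mul, h.right_inv, Matrix.transpose_one, Matrix.one_mul,
        Matrix.mul_one]

theorem conj_right (h : IsFrame g P R) (X : Matrix (Fin 4) (Fin 4) ℂ) :
    P.transpose * (R.transpose * X * R) * P = X := by
  calc P.transpose * (R.transpose * X * R) * P
      = (P.transpose * R.transpose) * X * (R * P) := by noncomm_ring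
    _ = X := by
      rw [← Matrix.transpose_mul, h.left_inv, Matrix.transpose_one, Matrix.one_mul,
        Matrix.mul_one]

variable {s : ℂ}

theorem halfCoord_halfEmbed (h : IsFrame g P R) (hs : s * s = 1) (c : Fin 3 → ℂ) :
    halfCoord R s (halfEmbed P s c) = c := by
  simp only [halfCoord, halfEmbed, LinearMap.coe_mk, AddHom.coe_mk]
  rw [h.conj_left, euclidCoord_sum hs]

theorem hodgeStar_halfEmbed (h : IsFrame g P R) (hs : s * s = 1) (c : Fin 3 → ℂ) :
    hodgeStar g (halfEmbed P s c) = (s * dualEigenvalue g 1) • halfEmbed P s c := by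
  simp only [halfEmbed, LinearMap.coe_mk, AddHom.coe_mk]
  rw [hodgeStar_eq h, euclidStar_sum hs, Matrix.mul_smul, Matrix.smul_mul, smul_smul, mul_comm]

theorem halfProj_eq (h : IsFrame g P R) (hs : s * s = 1) :
    halfProj g (s * dualEigenvalue g 1) = halfEmbed P s ∘ₗ halfCoord R s := by
  have hε := dualEigenvalue_ne_zero g 1
  have hs0 : s ≠ 0 := fun h0 => by simp [h0] at hs
  ext1 X
  simp only [halfProj, LinearMap.smul_apply, LinearMap.add_apply, Module.End.mul_apply,
    LinearMap.comp_apply]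
  conv_lhs => rw [← h.conj_right X]
  simp only [halfEmbed, halfCoord, LinearMap.coe_mk, AddHom.coe_mk]
  rw [← euclidStar_projection hs, hodgeStar_eq h, map_smul, hodgeStar_eq h]
  simp only [Matrix.mul_smul, Matrix.smul_mul, Matrix.mul_add, Matrix.add_mul, smul_smul]
  have e1 : (s * dualEigenvalue g 1)⁻¹ * dualEigenvalue g 1 = s := by
    field_simp
    linear_combination -hs
  have e2 : (s * dualEigenvalue g 1)⁻¹ ^ 2 * (dualEigenvalue g 1 * dualEigenvalue g 1) = 1 := by
    field_simp
    linear_combination -hs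
  rw [e1, e2, one_smul]

/-- An eigenvector is fixed by `halfProj`, which factors through `halfEmbed`. -/
theorem eigenspace_hodgeStar (h : IsFrame g P R) (hs : s * s = 1) :
    Module.End.eigenspace (hodgeStar g) (s * dualEigenvalue g 1) =
      LinearMap.range (halfEmbed P s) := by
  have hε : s * dualEigenvalue g 1 ≠ 0 :=
    mul_ne_zero (fun h0 => by simp [h0] at hs) (dualEigenvalue_ne_zero g 1)
  ext X
  rw [Module.End.mem_eigenspace_iff]
  constructor
  · intro hX
    refine ⟨halfCoord R s X, ?_⟩
    rw [← LinearMap.comp_apply, ← h.halfProj_eq hs]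
    simp only [halfProj, LinearMap.smul_apply, LinearMap.add_apply, Module.End.mul_apply, hX,
      map_smul, smul_smul]
    have e : (s * dualEigenvalue g 1)⁻¹ ^ 2 * ((s * dualEigenvalue g 1) * (s * dualEigenvalue g 1))
        = 1 := by
      rw [← pow_two, ← mul_pow, inv_mul_cancel₀ hε, one_pow]
    rw [inv_mul_cancel₀ hε, e, one_smul, ← two_smul ℂ X, smul_smul]
    norm_num
  · rintro ⟨c, rfl⟩
    exact h.hodgeStar_halfEmbed hs c

/-- The parametrization of the (anti-)self-dual bivectors by a frame, as an equivalence. -/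
def halfEquiv (h : IsFrame g P R) (hs : s * s = 1) :
    (Fin 3 → ℂ) ≃ₗ[ℂ] Module.End.eigenspace (hodgeStar g) (s * dualEigenvalue g 1) :=
  (LinearEquiv.ofInjective (halfEmbed P s)
    (Function.LeftInverse.injective (h.halfCoord_halfEmbed hs))).trans
    (LinearEquiv.ofEq _ _ (h.eigenspace_hodgeStar hs).symm)

theorem coe_halfEquiv (h : IsFrame g P R) (hs : s * s = 1) (c : Fin 3 → ℂ) :
    (h.halfEquiv hs c : Matrix (Fin 4) (Fin 4) ℂ) = halfEmbed P s c := rfl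

/-- The matrix of a Weyl-like operator on the (anti-)self-dual bivectors. -/
theorem bivectorOp_halfEmbed (h : IsFrame g P R) (hs : s * s = 1)
    {K : Fin 4 → Fin 4 → Fin 4 → Fin 4 → ℝ}
    (hK : IsWeylLike (frameTensor R fun a b c d => (K a b c d : ℂ))) (c : Fin 3 → ℂ) :
    bivectorOp g K (halfEmbed P s c) = halfEmbed P s
      (Matrix.toLin' (dualMatrix (frameTensor R fun a b c d => (K a b c d : ℂ)) s) c) := by
  set κ := frameTensor R fun a b c d => (K a b c d : ℂ)
  have e : ∀ X, bivectorOp g K (P.transpose * X * P) = P.transpose * euclidOp κ X * P :=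
    h.bivectorOp_eq K
  have hsum : halfEmbed P s c = ∑ i, c i • (P.transpose * dualBasis s i * P) := by
    simp only [halfEmbed, LinearMap.coe_mk, AddHom.coe_mk, Matrix.mul_sum, Matrix.sum_mul,
      Matrix.mul_smul, Matrix.smul_mul]
  rw [hsum, map_sum]
  simp only [map_smul, e, hK.euclidOp_dualBasis hs]
  simp only [halfEmbed, LinearMap.coe_mk, AddHom.coe_mk, Matrix.toLin'_apply, Matrix.mulVec,
    dotProduct, Matrix.mul_sum, Matrix.sum_mul, Matrix.mul_smul, Matrix.smul_mul, Finset.smul_sum,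
    Finset.sum_smul, smul_smul]
  rw [Finset.sum_comm]
  exact Finset.sum_congr rfl fun _ _ => Finset.sum_congr rfl fun _ _ => by rw [mul_comm]

theorem actsWithType (h : IsFrame g P R) (hs : s * s = 1)
    {K : Fin 4 → Fin 4 → Fin 4 → Fin 4 → ℝ}
    (hK : IsWeylLike (frameTensor R fun a b c d => (K a b c d : ℂ))) {t : PetrovType}
    (ht : HasNormalForm
      (Matrix.toLin' (dualMatrix (frameTensor R fun a b c d => (K a b c d : ℂ)) s)) t) :
    ActsWithType (bivectorOp g K)
      (Module.End.eigenspace (hodgeStar g) (s * dualEigenvalue g 1)) t := by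
  obtain ⟨b, J, hJ, hb⟩ := ht
  refine ⟨b.map (h.halfEquiv hs), J, hJ, fun j => ?_⟩
  simp only [Module.Basis.map_apply, h.coe_halfEquiv hs, h.bivectorOp_halfEmbed hs hK, hb, map_sum,
    map_smul]

end IsFrame

end Halves

/-! ### A closed condition on the halves of the Weyl operator -/

section ClosedCondition

/-- The symmetries of a Weyl tensor of the metric `g`. -/
structure IsWeylTensor (g : Matrix (Fin 4) (Fin 4) ℝ)
    (K : Fin 4 → Fin 4 → Fin 4 → Fin 4 → ℝ) : Prop where
  curvatureLike : IsCurvatureLike K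
  trace : ∀ b d, ∑ f, ∑ r, g⁻¹ f r * K r b f d = 0

theorem IsCurvatureLike.ofReal {K : Fin 4 → Fin 4 → Fin 4 → Fin 4 → ℝ} (hK : IsCurvatureLike K) :
    IsCurvatureLike fun a b c d => (K a b c d : ℂ) where
  skew_left a b c d := by exact_mod_cast hK.skew_left a b c d
  skew_right a b c d := by exact_mod_cast hK.skew_right a b c d
  bianchi a b c d := by exact_mod_cast hK.bianchi a b c d

/-- The Weyl operator on one half of the bivectors, extended by zero to the other half. -/
def halfOp (g : Matrix (Fin 4) (Fin 4) ℝ) (K : Fin 4 → Fin 4 → Fin 4 → Fin 4 → ℝ) (ε : ℂ) :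
    Module.End ℂ (Matrix (Fin 4) (Fin 4) ℂ) :=
  bivectorOp g K * halfProj g ε

/-- The trace-free part of the square of `halfOp`. -/
def halfOpSq (g : Matrix (Fin 4) (Fin 4) ℝ) (K : Fin 4 → Fin 4 → Fin 4 → Fin 4 → ℝ) (ε : ℂ) :
    Module.End ℂ (Matrix (Fin 4) (Fin 4) ℂ) :=
  halfOp g K ε * halfOp g K ε -
    (LinearMap.trace ℂ _ (halfOp g K ε * halfOp g K ε) / 3) • halfProj g ε

/-- The operators `A` and `D` are linearly dependent. -/
def Proportional (A D : Module.End ℂ (Matrix (Fin 4) (Fin 4) ℂ)) : Prop :=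
  ∀ X X' : Matrix (Fin 4) (Fin 4) ℂ, ∀ a b a' b' : Fin 4,
    A X a b * D X' a' b' - A X' a' b' * D X a b = 0

variable {g : Matrix (Fin 4) (Fin 4) ℝ} {P R : Matrix (Fin 4) (Fin 4) ℂ}
  {K : Fin 4 → Fin 4 → Fin 4 → Fin 4 → ℝ} {s : ℂ}

theorem add_smul_euclidStar (hs : s * s = 1) {Z : Matrix (Fin 4) (Fin 4) ℂ}
    (hZ : Z.transpose = -Z) (h0 : dualCoord s Z = 0) : Z + s • euclidStar Z = 0 := by
  have c0 : Z 0 1 + s * Z 2 3 = 0 := congrFun h0 0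
  have c1 : Z 0 2 + s * Z 3 1 = 0 := congrFun h0 1
  have c2 : Z 0 3 + s * Z 1 2 = 0 := congrFun h0 2
  have hZ' : ∀ a b, Z a b = -Z b a := fun a b => congrFun (congrFun hZ b) a
  have hd : ∀ a, Z a a = 0 := fun a => by linear_combination hZ' a a / 2
  have z1 := hZ' 1 0
  have z2 := hZ' 2 0
  have z3 := hZ' 3 0
  have z4 := hZ' 3 2
  have z5 := hZ' 1 3
  have z6 := hZ' 2 1
  clear hZ' hZ h0
  ext a b
  fin_cases a <;> fin_cases b <;> simp [euclidStar, hd] <;> grind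

namespace IsFrame

theorem isWeylLike (h : IsFrame g P R) (hK : IsWeylTensor g K) :
    IsWeylLike (frameTensor R fun a b c d => (K a b c d : ℂ)) :=
  { frameTensor_curvatureLike R hK.curvatureLike.ofReal with
    trace := h.frameTensor_trace hK.trace }

/-- The operator on bivectors which acts on one half as the matrix `N`. -/
def halfMatrixOp (P R : Matrix (Fin 4) (Fin 4) ℂ) (s : ℂ) (N : Matrix (Fin 3) (Fin 3) ℂ) :
    Module.End ℂ (Matrix (Fin 4) (Fin 4) ℂ) :=
  halfEmbed P s ∘ₗ Matrix.toLin' N ∘ₗ halfCoord R s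

theorem halfMatrixOp_mul (h : IsFrame g P R) (hs : s * s = 1) (N N' : Matrix (Fin 3) (Fin 3) ℂ) :
    halfMatrixOp P R s N * halfMatrixOp P R s N' = halfMatrixOp P R s (N * N') := by
  ext1 X
  simp only [halfMatrixOp, Module.End.mul_apply, LinearMap.comp_apply, h.halfCoord_halfEmbed hs,
    Matrix.toLin'_mul]

theorem halfMatrixOp_one (h : IsFrame g P R) (hs : s * s = 1) :
    halfMatrixOp P R s 1 = halfProj g (s * dualEigenvalue g 1) := by
  rw [h.halfProj_eq hs, halfMatrixOp, Matrix.toLin'_one, LinearMap.id_comp]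

theorem halfMatrixOp_sub (N N' : Matrix (Fin 3) (Fin 3) ℂ) :
    halfMatrixOp P R s (N - N') = halfMatrixOp P R s N - halfMatrixOp P R s N' := by
  simp only [halfMatrixOp, map_sub, LinearMap.sub_comp, LinearMap.comp_sub]

theorem halfMatrixOp_smul (r : ℂ) (N : Matrix (Fin 3) (Fin 3) ℂ) :
    halfMatrixOp P R s (r • N) = r • halfMatrixOp P R s N := by
  simp only [halfMatrixOp, map_smul, LinearMap.smul_comp, LinearMap.comp_smul]

theorem halfMatrixOp_injective (h : IsFrame g P R) (hs : s * s = 1) :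
    Function.Injective (halfMatrixOp P R s) := by
  intro N N' hN
  refine Matrix.toLin'.injective (LinearMap.ext fun c => ?_)
  have := congrArg (halfCoord R s) (LinearMap.congr_fun hN (halfEmbed P s c))
  simpa only [halfMatrixOp, LinearMap.comp_apply, h.halfCoord_halfEmbed hs] using this

/-- Cyclicity of the trace, since `halfCoord ∘ halfEmbed` is the identity: extension by zero does
not change the trace. -/
theorem trace_halfMatrixOp (h : IsFrame g P R) (hs : s * s = 1) (N : Matrix (Fin 3) (Fin 3) ℂ) :
    LinearMap.trace ℂ _ (halfMatrixOp P R s N) = N.trace := by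
  rw [halfMatrixOp, LinearMap.trace_comp_comm']
  have : (Matrix.toLin' N ∘ₗ halfCoord R s) ∘ₗ halfEmbed P s = Matrix.toLin' N := by
    refine LinearMap.ext fun c => ?_
    simp only [LinearMap.comp_apply, h.halfCoord_halfEmbed hs]
  rw [this, Matrix.trace_toLin'_eq]

theorem halfOp_eq (h : IsFrame g P R) (hs : s * s = 1) (hK : IsWeylTensor g K) :
    halfOp g K (s * dualEigenvalue g 1) = halfMatrixOp P R s
      (dualMatrix (frameTensor R fun a b c d => (K a b c d : ℂ)) s) := by
  ext1 X
  rw [halfOp, h.halfProj_eq hs, Module.End.mul_apply, LinearMap.comp_apply,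
    h.bivectorOp_halfEmbed hs (h.isWeylLike hK)]
  rfl

theorem halfOpSq_eq (h : IsFrame g P R) (hs : s * s = 1) (hK : IsWeylTensor g K) :
    halfOpSq g K (s * dualEigenvalue g 1) = halfMatrixOp P R s
      (dualMatrix (frameTensor R fun a b c d => (K a b c d : ℂ)) s *
          dualMatrix (frameTensor R fun a b c d => (K a b c d : ℂ)) s -
        ((dualMatrix (frameTensor R fun a b c d => (K a b c d : ℂ)) s *
          dualMatrix (frameTensor R fun a b c d => (K a b c d : ℂ)) s).trace / 3) • 1) := by
  rw [halfOpSq, h.halfOp_eq hs hK, h.halfMatrixOp_mul hs, h.trace_halfMatrixOp hs,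
    halfMatrixOp_sub, halfMatrixOp_smul, h.halfMatrixOp_one hs]

theorem transpose_conj_map_ofReal {Y : Matrix (Fin 4) (Fin 4) ℝ} (hY : Y.transpose = -Y)
    (R : Matrix (Fin 4) (Fin 4) ℂ) :
    (R.transpose * Y.map Complex.ofReal * R).transpose =
      -(R.transpose * Y.map Complex.ofReal * R) := by
  have hYC : (Y.map Complex.ofReal).transpose = -Y.map Complex.ofReal := by
    ext a b
    have := congrFun (congrFun hY a) b
    simp only [Matrix.transpose_apply, Matrix.neg_apply, Matrix.map_apply] at this ⊢
    rw [this, Complex.ofReal_neg]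
  rw [Matrix.transpose_mul, Matrix.transpose_mul, Matrix.transpose_transpose, hYC]
  noncomm_ring

theorem dualCoord_ne_zero (h : IsFrame g P R) (hs : s * s = 1) {Y : Matrix (Fin 4) (Fin 4) ℝ}
    (hY : Y.transpose = -Y)
    (hne : (1 / 2 : ℂ) • (Y.map Complex.ofReal + (s * dualEigenvalue g 1)⁻¹ •
      hodgeStar g (Y.map Complex.ofReal)) ≠ 0) :
    dualCoord s (R.transpose * Y.map Complex.ofReal * R) ≠ 0 := by
  intro h0
  apply hne
  have hε := dualEigenvalue_ne_zero g 1
  have hs0 : s ≠ 0 := fun h0 => by simp [h0] at hs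
  have e1 : (s * dualEigenvalue g 1)⁻¹ * dualEigenvalue g 1 = s := by
    field_simp
    linear_combination -hs
  rw [← h.conj_right (Y.map Complex.ofReal)]
  set Z := R.transpose * Y.map Complex.ofReal * R
  have hZ : Z.transpose = -Z := transpose_conj_map_ofReal hY R
  have hz := add_smul_euclidStar hs hZ h0
  rw [hodgeStar_eq h, smul_smul, e1, ← Matrix.smul_mul, ← Matrix.mul_smul, ← Matrix.add_mul,
    ← Matrix.mul_add, hz, Matrix.mul_zero, Matrix.zero_mul, smul_zero]

/-- The closed condition holds wherever the corresponding half of the 2-form does not vanish. -/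
theorem proportional (h : IsFrame g P R) (hs : s * s = 1) (hK : IsWeylTensor g K)
    {Y : Matrix (Fin 4) (Fin 4) ℝ} (hY : Y.transpose = -Y)
    (hW : ∀ a b c d, curvatureAction (fun f a b c => ∑ r, g⁻¹ f r * K r a b c) Y a b c d = 0)
    (hne : (1 / 2 : ℂ) • (Y.map Complex.ofReal + (s * dualEigenvalue g 1)⁻¹ •
      hodgeStar g (Y.map Complex.ofReal)) ≠ 0) :
    Proportional (halfOp g K (s * dualEigenvalue g 1))
      (halfOpSq g K (s * dualEigenvalue g 1)) := by
  have hw := h.isWeylLike hK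
  have hZ := transpose_conj_map_ofReal hY R
  obtain ⟨ν, hν⟩ := exists_quadratic_of_commute (hw.dualMatrix_transpose s)
    (hw.dualMatrix_trace s) (h.dualCoord_ne_zero hs hY hne)
    (hw.dualMatrix_commute hs hZ (h.curvatureAction_frame hW))
  -- From `M² = ν M + 2ν²` and `tr M = 0`, one third of `tr M²` is `2ν²`, so the trace-free part of
  -- `M²` is exactly `ν M`.
  have hD : halfOpSq g K (s * dualEigenvalue g 1) =
      ν • halfOp g K (s * dualEigenvalue g 1) := by
    rw [h.halfOpSq_eq hs hK, h.halfOp_eq hs hK, ← halfMatrixOp_smul, hν, Matrix.trace_add,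
      Matrix.trace_smul, Matrix.trace_smul, hw.dualMatrix_trace s, Matrix.trace_one]
    congr 1
    simp only [smul_eq_mul, mul_zero, zero_add, Fintype.card_fin]
    push_cast
    rw [mul_div_assoc, div_self (by norm_num : (3 : ℂ) ≠ 0), mul_one, add_sub_cancel_right]
  rw [hD]
  intro X X' a b a' b'
  simp only [LinearMap.smul_apply, Matrix.smul_apply, smul_eq_mul]
  ring

/-- The closed condition forces the half of the Weyl operator to be of type `O`, `N` or `D`. -/
theorem exists_hasNormalForm_of_proportional (h : IsFrame g P R) (hs : s * s = 1)
    (hK : IsWeylTensor g K) (hp : Proportional (halfOp g K (s * dualEigenvalue g 1))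
      (halfOpSq g K (s * dualEigenvalue g 1))) :
    ∃ t ∈ ({.O, .N, .D} : Set PetrovType), HasNormalForm
      (Matrix.toLin' (dualMatrix (frameTensor R fun a b c d => (K a b c d : ℂ)) s)) t := by
  have hw := h.isWeylLike hK
  have hA := h.halfOp_eq hs hK
  have hD := h.halfOpSq_eq hs hK
  set M := dualMatrix (frameTensor R fun a b c d => (K a b c d : ℂ)) s with hM
  obtain ⟨μ, κ, hq⟩ : ∃ μ κ : ℂ, M * M = μ • M + κ • (1 : Matrix (Fin 3) (Fin 3) ℂ) := by
    by_cases h0 : halfOp g K (s * dualEigenvalue g 1) = 0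
    · have : M = 0 := h.halfMatrixOp_injective hs (by
        rw [← hA, h0]
        simp [halfMatrixOp])
      exact ⟨0, 0, by simp [this]⟩
    · obtain ⟨X, hX⟩ : ∃ X, halfOp g K (s * dualEigenvalue g 1) X ≠ 0 := by
        by_contra! hc
        exact h0 (LinearMap.ext hc)
      obtain ⟨a, b, hab⟩ : ∃ a b, halfOp g K (s * dualEigenvalue g 1) X a b ≠ 0 := by
        by_contra! hc
        exact hX (Matrix.ext hc)
      -- The minors through one non-zero entry of the operator express its trace-free square as a
      -- multiple of it.
      set μ := halfOpSq g K (s * dualEigenvalue g 1) X a b /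
        halfOp g K (s * dualEigenvalue g 1) X a b with hμ
      have e : halfOpSq g K (s * dualEigenvalue g 1) =
          μ • halfOp g K (s * dualEigenvalue g 1) := by
        ext1 X'
        ext a' b'
        rw [LinearMap.smul_apply, Matrix.smul_apply, smul_eq_mul, hμ, div_mul_eq_mul_div,
          eq_div_iff hab]
        linear_combination hp X X' a b a' b'
      rw [hA, hD, ← halfMatrixOp_smul] at e
      exact ⟨μ, _, sub_eq_iff_eq_add.mp (h.halfMatrixOp_injective hs e)⟩
  refine exists_hasNormalForm (by simp) (μ := μ) (κ := κ) ?_ ?_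
  · rw [Matrix.trace_toLin'_eq, hw.dualMatrix_trace s]
  · rw [Module.End.mul_eq_comp, ← Matrix.toLin'_mul, hq, map_add, map_smul, map_smul,
      Matrix.toLin'_one]
    rfl

end IsFrame

end ClosedCondition

/-! ### The closed condition passes to limits -/

section Limits

open Filter

variable {T : Type*} [TopologicalSpace T] {y : T} {G : T → Matrix (Fin 4) (Fin 4) ℝ}

theorem continuousAt_matrix_inv {n : Type*} [Fintype n] [DecidableEq n] {G : T → Matrix n n ℝ}
    (hG : ContinuousAt G y) (hdet : (G y).det ≠ 0) : ContinuousAt (fun z => (G z)⁻¹) y := by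
  simp only [Matrix.inv_def, Ring.inverse_eq_inv']
  have h1 : ContinuousAt (fun z => (G z).det) y :=
    (continuous_id.matrix_det).continuousAt.comp hG
  have h2 : ContinuousAt (fun z => (G z).adjugate) y :=
    (continuous_id.matrix_adjugate).continuousAt.comp hG
  exact (h1.inv₀ hdet).smul h2

theorem continuousAt_bivectorOp {K : T → Fin 4 → Fin 4 → Fin 4 → Fin 4 → ℝ}
    (hG : ContinuousAt G y) (hdet : (G y).det ≠ 0)
    (hK : ∀ a b c d, ContinuousAt (fun z => K z a b c d) y)
    {X : T → Matrix (Fin 4) (Fin 4) ℂ} (hX : ContinuousAt X y) :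
    ContinuousAt (fun z => bivectorOp (G z) (K z) (X z)) y := by
  have hi := continuousAt_matrix_inv hG hdet
  have hi' : ∀ a b, ContinuousAt (fun z => (G z)⁻¹ a b) y := fun a b =>
    continuousAt_pi.mp (continuousAt_pi.mp hi a) b
  have hX' : ∀ a b, ContinuousAt (fun z => X z a b) y := fun a b =>
    continuousAt_pi.mp (continuousAt_pi.mp hX a) b
  refine continuousAt_pi.mpr fun a => continuousAt_pi.mpr fun b => ?_
  simp only [bivectorOp, LinearMap.coe_mk, AddHom.coe_mk, Matrix.of_apply]
  refine continuousAt_const.mul ?_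
  refine tendsto_finsetSum _ fun p _ => tendsto_finsetSum _ fun q _ =>
    tendsto_finsetSum _ fun c _ => tendsto_finsetSum _ fun d _ => ?_
  exact ContinuousAt.mul (Complex.continuous_ofReal.continuousAt.comp
    (((hK a b p q).mul (hi' p c)).mul (hi' q d))) (hX' c d)

theorem continuousAt_hodgeStar (hG : ContinuousAt G y) (hdet : (G y).det ≠ 0)
    {X : T → Matrix (Fin 4) (Fin 4) ℂ} (hX : ContinuousAt X y) :
    ContinuousAt (fun z => hodgeStar (G z) (X z)) y := by
  refine continuousAt_bivectorOp hG hdet (fun a b c d => ?_) hX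
  have h1 : ContinuousAt (fun z => (G z).det) y :=
    (continuous_id.matrix_det).continuousAt.comp hG
  exact (Real.continuous_sqrt.continuousAt.comp h1.abs).mul continuousAt_const

theorem continuousAt_halfProj (hG : ContinuousAt G y) (hdet : (G y).det ≠ 0) (ε : ℂ)
    {X : T → Matrix (Fin 4) (Fin 4) ℂ} (hX : ContinuousAt X y) :
    ContinuousAt (fun z => halfProj (G z) ε (X z)) y := by
  have h1 := continuousAt_hodgeStar hG hdet hX
  have h2 := continuousAt_hodgeStar hG hdet h1
  simp only [halfProj, LinearMap.smul_apply, LinearMap.add_apply, Module.End.mul_apply]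
  exact ((h1.const_smul ε⁻¹).add (h2.const_smul (ε⁻¹ ^ 2))).const_smul (1 / 2 : ℂ)

variable {K : T → Fin 4 → Fin 4 → Fin 4 → Fin 4 → ℝ}

theorem continuousAt_halfOp (hG : ContinuousAt G y) (hdet : (G y).det ≠ 0)
    (hK : ∀ a b c d, ContinuousAt (fun z => K z a b c d) y) (ε : ℂ)
    {X : T → Matrix (Fin 4) (Fin 4) ℂ} (hX : ContinuousAt X y) :
    ContinuousAt (fun z => halfOp (G z) (K z) ε (X z)) y :=
  continuousAt_bivectorOp hG hdet hK (continuousAt_halfProj hG hdet ε hX)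

theorem continuousAt_trace {V : Type*} [AddCommGroup V] [Module ℂ V] [FiniteDimensional ℂ V]
    [TopologicalSpace V] [IsTopologicalAddGroup V] [ContinuousSMul ℂ V] [T2Space V]
    {F : T → Module.End ℂ V} (hF : ∀ X, ContinuousAt (fun z => F z X) y) :
    ContinuousAt (fun z => LinearMap.trace ℂ V (F z)) y := by
  have b := Module.finBasis ℂ V
  simp only [LinearMap.trace_eq_matrix_trace ℂ b, Matrix.trace, Matrix.diag_apply,
    LinearMap.toMatrix_apply]
  refine tendsto_finsetSum _ fun i _ => ?_
  exact (LinearMap.continuous_of_finiteDimensional (b.coord i)).continuousAt.comp (hF (b i))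

theorem continuousAt_halfOpSq (hG : ContinuousAt G y) (hdet : (G y).det ≠ 0)
    (hK : ∀ a b c d, ContinuousAt (fun z => K z a b c d) y) (ε : ℂ)
    (X : Matrix (Fin 4) (Fin 4) ℂ) :
    ContinuousAt (fun z => halfOpSq (G z) (K z) ε X) y := by
  have h : ∀ X, ContinuousAt (fun z => (halfOp (G z) (K z) ε * halfOp (G z) (K z) ε) X) y := by
    intro X
    have h1 := continuousAt_halfOp hG hdet hK ε (X := fun _ => X) continuousAt_const
    have h2 := continuousAt_halfOp hG hdet hK ε h1
    simpa only [Module.End.mul_apply] using h2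
  have ht := (continuousAt_trace h).div_const 3
  have hp := continuousAt_halfProj hG hdet ε (X := fun _ => X) continuousAt_const
  simp only [halfOpSq, LinearMap.sub_apply, LinearMap.smul_apply]
  exact (h X).sub (ht.smul hp)

/-- The determinant keeps its sign near `y`, so the eigenvalue, which depends only on that sign, is
locally constant. -/
theorem eventually_dualEigenvalue_eq (hG : ContinuousAt G y) (hdet : (G y).det ≠ 0) (σ : ℤˣ) :
    ∀ᶠ z in 𝓝 y, dualEigenvalue (G z) σ = dualEigenvalue (G y) σ := by
  have h1 : ContinuousAt (fun z => (G z).det) y :=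
    (continuous_id.matrix_det).continuousAt.comp hG
  rcases lt_or_gt_of_ne hdet with h | h
  · filter_upwards [h1.eventually_lt continuousAt_const h] with z hz
    simp [dualEigenvalue, not_lt.mpr h.le, not_lt.mpr hz.le]
  · filter_upwards [continuousAt_const.eventually_lt h1 h] with z hz
    simp [dualEigenvalue, h, hz]

/-- Stating proportionality by minors makes it closed with no control of the factor: a minor that is
non-zero at `y` would be non-zero at all nearby points. -/
theorem proportional_of_frequently (hG : ContinuousAt G y) (hdet : (G y).det ≠ 0)
    (hK : ∀ a b c d, ContinuousAt (fun z => K z a b c d) y) {σ : ℤˣ}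
    (h : ∃ᶠ z in 𝓝 y, Proportional (halfOp (G z) (K z) (dualEigenvalue (G z) σ))
      (halfOpSq (G z) (K z) (dualEigenvalue (G z) σ))) :
    Proportional (halfOp (G y) (K y) (dualEigenvalue (G y) σ))
      (halfOpSq (G y) (K y) (dualEigenvalue (G y) σ)) := by
  have h' : ∃ᶠ z in 𝓝 y, Proportional (halfOp (G z) (K z) (dualEigenvalue (G y) σ))
      (halfOpSq (G z) (K z) (dualEigenvalue (G y) σ)) := by
    refine (h.and_eventually (eventually_dualEigenvalue_eq hG hdet σ)).mono ?_
    rintro z ⟨hz, e⟩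
    rwa [e] at hz
  intro X X' a b a' b'
  have c1 : ∀ X a b, ContinuousAt
      (fun z => halfOp (G z) (K z) (dualEigenvalue (G y) σ) X a b) y := fun X a b =>
    continuousAt_pi.mp (continuousAt_pi.mp
      (continuousAt_halfOp hG hdet hK _ continuousAt_const) a) b
  have c2 : ∀ X a b, ContinuousAt
      (fun z => halfOpSq (G z) (K z) (dualEigenvalue (G y) σ) X a b) y := fun X a b =>
    continuousAt_pi.mp (continuousAt_pi.mp (continuousAt_halfOpSq hG hdet hK _ X) a) b
  have hc := ((c1 X a b).mul (c2 X' a' b')).sub ((c1 X' a' b').mul (c2 X a b))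
  by_contra hne
  exact h' ((hc.eventually_ne hne).mono fun z hz hp => hz (hp X X' a b a' b'))

end Limits

/-! ### The two halves of the Weyl tensor of a manifold with a conformal Killing-Yano 2-form -/

section HalfTypes

open Filter

theorem continuousAt_weyl {n : ℕ} {G : E n → Matrix (Fin n) (Fin n) ℝ} {U : Set (E n)} {y : E n}
    (hU : IsOpen U) (hG : SmoothMat U G) (hdet : ∀ z ∈ U, (G z).det ≠ 0) (hy : y ∈ U)
    (a b c d : Fin n) : ContinuousAt (fun z => weyl G z a b c d) y := by
  have hn := hU.mem_nhds hy
  have h1 : ∀ i j, ContinuousAt (fun z => G z i j) y := fun i j =>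
    (hG i j).continuousOn.continuousAt hn
  have h2 : ∀ i j, ContinuousAt (fun z => (G z)⁻¹ i j) y := fun i j =>
    (hG.inv hdet i j).continuousOn.continuousAt hn
  have h3 : ∀ r s m k, ContinuousAt (fun z => riemannUp G z r s m k) y := fun r s m k =>
    (curvMat_smooth hU hG hdet m k r s).continuousOn.continuousAt hn
  have h4 : ∀ i j, ContinuousAt (fun z => ricci G z i j) y := fun i j =>
    tendsto_finsetSum _ fun r _ => h3 r i r j
  have h5 : ContinuousAt (fun z => scalarCurv G z) y :=
    tendsto_finsetSum _ fun i _ => tendsto_finsetSum _ fun j _ => (h2 i j).mul (h4 i j)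
  have h6 : ContinuousAt (fun z => riemann G z a b c d) y :=
    tendsto_finsetSum _ fun r _ => (h1 a r).mul (h3 r b c d)
  unfold weyl
  exact (h6.sub (continuousAt_const.mul (((((h1 a c).mul (h4 b d)).sub ((h1 a d).mul (h4 b c))).add
    ((h1 b d).mul (h4 a c))).sub ((h1 b c).mul (h4 a d))))).add
    ((h5.div_const _).mul (((h1 a c).mul (h1 b d)).sub ((h1 a d).mul (h1 b c))))

variable {M : Type u} [TopologicalSpace M] [ChartedSpace (E 4) M]
  {g : Metric 4 M} {Y : TwoForm 4 M} {e : OpenPartialHomeomorph M (E 4)} {x : M}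

theorem isWeylTensor (g : Metric 4 M) (he : e ∈ charts 4 M) {y : E 4} (hy : y ∈ e.target) :
    IsWeylTensor (comp g.val e y) (weyl (comp g.val e) y) := by
  have hs := comp_transpose_of_isSymm g.symm e
  have hdet : ∀ z ∈ e.target, (comp g.val e z).det ≠ 0 := fun z hz => comp_det_ne_zero g he hz
  have hR := riemann_curvatureLike e.open_target (g.smooth e he) hdet hs hy
  refine ⟨weyl_curvatureLike (hdet y hy) (hs y) hR, fun b d => ?_⟩
  exact weylUp_trace (by norm_num) (hdet y hy) (hs y) hR b d

theorem exists_isFrame_comp (g : Metric 4 M) (he : e ∈ charts 4 M) {y : E 4}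
    (hy : y ∈ e.target) : ∃ P R, IsFrame (comp g.val e y) P R :=
  exists_isFrame (comp_transpose_of_isSymm g.symm e y) (comp_det_ne_zero g he hy)

theorem intCast_units_mul_self (σ : ℤˣ) : ((σ : ℤ) : ℂ) * ((σ : ℤ) : ℂ) = 1 := by
  rcases Int.units_eq_one_or σ with rfl | rfl <;> simp

theorem IsCKY.exists_hasNormalForm (h : IsCKY g Y) (he : e ∈ charts 4 M) (hx : x ∈ e.source)
    {σ : ℤˣ} (hσ : HalfNonzeroNear g Y e x σ) {P R : Matrix (Fin 4) (Fin 4) ℂ}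
    (hF : IsFrame (comp g.val e (e x)) P R) :
    ∃ t ∈ ({.O, .N, .D} : Set PetrovType), HasNormalForm (Matrix.toLin' (dualMatrix
      (frameTensor R fun a b c d => (weyl (comp g.val e) (e x) a b c d : ℂ)) ((σ : ℤ) : ℂ))) t := by
  have hs := intCast_units_mul_self σ
  have hec := e.continuousAt hx
  have hy := e.map_source hx
  have hdet : ∀ z ∈ e.target, (comp g.val e z).det ≠ 0 := fun z hz => comp_det_ne_zero g he hz
  have hG : ContinuousAt (fun z => comp g.val e (e z)) x := by
    refine continuousAt_pi.mpr fun i => continuousAt_pi.mpr fun j => ?_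
    exact ContinuousAt.comp (f := e) (g := fun z => comp g.val e z i j)
      ((g.smooth e he i j).continuousOn.continuousAt (e.open_target.mem_nhds hy)) hec
  have hK : ∀ a b c d, ContinuousAt (fun z => weyl (comp g.val e) (e z) a b c d) x :=
    fun a b c d => ContinuousAt.comp (f := e) (g := fun z => weyl (comp g.val e) z a b c d)
      (continuousAt_weyl e.open_target (g.smooth e he) hdet hy a b c d) hec
  refine hF.exists_hasNormalForm_of_proportional hs (isWeylTensor g he hy) ?_
  rw [← dualEigenvalue_eq]
  refine proportional_of_frequently hG (hdet _ hy) hK ?_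
  refine (hσ.and_eventually (e.open_source.mem_nhds hx)).mono ?_
  rintro z ⟨hz, hzs⟩
  have hzt := e.map_source hzs
  -- This frame is unrelated to the one at `x`; no continuous choice is needed because the closed
  -- condition mentions no frame.
  obtain ⟨P', R', hF'⟩ := exists_isFrame_comp g he hzt
  rw [halfPart, dualEigenvalue_eq] at hz
  rw [dualEigenvalue_eq]
  exact hF'.proportional hs (isWeylTensor g he hzt) (comp_transpose_of_isAlt Y.alt e (e z))
    (h.curvatureAction_weyl (by norm_num) he hzt) hz

theorem halfWeylHasType_of_hasNormalForm (he : e ∈ charts 4 M) (hx : x ∈ e.source) {σ : ℤˣ}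
    {P R : Matrix (Fin 4) (Fin 4) ℂ} (hF : IsFrame (comp g.val e (e x)) P R) {t : PetrovType}
    (ht : HasNormalForm (Matrix.toLin' (dualMatrix
      (frameTensor R fun a b c d => (weyl (comp g.val e) (e x) a b c d : ℂ)) ((σ : ℤ) : ℂ))) t) :
    HalfWeylHasType g e x σ t := by
  have := hF.actsWithType (intCast_units_mul_self σ)
    (hF.isWeylLike (isWeylTensor g he (e.map_source hx))) ht
  rwa [← dualEigenvalue_eq] at this

/-- A half of the Weyl tensor is of type `O`, `N` or `D` if the corresponding half of some
conformal Killing-Yano 2-form is non-zero. -/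
theorem IsCKY.exists_halfWeylHasType (h : IsCKY g Y) (he : e ∈ charts 4 M) (hx : x ∈ e.source)
    {σ : ℤˣ} (hσ : HalfNonzeroNear g Y e x σ) :
    ∃ t ∈ ({.O, .N, .D} : Set PetrovType), HalfWeylHasType g e x σ t := by
  obtain ⟨P, R, hF⟩ := exists_isFrame_comp g he (e.map_source hx)
  obtain ⟨t, ht, hN⟩ := h.exists_hasNormalForm he hx hσ hF
  exact ⟨t, ht, halfWeylHasType_of_hasNormalForm he hx hF hN⟩

end HalfTypes

/-! ### Lorentzian and Euclidean signature -/

section Signature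

open Filter
open scoped ComplexConjugate ComplexOrder

/-! ### Lorentzian signature: complex conjugation -/

theorem map_conj_mem_normalForms {t : PetrovType} {J : Matrix (Fin 3) (Fin 3) ℂ}
    (hJ : J ∈ t.normalForms) : J.map conj ∈ t.normalForms := by
  have inj : Function.Injective (conj : ℂ → ℂ) := star_injective
  have hc : ∀ z : ℂ, z ≠ 0 → conj z ≠ 0 := fun z hz => by simpa using hz
  cases t
  · rw [show J = 0 from hJ]
    simp [PetrovType.normalForms]
  · rw [show J = _ from hJ]
    refine Set.mem_singleton_iff.mpr ?_
    ext i j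
    fin_cases i <;> fin_cases j <;> simp
  · obtain ⟨l, hl, rfl⟩ := hJ
    refine ⟨conj l, hc l hl, ?_⟩
    ext i j
    fin_cases i <;> fin_cases j <;> simp [Complex.ext_iff]
  · rw [show J = _ from hJ]
    refine Set.mem_singleton_iff.mpr ?_
    ext i j
    fin_cases i <;> fin_cases j <;> simp
  · obtain ⟨l, hl, rfl⟩ := hJ
    refine ⟨conj l, hc l hl, ?_⟩
    ext i j
    fin_cases i <;> fin_cases j <;> simp [Complex.ext_iff]
  · obtain ⟨l, m, k, h1, h2, h3, h4, rfl⟩ := hJ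
    refine ⟨conj l, conj m, conj k, inj.ne h1, inj.ne h2, inj.ne h3, ?_, ?_⟩
    · rw [← map_add, ← map_add, h4, map_zero]
    · ext i j
      fin_cases i <;> fin_cases j <;> simp

theorem bivectorOp_map_conj (g : Matrix (Fin 4) (Fin 4) ℝ)
    (K : Fin 4 → Fin 4 → Fin 4 → Fin 4 → ℝ) (X : Matrix (Fin 4) (Fin 4) ℂ) :
    bivectorOp g K (X.map conj) = (bivectorOp g K X).map conj := by
  ext a b
  simp only [bivectorOp, LinearMap.coe_mk, AddHom.coe_mk, Matrix.of_apply, Matrix.map_apply,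
    map_mul, map_sum, Complex.conj_ofReal, map_div₀, map_one, map_ofNat]

theorem map_conj_sum_smul {V : Type*} {ι : Type*} [Fintype ι] (c : ι → ℂ)
    (X : ι → Matrix V V ℂ) :
    (∑ i, c i • X i).map conj = ∑ i, conj (c i) • (X i).map conj := by
  ext a b
  simp [Matrix.sum_apply]

/-- Complex conjugation exchanges the two halves of the bivectors if `det g < 0`. -/
theorem map_conj_mem_halfBivectors {g : Matrix (Fin 4) (Fin 4) ℝ} (hg : g.det < 0) {σ : ℤˣ}
    {X : Matrix (Fin 4) (Fin 4) ℂ} (hX : X ∈ halfBivectors g σ) :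
    X.map conj ∈ halfBivectors g (-σ) := by
  rw [halfBivectors, Module.End.mem_eigenspace_iff] at hX ⊢
  rw [hodgeStar, bivectorOp_map_conj, ← hodgeStar, hX]
  ext a b
  simp [dualEigenvalue, not_lt.mpr hg.le]

theorem IsFrame.finrank_halfBivectors {g : Matrix (Fin 4) (Fin 4) ℝ}
    {P R : Matrix (Fin 4) (Fin 4) ℂ} (h : IsFrame g P R) (σ : ℤˣ) :
    Module.finrank ℂ (halfBivectors g σ) = 3 := by
  rw [halfBivectors, dualEigenvalue_eq,
    ← (h.halfEquiv (intCast_units_mul_self σ)).finrank_eq]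
  simp

/-- If `det g < 0`, the two halves of a real operator have the same type. -/
theorem IsFrame.actsWithType_neg {g : Matrix (Fin 4) (Fin 4) ℝ} {P R : Matrix (Fin 4) (Fin 4) ℂ}
    (h : IsFrame g P R) (hg : g.det < 0) {K : Fin 4 → Fin 4 → Fin 4 → Fin 4 → ℝ} {σ : ℤˣ}
    {t : PetrovType} (ht : ActsWithType (bivectorOp g K) (halfBivectors g σ) t) :
    ActsWithType (bivectorOp g K) (halfBivectors g (-σ)) t := by
  obtain ⟨b, J, hJ, hb⟩ := ht
  -- The conjugate basis lies in the other half, and the operator is real, so its matrix there is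
  -- the conjugate matrix, which has the same type.
  let c : Fin 3 → halfBivectors g (-σ) := fun i =>
    ⟨(b i : Matrix (Fin 4) (Fin 4) ℂ).map conj, map_conj_mem_halfBivectors hg (b i).2⟩
  have hli : LinearIndependent ℂ c := by
    rw [Fintype.linearIndependent_iff]
    intro r hr i
    have h1 : ∑ i, r i • (b i : Matrix (Fin 4) (Fin 4) ℂ).map conj = 0 := by
      have := congrArg Subtype.val hr
      simpa [c] using this
    have h2 : ∑ i, conj (r i) • (b i : Matrix (Fin 4) (Fin 4) ℂ) = 0 := by
      have e := congrArg (fun X : Matrix (Fin 4) (Fin 4) ℂ => X.map conj) h1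
      simp only [map_conj_sum_smul, Matrix.map_map] at e
      have hcc : (conj : ℂ → ℂ) ∘ conj = id := funext Complex.conj_conj
      rw [hcc] at e
      simpa using e
    have h3 : ∑ i, conj (r i) • b i = 0 := by
      apply Subtype.ext
      simpa using h2
    have := Fintype.linearIndependent_iff.mp b.linearIndependent _ h3 i
    simpa using this
  refine ⟨basisOfLinearIndependentOfCardEqFinrank hli (by simp [h.finrank_halfBivectors]),
    J.map conj, map_conj_mem_normalForms hJ, fun j => ?_⟩
  simp only [coe_basisOfLinearIndependentOfCardEqFinrank, c]
  rw [bivectorOp_map_conj, hb, map_conj_sum_smul]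
  rfl

/-- A bivector is the sum of its two halves. -/
theorem halfPart_add_halfPart_neg (g Y : Matrix (Fin 4) (Fin 4) ℝ) :
    halfPart g 1 Y + halfPart g (-1) Y = Y.map Complex.ofReal := by
  have : dualEigenvalue g (-1) = -dualEigenvalue g 1 := by
    rw [dualEigenvalue_eq]
    simp
  rw [halfPart, halfPart, this, inv_neg]
  module

variable {M : Type u} [TopologicalSpace M] [ChartedSpace (E 4) M]
  {g : Metric 4 M} {Y : TwoForm 4 M} {e : OpenPartialHomeomorph M (E 4)} {x : M}

/-- A non-zero 2-form has a non-zero half at each point, and "frequently" distributes over a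
disjunction, so one and the same half is non-zero arbitrarily near `x`. -/
theorem exists_halfNonzeroNear (he : e ∈ charts 4 M) (hx : x ∈ e.source)
    (hY : ∃ᶠ z in 𝓝 x, Y.val z ≠ 0) : ∃ σ : ℤˣ, HalfNonzeroNear g Y e x σ := by
  have hf : ∃ᶠ z in 𝓝 x, halfPart (comp g.val e (e z)) 1 (comp Y.val e (e z)) ≠ 0 ∨
      halfPart (comp g.val e (e z)) (-1) (comp Y.val e (e z)) ≠ 0 := by
    refine (hY.and_eventually (e.open_source.mem_nhds hx)).mono ?_
    rintro z ⟨hz, hzs⟩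
    have hc : comp Y.val e (e z) ≠ 0 :=
      comp_ne_zero he (e.map_source hzs) (by rwa [e.left_inv hzs])
    by_contra! h0
    have := halfPart_add_halfPart_neg (comp g.val e (e z)) (comp Y.val e (e z))
    rw [h0.1, h0.2, add_zero] at this
    exact hc (by
      ext i j
      have := congrFun (congrFun this i) j
      simpa using this.symm)
  rcases frequently_or_distrib.mp hf with h | h
  exacts [⟨1, h⟩, ⟨-1, h⟩]

theorem det_neg_of_isLorentzianAt (he : e ∈ charts 4 M) (hx : x ∈ e.source)
    (h : IsLorentzianAt g x) : (comp g.val e (e x)).det < 0 := by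
  have key : ∀ η : Fin 4 → ℝ, ∏ i, η i = -1 → HasSignatureAt g x η →
      (comp g.val e (e x)).det < 0 := by
    intro η hη h
    obtain ⟨Q, hQ, e⟩ := comp_of_hasSignatureAt g he hx h
    rw [e, Matrix.det_mul, Matrix.det_mul, Matrix.det_transpose, Matrix.det_diagonal, hη]
    have := mul_self_pos.mpr hQ.ne_zero
    linarith
  rcases h with h | h
  · exact key _ (by simp [Fin.prod_univ_four]) h
  · exact key _ (by simp [Fin.prod_univ_four]) h

theorem IsCKY.exists_weylHasType_of_isLorentzianAt (h : IsCKY g Y) (he : e ∈ charts 4 M)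
    (hx : x ∈ e.source) (hL : IsLorentzianAt g x) (hY : ∃ᶠ z in 𝓝 x, Y.val z ≠ 0) :
    ∃ t ∈ ({.O, .N, .D} : Set PetrovType), WeylHasType g e x s(t, t) := by
  obtain ⟨σ, hσ⟩ := exists_halfNonzeroNear (g := g) he hx hY
  obtain ⟨t, ht, hT⟩ := h.exists_halfWeylHasType he hx hσ
  obtain ⟨P, R, hF⟩ := exists_isFrame_comp g he (e.map_source hx)
  have hT' : HalfWeylHasType g e x (-σ) t :=
    hF.actsWithType_neg (det_neg_of_isLorentzianAt he hx hL) hT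
  refine ⟨t, ht, t, t, ?_, ?_, rfl⟩
  · rcases Int.units_eq_one_or σ with rfl | rfl
    exacts [hT, by simpa using hT']
  · rcases Int.units_eq_one_or σ with rfl | rfl
    exacts [hT', hT]

/-! ### Definite signature: reality of the halves -/

theorem ctr_conj (r X : Fin 4 → ℂ) : conj (ctr r X) = ctr (fun a => conj (r a))
    fun a => conj (X a) := by
  simp only [ctr, map_sum, map_mul]

theorem ctr_mul_vec (τ : ℂ) (r X : Fin 4 → ℂ) : ctr (fun a => τ * r a) X = τ * ctr r X := by
  simp only [ctr, Finset.mul_sum, mul_assoc]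

/-- The four factors `R` contribute `τ⁴ = 1`, so the components are real even in the purely
imaginary frame of a negative definite metric. -/
theorem frameTensor_conj {R : Matrix (Fin 4) (Fin 4) ℂ} {τ : ℂ} (hτ : τ * τ = 1)
    (hR : R.map conj = τ • R) (K : Fin 4 → Fin 4 → Fin 4 → Fin 4 → ℝ) (a b c d : Fin 4) :
    conj (frameTensor R (fun a b c d => (K a b c d : ℂ)) a b c d) =
      frameTensor R (fun a b c d => (K a b c d : ℂ)) a b c d := by
  have hR' : ∀ i j, conj (R i j) = τ * R i j := fun i j => congrFun (congrFun hR i) j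
  simp only [frameTensor, ctr_conj, hR', ctr_mul_vec, ctr_mul_left, Complex.conj_ofReal]
  rw [← mul_assoc τ, ← mul_assoc (τ * τ), ← mul_assoc (τ * τ * τ), hτ, one_mul, hτ, one_mul]

theorem dualMatrix_conj {K : Fin 4 → Fin 4 → Fin 4 → Fin 4 → ℂ}
    (hK : ∀ a b c d, conj (K a b c d) = K a b c d) {s : ℂ} (hs : conj s = s) :
    (dualMatrix K s).map conj = dualMatrix K s := by
  have hq : ∀ i a b, conj (dualBasis s i a b) = dualBasis s i a b := by
    intro i a b
    fin_cases i <;> fin_cases a <;> fin_cases b <;> simp [dualBasis, hs]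
  ext i j
  simp only [dualMatrix, euclidOp, Matrix.map_apply, Matrix.of_apply, map_mul, map_sum, hK, hq,
    map_div₀, map_one, map_ofNat]

/-- A real symmetric matrix does not have the canonical form `N`. -/
theorem not_hasNormalForm_N {A : Matrix (Fin 3) (Fin 3) ℂ} (hs : A.transpose = A)
    (hc : A.map conj = A) : ¬ HasNormalForm (Matrix.toLin' A) .N := by
  rintro ⟨b, J, hJ, hb⟩
  rw [show J = _ from hJ] at hb
  have h0 : Matrix.toLin' A (b 0) = 0 := by rw [hb]; simp [Fin.sum_univ_three]
  have h1 : Matrix.toLin' A (b 1) = b 0 := by rw [hb]; simp [Fin.sum_univ_three]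
  have h2 : Matrix.toLin' A (b 2) = 0 := by rw [hb]; simp [Fin.sum_univ_three]
  have hAA : A * A = 0 := by
    apply Matrix.toLin'.injective
    refine b.ext fun i => ?_
    rw [Matrix.toLin'_mul, LinearMap.comp_apply]
    fin_cases i
    · simp only [Fin.zero_eta, h0, map_zero, LinearMap.zero_apply]
    · simp only [Fin.mk_one, h1, h0, map_zero, LinearMap.zero_apply]
    · simp only [Fin.reduceFinMk, h2, map_zero, LinearMap.zero_apply]
  have hA : A.conjTranspose = A := by
    rw [Matrix.conjTranspose, hs]
    exact hc
  -- A real symmetric matrix is Hermitian, so `A² = 0` reads `Aᴴ A = 0`.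
  have hz : A = 0 := Matrix.conjTranspose_mul_self_eq_zero.mp (by rw [hA, hAA])
  rw [hz, map_zero, LinearMap.zero_apply] at h1
  exact b.ne_zero 0 h1.symm

/-- In Euclidean signature there is a frame with real or purely imaginary components. -/
theorem exists_isFrame_map_conj (he : e ∈ charts 4 M) (hx : x ∈ e.source)
    (h : IsEuclideanAt g x) : ∃ P R, ∃ τ : ℂ, τ * τ = 1 ∧
      IsFrame (comp g.val e (e x)) P R ∧ R.map conj = τ • R := by
  have key : ∀ (η : Fin 4 → ℝ) (c τ : ℂ), (∀ i, c ^ 2 = η i) → τ * τ = 1 → conj c = τ * c →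
      HasSignatureAt g x η → ∃ P R, ∃ τ : ℂ, τ * τ = 1 ∧
        IsFrame (comp g.val e (e x)) P R ∧ R.map conj = τ • R := by
    intro η c τ hc hτ hcτ h
    obtain ⟨Q, -, hQ⟩ := comp_of_hasSignatureAt g he hx h
    obtain ⟨t, R, hF⟩ := exists_isFrame_of_diagonal (comp_det_ne_zero g he (e.map_source hx)) hQ
      (c := fun _ => c) hc
    refine ⟨_, R, τ, hτ, hF, ?_⟩
    set P := Matrix.diagonal (fun i => (t i : ℂ) * c) * Q.map Complex.ofReal with hP
    have hPc : P.map conj = τ • P := by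
      ext i j
      simp only [hP, Matrix.map_apply, Matrix.diagonal_mul, Matrix.smul_apply, map_mul, hcτ,
        Complex.conj_ofReal, smul_eq_mul]
      ring
    -- Conjugating `R P = 1` shows that the conjugate of `R` is inverse to `τ P`, hence equals `τ R`
    -- because `τ² = 1`.
    have h1 : R.map conj * (τ • P) = 1 := by
      rw [← hPc, ← Matrix.map_mul, hF.left_inv]
      simp
    calc R.map conj = R.map conj * (P * R) := by rw [hF.right_inv, Matrix.mul_one]
      _ = τ • (R.map conj * (τ • P) * R) := by
        rw [Matrix.mul_smul, Matrix.smul_mul, smul_smul, hτ, one_smul, ← Matrix.mul_assoc (R.map conj)]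
      _ = τ • R := by rw [h1, Matrix.one_mul]
  rcases h with h | h
  · exact key _ 1 1 (fun i => by fin_cases i <;> simp) (by simp) (by simp) h
  -- For the negative definite metric the square root of `-1` is `I`, whose conjugate is `-I`.
  · exact key _ Complex.I (-1) (fun i => by fin_cases i <;> simp) (by simp) (by simp) h

theorem IsCKY.exists_halfWeylHasType_of_isEuclideanAt (h : IsCKY g Y) (he : e ∈ charts 4 M)
    (hx : x ∈ e.source) (hE : IsEuclideanAt g x) {σ : ℤˣ} (hσ : HalfNonzeroNear g Y e x σ) :
    ∃ t ∈ ({.O, .D} : Set PetrovType), HalfWeylHasType g e x σ t := by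
  obtain ⟨P, R, τ, hτ, hF, hR⟩ := exists_isFrame_map_conj he hx hE
  obtain ⟨t, ht, hN⟩ := h.exists_hasNormalForm he hx hσ hF
  have hw := hF.isWeylLike (isWeylTensor g he (e.map_source hx))
  have hne : t ≠ .N := by
    rintro rfl
    exact not_hasNormalForm_N (hw.dualMatrix_transpose _)
      (dualMatrix_conj (frameTensor_conj hτ hR _) (by simp)) hN
  refine ⟨t, ?_, halfWeylHasType_of_hasNormalForm he hx hF hN⟩
  rcases ht with rfl | rfl | rfl
  exacts [Or.inl rfl, absurd rfl hne, Or.inr rfl]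

end Signature
end CKY

end

/-! ### The theorem -/

open CKY PetrovType in
theorem mainTheorem8 :
    (∀ (n : ℕ) (M : Type u) [TopologicalSpace M] [ChartedSpace (E n) M] [IsManifold (𝓡 n) ∞ M]
      (g : Metric n M) (Y : TwoForm n M), 3 ≤ n → IsCKY g Y →
      ∀ e ∈ charts n M, ∀ y ∈ e.target, ∀ a b c d : Fin n,
        ∑ f, (weylUp (comp g.val e) y f a c b * comp Y.val e y d f
            + weylUp (comp g.val e) y f b d a * comp Y.val e y c f
            + weylUp (comp g.val e) y f c a d * comp Y.val e y b f
            + weylUp (comp g.val e) y f d b c * comp Y.val e y a f) = 0) ∧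
    (∀ (M : Type u) [TopologicalSpace M] [ChartedSpace (E 4) M] [IsManifold (𝓡 4) ∞ M]
      (g : Metric 4 M) (Y : TwoForm 4 M), IsCKY g Y →
      ∀ e ∈ charts 4 M, ∀ x ∈ e.source,
        (∀ σ : ℤˣ, HalfNonzeroNear g Y e x σ →
          ∃ t ∈ ({O, N, D} : Set PetrovType), HalfWeylHasType g e x σ t) ∧
        (HalfNonzeroNear g Y e x 1 → HalfNonzeroNear g Y e x (-1) →
          ∃ w ∈ ({s(O, O), s(O, N), s(O, D), s(N, N), s(N, D), s(D, D)} : Set (Sym2 PetrovType)),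
            WeylHasType g e x w) ∧
        (IsLorentzianAt g x → (∃ᶠ z in 𝓝 x, Y.val z ≠ 0) →
          ∃ t ∈ ({O, N, D} : Set PetrovType), WeylHasType g e x s(t, t)) ∧
        (IsEuclideanAt g x → HalfNonzeroNear g Y e x 1 → HalfNonzeroNear g Y e x (-1) →
          ∃ w ∈ ({s(O, O), s(O, D), s(D, D)} : Set (Sym2 PetrovType)), WeylHasType g e x w)) := by
  refine ⟨?_, ?_⟩
  · intro n M _ _ _ g Y hn h e he y hy a b c d
    exact h.curvatureAction_weyl hn he hy a b c d
  · intro M _ _ _ g Y h e he x hx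
    refine ⟨fun σ hσ => h.exists_halfWeylHasType he hx hσ, fun h1 h2 => ?_,
      fun hL hY => h.exists_weylHasType_of_isLorentzianAt he hx hL hY, fun hE h1 h2 => ?_⟩
    · obtain ⟨t₁, ht₁, hT₁⟩ := h.exists_halfWeylHasType he hx h1
      obtain ⟨t₂, ht₂, hT₂⟩ := h.exists_halfWeylHasType he hx h2
      refine ⟨s(t₁, t₂), ?_, t₁, t₂, hT₁, hT₂, rfl⟩
      -- The nine ordered pairs reduce to six because `Sym2` forgets the order.
      rcases ht₁ with rfl | rfl | rfl <;> rcases ht₂ with rfl | rfl | rfl <;> simp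
    · obtain ⟨t₁, ht₁, hT₁⟩ := h.exists_halfWeylHasType_of_isEuclideanAt he hx hE h1
      obtain ⟨t₂, ht₂, hT₂⟩ := h.exists_halfWeylHasType_of_isEuclideanAt he hx hE h2
      refine ⟨s(t₁, t₂), ?_, t₁, t₂, hT₁, hT₂, rfl⟩
      rcases ht₁ with rfl | rfl <;> rcases ht₂ with rfl | rfl <;> simp
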